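/- Let $\Gamma=\Gamma^{4,4}$ be an even unimodular lattice of signature $(4,4)$, let $\Pi=\Gamma\otimes\mathbb R$ carry the real extension of its bilinear form, and let $\Pi=\Pi_L\oplus_\perp\Pi_R$ be an orthogonal decomposition into a positive definite subspace $\Pi_L$ and a negative definite subspace $\Pi_R$ (necessarily both of dimension $4$); these data $\Gamma^{4,4}_{\text{w-m}}=(\Gamma,\Pi_L,\Pi_R)$ are the winding-momentum lattice of a four-torus sigma model. Identify $\Pi_L$, and $\Pi_R$ with the sign of its form reversed, isometrically with $\mathbb C^2=\mathbb R^4$, and let $SU(2)^A_L\subset SO(\Pi_L)$ and $SU(2)^A_R\subset SO(\Pi_R)$ be the groups that correspond to $SU(2)$ in its defining action on $\mathbb C^2$. Let $SU(2)^A_L\times SU(2)^A_R$ act on $\Pi=\Pi_L\oplus\Pi_R$ componentwise, let $O(\Gamma)$ be the group of linear isometries of $\Pi$ that map $\Gamma$ onto itself, and put $$G_0=\left(SU(2)^A_L\times SU(2)^A_R\right)\cap O(\Gamma).$$ Let $W(E_8)$ be the Weyl group of the $E_8$ root system in $\mathbb R^8$, that is, the group generated by the reflections in the roots, and let $W^+(E_8)$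 be its subgroup of elements of determinant $1$. Then $G_0$ is isomorphic to a subgroup of $W^+(E_8)$. -/

import Mathlib

open scoped TensorProduct Matrix

/-- A symmetric bilinear form on a free `ℤ`-module of finite rank is *even unimodular* if all
`B x x` are even and `B` identifies the module with its dual. -/
structure IsEvenUnimodular {Γ : Type*} [AddCommGroup Γ] (B : LinearMap.BilinForm ℤ Γ) : Prop where
  symm : ∀ x y, B x y = B y x
  even : ∀ x, Even (B x x)
  unimodular : Function.Bijective (B : Γ →ₗ[ℤ] Module.Dual ℤ Γ)

/-- An orthogonal decomposition `Π = Π_L ⊕ Π_R` of `Π = ℝ ⊗ Γ` (with the extended form) into a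
positive definite subspace and a negative definite subspace, both of dimension four. A lattice
has such a decomposition iff its signature is `(4,4)`; the lattice together with the
decomposition is the winding-momentum (Narain) lattice of a four-torus sigma model. -/
structure NarainDecomposition {Γ : Type*} [AddCommGroup Γ] (B : LinearMap.BilinForm ℤ Γ) where
  left : Submodule ℝ (ℝ ⊗[ℤ] Γ)
  right : Submodule ℝ (ℝ ⊗[ℤ] Γ)
  isCompl : IsCompl left right
  finrank_left : Module.finrank ℝ left = 4
  finrank_right : Module.finrank ℝ right = 4
  orthogonal : ∀ x ∈ left, ∀ y ∈ right, B.baseChange ℝ x y = 0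
  pos : ∀ x ∈ left, x ≠ 0 → 0 < B.baseChange ℝ x x
  neg : ∀ y ∈ right, y ≠ 0 → B.baseChange ℝ y y < 0

namespace NarainDecomposition

variable {Γ : Type*} [AddCommGroup Γ] {B : LinearMap.BilinForm ℤ Γ}

/-- Isometric identifications of `Π_L` and of `Π_R` (with the sign of its form reversed) with
`ℂ² = ℝ⁴`. In real coordinates `x¹, …, x⁴` with respect to an orthonormal basis, corresponding
to the four fermions `ψ¹, …, ψ⁴`, they are `(x¹ + i x³, x² + i x⁴)`. -/
structure ComplexFrame (D : NarainDecomposition B) where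
  toL : D.left ≃ₗ[ℝ] (Fin 2 → ℂ)
  toR : D.right ≃ₗ[ℝ] (Fin 2 → ℂ)
  normSq_toL : ∀ x : D.left,
    ∑ i, Complex.normSq (toL x i) = B.baseChange ℝ (x : ℝ ⊗[ℤ] Γ) (x : ℝ ⊗[ℤ] Γ)
  normSq_toR : ∀ y : D.right,
    ∑ i, Complex.normSq (toR y i) = - B.baseChange ℝ (y : ℝ ⊗[ℤ] Γ) (y : ℝ ⊗[ℤ] Γ)

/-- The group `SU(2)_L^A × SU(2)_R^A`, acting on `Π = Π_L ⊕ Π_R`: on each summand, `SU(2)` acts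
by its defining representation on the complex doublet `(χ¹, χ²)`. In `SO(Π_L) ≅ SO(4)` this is one
of the two normal `SU(2)` subgroups (the other one being the R-symmetry `SU(2)_L^J`), and likewise
on the right. It depends on the frame only through the induced orientations. -/
def SU2A {D : NarainDecomposition B} (F : D.ComplexFrame) :
    Subgroup ((ℝ ⊗[ℤ] Γ) ≃ₗ[ℝ] (ℝ ⊗[ℤ] Γ)) where
  carrier := {g | ∃ u ∈ Matrix.specialUnitaryGroup (Fin 2) ℂ,
    ∃ v ∈ Matrix.specialUnitaryGroup (Fin 2) ℂ,
      (∀ x : D.left, g (x : ℝ ⊗[ℤ] Γ) = (F.toL.symm (u *ᵥ F.toL x) : D.left)) ∧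
      (∀ y : D.right, g (y : ℝ ⊗[ℤ] Γ) = (F.toR.symm (v *ᵥ F.toR y) : D.right))}
  one_mem' := ⟨1, one_mem _, 1, one_mem _, by simp, by simp⟩
  mul_mem' := by
    rintro g h ⟨u, hu, v, hv, h1, h2⟩ ⟨u', hu', v', hv', h1', h2'⟩
    refine ⟨u * u', mul_mem hu hu', v * v', mul_mem hv hv', fun x => ?_, fun y => ?_⟩
    · rw [LinearEquiv.mul_apply, h1', h1, LinearEquiv.apply_symm_apply, Matrix.mulVec_mulVec]
    · rw [LinearEquiv.mul_apply, h2', h2, LinearEquiv.apply_symm_apply, Matrix.mulVec_mulVec]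
  inv_mem' := by
    rintro g ⟨u, hu, v, hv, h1, h2⟩
    have key : ∀ w ∈ Matrix.specialUnitaryGroup (Fin 2) ℂ,
        star w ∈ Matrix.specialUnitaryGroup (Fin 2) ℂ ∧ w * star w = 1 := fun w hw =>
      ⟨Matrix.mem_specialUnitaryGroup_iff.2
        ⟨Unitary.star_mem (Matrix.mem_specialUnitaryGroup_iff.1 hw).1, by
          rw [Matrix.star_eq_conjTranspose, Matrix.det_conjTranspose,
            (Matrix.mem_specialUnitaryGroup_iff.1 hw).2, star_one]⟩,
        Matrix.mem_unitaryGroup_iff.1 (Matrix.mem_specialUnitaryGroup_iff.1 hw).1⟩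
    refine ⟨star u, (key u hu).1, star v, (key v hv).1, fun x => ?_, fun y => ?_⟩
    · apply g.injective
      rw [h1, LinearEquiv.apply_symm_apply, Matrix.mulVec_mulVec, (key u hu).2, Matrix.one_mulVec,
        LinearEquiv.symm_apply_apply]
      exact g.apply_symm_apply _
    · apply g.injective
      rw [h2, LinearEquiv.apply_symm_apply, Matrix.mulVec_mulVec, (key v hv).2, Matrix.one_mulVec,
        LinearEquiv.symm_apply_apply]
      exact g.apply_symm_apply _

end NarainDecomposition

/-- The group `O(Γ)` of isometries of the lattice `Γ`, as a group of linear automorphisms of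
`Π = ℝ ⊗ Γ`: those that preserve the form and map the lattice onto itself. -/
def latticeO {Γ : Type*} [AddCommGroup Γ] (B : LinearMap.BilinForm ℤ Γ) :
    Subgroup ((ℝ ⊗[ℤ] Γ) ≃ₗ[ℝ] (ℝ ⊗[ℤ] Γ)) where
  carrier := {g | (∀ x y, B.baseChange ℝ (g x) (g y) = B.baseChange ℝ x y) ∧
    ∃ f : Γ ≃ₗ[ℤ] Γ, ∀ k : Γ, g ((1 : ℝ) ⊗ₜ[ℤ] k) = (1 : ℝ) ⊗ₜ[ℤ] f k}
  one_mem' := ⟨fun _ _ => rfl, 1, fun _ => rfl⟩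
  mul_mem' := by
    rintro g h ⟨hg, f, hf⟩ ⟨hh, f', hf'⟩
    refine ⟨fun x y => ?_, f * f', fun k => ?_⟩
    · rw [LinearEquiv.mul_apply, LinearEquiv.mul_apply, hg, hh]
    · rw [LinearEquiv.mul_apply, hf', hf]; rfl
  inv_mem' := by
    rintro g ⟨hg, f, hf⟩
    refine ⟨fun x y => ?_, f⁻¹, fun k => ?_⟩
    · rw [← hg]
      exact congrArg₂ (fun a b => B.baseChange ℝ a b) (g.apply_symm_apply x) (g.apply_symm_apply y)
    · apply g.injective
      rw [hf]
      exact (g.apply_symm_apply _).trans (congrArg _ (f.apply_symm_apply k).symm)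

/-- `G₀ = (SU(2)_L^A × SU(2)_R^A) ∩ O(Γ)`. -/
def NarainDecomposition.G0 {Γ : Type*} [AddCommGroup Γ] {B : LinearMap.BilinForm ℤ Γ}
    {D : NarainDecomposition B} (F : D.ComplexFrame) :
    Subgroup ((ℝ ⊗[ℤ] Γ) ≃ₗ[ℝ] (ℝ ⊗[ℤ] Γ)) :=
  NarainDecomposition.SU2A F ⊓ latticeO B

/-- The `E₈` lattice in `ℝ⁸`: the coordinates are all integers or all half-integers, and their
sum is an even integer. -/
def E8Lattice : Set (Fin 8 → ℝ) :=
  {v | ((∀ i, ∃ n : ℤ, v i = n) ∨ (∀ i, ∃ n : ℤ, v i = n + 1 / 2)) ∧ ∃ n : ℤ, ∑ i, v i = 2 * n}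

/-- The roots of `E₈`: the lattice vectors of square length two. -/
def E8Roots : Set (Fin 8 → ℝ) :=
  {v | v ∈ E8Lattice ∧ v ⬝ᵥ v = 2}

/-- The Weyl group of `E₈`, generated by the reflections in the roots. -/
def WeylE8 : Subgroup ((Fin 8 → ℝ) ≃ₗ[ℝ] (Fin 8 → ℝ)) :=
  Subgroup.closure {s | ∃ α ∈ E8Roots, ∀ x, s x = x - (α ⬝ᵥ x) • α}

/-- `W⁺(E₈)`: the elements of the Weyl group of determinant one. -/
noncomputable def WPlusE8 : Subgroup ((Fin 8 → ℝ) ≃ₗ[ℝ] (Fin 8 → ℝ)) :=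
  WeylE8 ⊓ (LinearEquiv.det : ((Fin 8 → ℝ) ≃ₗ[ℝ] (Fin 8 → ℝ)) →* ℝˣ).ker

/-! Write ℂ² as the quaternions so that SU(2) acts by left multiplication. Then G₀ becomes a group
of pairs (a, b) of unit quaternions, with a acting on Π_L and b on Π_R. It suffices that the pairs
preserving Γ act faithfully and orthogonally on ℝ⁸ so as to preserve the E₈ lattice: the orthogonal
group of that lattice is the Weyl group (`e8Orthogonal_le_WeylE8`), and the determinants are one
because unit quaternions are squares (`IsOrthogonalModel.exists_mulEquiv`).

The lattice Γ is used only to obtain the properties in `IsAdmissible`. If g acts by (a, b), then g +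
g⁻¹ preserves Γ and is the scalar t = 2 Re a on Π_L and s = 2 Re b on Π_R. These are algebraic
integers, and since traces on Γ are integers, t + s and t s are rational, hence integers. As |t|,
|s| ≤ 2, either both are integers or they are, up to sign, √2 and -√2, √3 and -√3, or the golden
ratio and its conjugate in some order (`conjugates_cases`). Even unimodularity also forbids two
configurations. A pair (a, 1) with a of order six would split off a definite even unimodular lattice
of rank four, against Minkowski's theorem (`IsNarainPair.not_sixth`). If (-1, 1) is a symmetry, a
binary dihedral group of order twelve on one side would contradict unimodularity at the prime 3
(`IsNarainPair.not_dicyclic`).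

On the E₈ side, two anticommuting complex structures give an action λ of the quaternions on ℝ⁸, and
a projection E commuting with them gives the action λ(a) E + λ(b) (1 - E) of pairs. For E = (1 +
S/√n)/2 this is (λ(a) + λ(b))/2 + (λ(a) - λ(b)) S/(2√n), which is rational if λ is, S is an integral
matrix, and the coordinates of a and b are conjugate in ℚ(√n). Models of this kind for n = 1, 2, 3,
5, and one more adapted to cube roots of unity, suffice.

`IsAdmissible.isE8Embeddable` is a case division. If (-1, 1) is present, or if left and right traces
are equal integers and there is no binary dihedral group of order twelve, both sides can be
conjugated into the Hurwitz units, congruent modulo 1 + i, and `PairData.split` applies. A cube root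
of unity on one side only, or a binary dihedral group of order twelve with equal integral traces,
leads to `PairData.bihexagonal`. Otherwise some surd occurs, and only one of √2, √3, √5 can, because
tr x tr y = tr(xy) + tr(xy*) has an integral sum over the two sides; the model over that field
applies. Coordinates are found throughout as traces against an orthonormal frame, taken from the
group whenever it contains one. -/

open scoped Quaternion

/-! ### The orthogonal group of the E₈ lattice is its Weyl group. -/

section E8

theorem E8Lattice.add_mem {v w : Fin 8 → ℝ} (hv : v ∈ E8Lattice) (hw : w ∈ E8Lattice) :
    v + w ∈ E8Lattice := by
  obtain ⟨hv, a, ha⟩ := hv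
  obtain ⟨hw, b, hb⟩ := hw
  refine ⟨?_, a + b, by simp [Finset.sum_add_distrib, ha, hb]; ring⟩
  rcases hv with hv | hv <;> rcases hw with hw | hw
  · left; intro i
    obtain ⟨m, hm⟩ := hv i; obtain ⟨n, hn⟩ := hw i
    exact ⟨m + n, by simp [hm, hn]⟩
  · right; intro i
    obtain ⟨m, hm⟩ := hv i; obtain ⟨n, hn⟩ := hw i
    exact ⟨m + n, by simp [hm, hn]; ring⟩
  · right; intro i
    obtain ⟨m, hm⟩ := hv i; obtain ⟨n, hn⟩ := hw i
    exact ⟨m + n, by simp [hm, hn]; ring⟩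
  · left; intro i
    obtain ⟨m, hm⟩ := hv i; obtain ⟨n, hn⟩ := hw i
    exact ⟨m + n + 1, by simp [hm, hn]; ring⟩

theorem E8Lattice.neg_mem {v : Fin 8 → ℝ} (hv : v ∈ E8Lattice) : -v ∈ E8Lattice := by
  obtain ⟨hv, a, ha⟩ := hv
  refine ⟨?_, -a, by simp [ha]⟩
  rcases hv with hv | hv
  · left; intro i
    obtain ⟨m, hm⟩ := hv i
    exact ⟨-m, by simp [hm]⟩
  · right; intro i
    obtain ⟨m, hm⟩ := hv i
    exact ⟨-m - 1, by simp [hm]; ring⟩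

theorem E8Lattice.zero_mem : (0 : Fin 8 → ℝ) ∈ E8Lattice :=
  ⟨Or.inl fun _ => ⟨0, by simp⟩, 0, by simp⟩

/-- The `E₈` lattice as an additive subgroup. -/
def e8AddSubgroup : AddSubgroup (Fin 8 → ℝ) where
  carrier := E8Lattice
  add_mem' := E8Lattice.add_mem
  zero_mem' := E8Lattice.zero_mem
  neg_mem' := E8Lattice.neg_mem

theorem E8Lattice.zsmul_mem {v : Fin 8 → ℝ} (hv : v ∈ E8Lattice) (n : ℤ) :
    (n : ℝ) • v ∈ E8Lattice := by
  have := e8AddSubgroup.zsmul_mem hv n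
  rwa [← Int.cast_smul_eq_zsmul ℝ] at this

theorem E8Lattice.dot_int {v w : Fin 8 → ℝ} (hv : v ∈ E8Lattice) (hw : w ∈ E8Lattice) :
    ∃ n : ℤ, v ⬝ᵥ w = n := by
  obtain ⟨hv, a, ha⟩ := hv
  obtain ⟨hw, b, hb⟩ := hw
  rcases hv with hv | hv <;> choose m hm using hv <;> rcases hw with hw | hw <;>
    choose n hn using hw
  · exact ⟨∑ i, m i * n i, by simp [dotProduct, hm, hn]⟩
  · refine ⟨∑ i, m i * n i + a, ?_⟩
    simp only [hm] at ha
    simp [dotProduct, hm, hn, mul_add, Finset.sum_add_distrib]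
    rw [← Finset.sum_mul, ha]; ring
  · refine ⟨∑ i, m i * n i + b, ?_⟩
    simp only [hn] at hb
    simp [dotProduct, hm, hn, add_mul, Finset.sum_add_distrib]
    rw [← Finset.mul_sum, hb]; ring
  -- Here ∑ m = 2a - 4 and ∑ n = 2b - 4, so the cross terms and the eight quarters contribute (∑ m +
  -- ∑ n)/2 + 2 = a + b - 2.
  · refine ⟨∑ i, m i * n i + a + b - 2, ?_⟩
    simp only [hm, hn, Fin.sum_univ_eight] at ha hb
    simp only [dotProduct, hm, hn, Fin.sum_univ_eight]
    push_cast
    linarith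

/-- Twice the simple roots of `E₈`, in Bourbaki's order. -/
def e8Simple2 : Fin 8 → Fin 8 → ℤ :=
  ![![1, -1, -1, -1, -1, -1, -1, 1], ![2, 2, 0, 0, 0, 0, 0, 0], ![-2, 2, 0, 0, 0, 0, 0, 0],
    ![0, -2, 2, 0, 0, 0, 0, 0], ![0, 0, -2, 2, 0, 0, 0, 0], ![0, 0, 0, -2, 2, 0, 0, 0],
    ![0, 0, 0, 0, -2, 2, 0, 0], ![0, 0, 0, 0, 0, -2, 2, 0]]

/-- The Weyl vector of `E₈`. -/
def e8RhoZ : Fin 8 → ℤ := ![0, 1, 2, 3, 4, 5, 6, 23]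

/-- The coefficients of the Weyl vector with respect to the simple roots. -/
def e8RhoCoeff : Fin 8 → ℤ := ![46, 68, 91, 135, 110, 84, 57, 29]

noncomputable def e8Simple (i : Fin 8) : Fin 8 → ℝ := fun j => (e8Simple2 i j : ℝ) / 2

noncomputable def e8Rho : Fin 8 → ℝ := fun j => (e8RhoZ j : ℝ)

theorem e8Simple_dot (i j : Fin 8) :
    e8Simple i ⬝ᵥ e8Simple j = ((∑ k, e8Simple2 i k * e8Simple2 j k : ℤ) : ℝ) / 4 := by
  simp only [dotProduct, e8Simple, Int.cast_sum, Int.cast_mul, Finset.sum_div]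
  exact Finset.sum_congr rfl fun k _ => by ring

theorem e8Rho_dot_simple (i : Fin 8) : e8Rho ⬝ᵥ e8Simple i = 1 := by
  have h : ∀ i, ∑ k, e8RhoZ k * e8Simple2 i k = 2 := by decide
  have := congrArg (Int.cast : ℤ → ℝ) (h i)
  simp only [Int.cast_sum, Int.cast_mul] at this
  simp only [dotProduct, e8Simple, e8Rho, mul_div_assoc', ← Finset.sum_div]
  rw [this]; norm_num

theorem e8Rho_eq_sum : e8Rho = ∑ i, (e8RhoCoeff i : ℝ) • e8Simple i := by
  have h : ∀ j, 2 * e8RhoZ j = ∑ i, e8RhoCoeff i * e8Simple2 i j := by decide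
  ext j
  have := congrArg (Int.cast : ℤ → ℝ) (h j)
  simp only [Int.cast_sum, Int.cast_mul] at this
  simp only [e8Rho, Finset.sum_apply, Pi.smul_apply, e8Simple, smul_eq_mul, mul_div_assoc',
    ← Finset.sum_div]
  rw [← this]; norm_num

theorem e8Rho_mem : e8Rho ∈ E8Lattice := by
  refine ⟨Or.inl fun i => ⟨e8RhoZ i, rfl⟩, 22, ?_⟩
  have h : ∑ k, e8RhoZ k = 44 := by decide
  have := congrArg (Int.cast : ℤ → ℝ) h
  simp only [Int.cast_sum] at this
  simp only [e8Rho]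
  rw [this]; norm_num

theorem e8Simple_mem (i : Fin 8) : e8Simple i ∈ E8Lattice := by
  have h : ∀ i, ((∀ j, e8Simple2 i j = 2 * (e8Simple2 i j / 2)) ∨
      (∀ j, e8Simple2 i j = 2 * (e8Simple2 i j / 2) + 1)) ∧
      ∑ j, e8Simple2 i j = 4 * ((∑ j, e8Simple2 i j) / 4) := by decide
  obtain ⟨h1, h2⟩ := h i
  refine ⟨?_, (∑ j, e8Simple2 i j) / 4, ?_⟩
  · rcases h1 with h1 | h1
    · left; intro j
      refine ⟨e8Simple2 i j / 2, ?_⟩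
      have := congrArg (Int.cast : ℤ → ℝ) (h1 j)
      push_cast at this
      simp only [e8Simple]; linarith
    · right; intro j
      refine ⟨e8Simple2 i j / 2, ?_⟩
      have := congrArg (Int.cast : ℤ → ℝ) (h1 j)
      push_cast at this
      simp only [e8Simple]; linarith
  · have := congrArg (Int.cast : ℤ → ℝ) h2
    simp only [Int.cast_sum, Int.cast_mul, Int.cast_ofNat] at this
    simp only [e8Simple, ← Finset.sum_div]
    rw [this]; ring

theorem e8Simple_mem_roots (i : Fin 8) : e8Simple i ∈ E8Roots := by
  refine ⟨e8Simple_mem i, ?_⟩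
  have h : ∀ i, ∑ k, e8Simple2 i k * e8Simple2 i k = 8 := by decide
  rw [e8Simple_dot, h]; norm_num

/-- Integral roots have coordinates -1, 0, 1, encoded in `Fin 3`, so regularity and the list of
roots of height one are a finite check. The coordinate `a` is absent from the height because the
Weyl vector starts with 0. -/
theorem e8_int_root_rho :
    ∀ a b c d e f g h : Fin 3, ((a : ℤ) - 1)^2 + ((b : ℤ) - 1)^2 + ((c : ℤ) - 1)^2 +
      ((d : ℤ) - 1)^2 + ((e : ℤ) - 1)^2 + ((f : ℤ) - 1)^2 + ((g : ℤ) - 1)^2 + ((h : ℤ) - 1)^2 = 2 →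
      (((b : ℤ) - 1) + 2 * ((c : ℤ) - 1) + 3 * ((d : ℤ) - 1) + 4 * ((e : ℤ) - 1) +
        5 * ((f : ℤ) - 1) + 6 * ((g : ℤ) - 1) + 23 * ((h : ℤ) - 1) ≠ 0) ∧
      (((b : ℤ) - 1) + 2 * ((c : ℤ) - 1) + 3 * ((d : ℤ) - 1) + 4 * ((e : ℤ) - 1) +
        5 * ((f : ℤ) - 1) + 6 * ((g : ℤ) - 1) + 23 * ((h : ℤ) - 1) = 1 →
        ∃ i, ∀ j, e8Simple2 i j = (![2 * ((a : ℤ) - 1), 2 * ((b : ℤ) - 1), 2 * ((c : ℤ) - 1),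
          2 * ((d : ℤ) - 1), 2 * ((e : ℤ) - 1), 2 * ((f : ℤ) - 1), 2 * ((g : ℤ) - 1),
          2 * ((h : ℤ) - 1)] : Fin 8 → ℤ) j) := by
  decide +kernel

/-- The half-integral roots are treated after doubling: height one reads 2, and the even coordinate
sum becomes divisibility by 4. -/
theorem e8_half_root_rho :
    ∀ a b c d e f g h : Fin 2,
      ((2 * (b : ℤ) - 1) + 2 * (2 * (c : ℤ) - 1) + 3 * (2 * (d : ℤ) - 1) + 4 * (2 * (e : ℤ) - 1) +
        5 * (2 * (f : ℤ) - 1) + 6 * (2 * (g : ℤ) - 1) + 23 * (2 * (h : ℤ) - 1) ≠ 0) ∧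
      (((2 * (a : ℤ) - 1) + (2 * (b : ℤ) - 1) + (2 * (c : ℤ) - 1) + (2 * (d : ℤ) - 1) +
          (2 * (e : ℤ) - 1) + (2 * (f : ℤ) - 1) + (2 * (g : ℤ) - 1) + (2 * (h : ℤ) - 1)) % 4 = 0 →
        (2 * (b : ℤ) - 1) + 2 * (2 * (c : ℤ) - 1) + 3 * (2 * (d : ℤ) - 1) + 4 * (2 * (e : ℤ) - 1) +
        5 * (2 * (f : ℤ) - 1) + 6 * (2 * (g : ℤ) - 1) + 23 * (2 * (h : ℤ) - 1) = 2 →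
        ∃ i, ∀ j, e8Simple2 i j = (![2 * (a : ℤ) - 1, 2 * (b : ℤ) - 1, 2 * (c : ℤ) - 1,
          2 * (d : ℤ) - 1, 2 * (e : ℤ) - 1, 2 * (f : ℤ) - 1, 2 * (g : ℤ) - 1,
          2 * (h : ℤ) - 1] : Fin 8 → ℤ) j) := by
  decide +kernel

theorem exists_fin_three_of_sq_le {n : ℤ} (h : n ^ 2 ≤ 2) : ∃ a : Fin 3, n = (a : ℤ) - 1 := by
  have h1 : -1 ≤ n := by nlinarith
  have h2 : n ≤ 1 := by nlinarith
  interval_cases n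
  exacts [⟨0, rfl⟩, ⟨1, rfl⟩, ⟨2, rfl⟩]

theorem exists_fin_two_of_sq {n : ℤ} (h : n ^ 2 = 1) : ∃ a : Fin 2, n = 2 * (a : ℤ) - 1 := by
  rcases sq_eq_one_iff.mp h with h | h
  · exact ⟨1, h⟩
  · exact ⟨0, h⟩

/-- The Weyl vector is regular, and the roots of height one are the simple roots. -/
theorem e8Rho_dot_root {β : Fin 8 → ℝ} (hβ : β ∈ E8Roots) :
    e8Rho ⬝ᵥ β ≠ 0 ∧ (e8Rho ⬝ᵥ β = 1 → ∃ i, β = e8Simple i) := by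
  obtain ⟨⟨hβ, s, hs⟩, hn⟩ := hβ
  rcases hβ with hβ | hβ
  · choose n hβ using hβ
    have hsq : n 0 ^ 2 + n 1 ^ 2 + n 2 ^ 2 + n 3 ^ 2 + n 4 ^ 2 + n 5 ^ 2 + n 6 ^ 2 + n 7 ^ 2 = 2 := by
      simp only [dotProduct, hβ, Fin.sum_univ_eight] at hn
      have : ((n 0 ^ 2 + n 1 ^ 2 + n 2 ^ 2 + n 3 ^ 2 + n 4 ^ 2 + n 5 ^ 2 + n 6 ^ 2 + n 7 ^ 2 : ℤ) : ℝ)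
          = (2 : ℤ) := by
        push_cast; linarith
      exact_mod_cast this
    have hle : ∀ i, n i ^ 2 ≤ 2 := by
      intro i
      fin_cases i <;> simp only [Fin.zero_eta, Fin.mk_one, Fin.reduceFinMk] <;>
        linarith [sq_nonneg (n 0), sq_nonneg (n 1), sq_nonneg (n 2), sq_nonneg (n 3),
          sq_nonneg (n 4), sq_nonneg (n 5), sq_nonneg (n 6), sq_nonneg (n 7)]
    have hex := fun i => exists_fin_three_of_sq_le (hle i)
    choose a ha using hex
    have key := e8_int_root_rho (a 0) (a 1) (a 2) (a 3) (a 4) (a 5) (a 6) (a 7)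
    simp only [← ha] at key
    obtain ⟨k1, k2⟩ := key hsq
    have hdot : e8Rho ⬝ᵥ β = ((n 1 + 2 * n 2 + 3 * n 3 + 4 * n 4 + 5 * n 5 + 6 * n 6 + 23 * n 7 : ℤ)
        : ℝ) := by
      simp only [dotProduct, e8Rho, hβ, Fin.sum_univ_eight]
      simp [e8RhoZ]
    rw [hdot]
    refine ⟨by exact_mod_cast k1, fun h1 => ?_⟩
    obtain ⟨i, hi⟩ := k2 (by exact_mod_cast h1)
    refine ⟨i, ?_⟩
    ext j
    rw [e8Simple, hi, hβ]
    fin_cases j <;> simp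
  · choose n hβ using hβ
    have hβ' : ∀ i, β i = ((2 * n i + 1 : ℤ) : ℝ) / 2 := fun i => by rw [hβ]; push_cast; ring
    obtain ⟨m, hm⟩ : ∃ m : Fin 8 → ℤ, ∀ i, 2 * n i + 1 = m i := ⟨_, fun _ => rfl⟩
    simp only [hm] at hβ'
    have hsq : m 0 ^ 2 + m 1 ^ 2 + m 2 ^ 2 + m 3 ^ 2 + m 4 ^ 2 + m 5 ^ 2 + m 6 ^ 2 + m 7 ^ 2 = 8 := by
      simp only [dotProduct, hβ', Fin.sum_univ_eight] at hn
      have : ((m 0 ^ 2 + m 1 ^ 2 + m 2 ^ 2 + m 3 ^ 2 + m 4 ^ 2 + m 5 ^ 2 + m 6 ^ 2 + m 7 ^ 2 : ℤ) : ℝ)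
          = (8 : ℤ) := by
        push_cast; linarith
      exact_mod_cast this
    have hge : ∀ i, 1 ≤ m i ^ 2 := by
      intro i
      have : m i ≠ 0 := by have := hm i; omega
      have := sq_pos_of_ne_zero this
      omega
    have hone : ∀ i, m i ^ 2 = 1 := by
      have := hge 0; have := hge 1; have := hge 2; have := hge 3
      have := hge 4; have := hge 5; have := hge 6; have := hge 7
      intro i
      fin_cases i <;> simp only [Fin.zero_eta, Fin.mk_one, Fin.reduceFinMk] <;> linarith
    have hex := fun i => exists_fin_two_of_sq (hone i)
    choose a ha using hex
    have key := e8_half_root_rho (a 0) (a 1) (a 2) (a 3) (a 4) (a 5) (a 6) (a 7)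
    simp only [← ha] at key
    obtain ⟨k1, k2⟩ := key
    have hsum : (m 0 + m 1 + m 2 + m 3 + m 4 + m 5 + m 6 + m 7) % 4 = 0 := by
      simp only [hβ', Fin.sum_univ_eight] at hs
      have : ((m 0 + m 1 + m 2 + m 3 + m 4 + m 5 + m 6 + m 7 : ℤ) : ℝ) = (4 * s : ℤ) := by
        push_cast; linarith
      have : m 0 + m 1 + m 2 + m 3 + m 4 + m 5 + m 6 + m 7 = 4 * s := by exact_mod_cast this
      omega
    have hdot : e8Rho ⬝ᵥ β = ((m 1 + 2 * m 2 + 3 * m 3 + 4 * m 4 + 5 * m 5 + 6 * m 6 + 23 * m 7 : ℤ)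
        : ℝ) / 2 := by
      simp only [dotProduct, e8Rho, hβ', Fin.sum_univ_eight]
      simp [e8RhoZ]; ring
    rw [hdot]
    refine ⟨div_ne_zero (by exact_mod_cast k1) two_ne_zero, fun h1 => ?_⟩
    rw [div_eq_one_iff_eq two_ne_zero] at h1
    obtain ⟨i, hi⟩ := k2 hsum (by exact_mod_cast h1)
    refine ⟨i, ?_⟩
    ext j
    rw [e8Simple, hi, hβ']
    fin_cases j <;> simp

/-- The Cartan matrix of `E₈`. -/
def e8Cartan : Fin 8 → Fin 8 → ℤ :=
  ![![2, 0, -1, 0, 0, 0, 0, 0], ![0, 2, 0, -1, 0, 0, 0, 0], ![-1, 0, 2, -1, 0, 0, 0, 0],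
    ![0, -1, -1, 2, -1, 0, 0, 0], ![0, 0, 0, -1, 2, -1, 0, 0], ![0, 0, 0, 0, -1, 2, -1, 0],
    ![0, 0, 0, 0, 0, -1, 2, -1], ![0, 0, 0, 0, 0, 0, -1, 2]]

theorem e8Simple_dot_eq_cartan (i j : Fin 8) : e8Simple i ⬝ᵥ e8Simple j = (e8Cartan i j : ℝ) := by
  have h : ∀ i j, ∑ k, e8Simple2 i k * e8Simple2 j k = 4 * e8Cartan i j := by decide
  rw [e8Simple_dot, h]; push_cast; ring

set_option synthInstance.maxHeartbeats 200000 in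
set_option synthInstance.maxSize 1000 in
/-- The `E₈` diagram has no symmetries. -/
theorem e8_diagram_rigid :
    ∀ p0 : Fin 8,
    ∀ p2 : Fin 8, e8Cartan p0 p2 = -1 →
    ∀ p3 : Fin 8, e8Cartan p0 p3 = 0 ∧ e8Cartan p2 p3 = -1 →
    ∀ p1 : Fin 8, e8Cartan p0 p1 = 0 ∧ e8Cartan p2 p1 = 0 ∧ e8Cartan p3 p1 = -1 →
    ∀ p4 : Fin 8, e8Cartan p0 p4 = 0 ∧ e8Cartan p2 p4 = 0 ∧ e8Cartan p3 p4 = -1 ∧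
      e8Cartan p1 p4 = 0 →
    ∀ p5 : Fin 8, e8Cartan p0 p5 = 0 ∧ e8Cartan p2 p5 = 0 ∧ e8Cartan p3 p5 = 0 ∧
      e8Cartan p1 p5 = 0 ∧ e8Cartan p4 p5 = -1 →
    ∀ p6 : Fin 8, e8Cartan p0 p6 = 0 ∧ e8Cartan p2 p6 = 0 ∧ e8Cartan p3 p6 = 0 ∧
      e8Cartan p1 p6 = 0 ∧ e8Cartan p4 p6 = 0 ∧ e8Cartan p5 p6 = -1 →
    ∀ p7 : Fin 8, e8Cartan p0 p7 = 0 ∧ e8Cartan p2 p7 = 0 ∧ e8Cartan p3 p7 = 0 ∧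
      e8Cartan p1 p7 = 0 ∧ e8Cartan p4 p7 = 0 ∧ e8Cartan p5 p7 = 0 ∧ e8Cartan p6 p7 = -1 →
    p0 = 0 ∧ p1 = 1 ∧ p2 = 2 ∧ p3 = 3 ∧ p4 = 4 ∧ p5 = 5 ∧ p6 = 6 ∧ p7 = 7 := by
  decide +kernel

theorem eq_zero_of_dot_e8Simple {v : Fin 8 → ℝ} (h : ∀ i, v ⬝ᵥ e8Simple i = 0) : v = 0 := by
  have h0 := h 0; have h1 := h 1; have h2 := h 2; have h3 := h 3
  have h4 := h 4; have h5 := h 5; have h6 := h 6; have h7 := h 7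
  simp [dotProduct, e8Simple, Fin.sum_univ_eight, e8Simple2] at h0 h1 h2 h3 h4 h5 h6 h7
  ext j
  fin_cases j <;> simp <;> linarith

theorem sub_smul_mem_E8Lattice {α v : Fin 8 → ℝ} (hα : α ∈ E8Lattice) (hv : v ∈ E8Lattice) :
    v - (α ⬝ᵥ v) • α ∈ E8Lattice := by
  obtain ⟨n, hn⟩ := E8Lattice.dot_int hα hv
  rw [hn]
  exact e8AddSubgroup.sub_mem hv (E8Lattice.zsmul_mem hα n)

/-- The orthogonal group of the `E₈` lattice. -/
def e8Orthogonal : Subgroup ((Fin 8 → ℝ) ≃ₗ[ℝ] (Fin 8 → ℝ)) where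
  carrier := {g | (∀ x y, g x ⬝ᵥ g y = x ⬝ᵥ y) ∧ (∀ x, g x ∈ E8Lattice ↔ x ∈ E8Lattice)}
  one_mem' := ⟨fun _ _ => rfl, fun _ => Iff.rfl⟩
  mul_mem' := by
    rintro g h ⟨hg, hg'⟩ ⟨hh, hh'⟩
    exact ⟨fun x y => by rw [LinearEquiv.mul_apply, LinearEquiv.mul_apply, hg, hh],
      fun x => by rw [LinearEquiv.mul_apply, hg', hh']⟩
  inv_mem' := by
    rintro g ⟨hg, hg'⟩
    refine ⟨fun x y => ?_, fun x => ?_⟩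
    · rw [← hg]
      exact congrArg₂ (fun a b => a ⬝ᵥ b) (g.apply_symm_apply x) (g.apply_symm_apply y)
    · rw [← hg']
      exact iff_of_eq (congrArg (· ∈ E8Lattice) (g.apply_symm_apply x))

theorem reflection_dot {α : Fin 8 → ℝ} (hα : α ⬝ᵥ α = 2) (x y : Fin 8 → ℝ) :
    (x - (α ⬝ᵥ x) • α) ⬝ᵥ (y - (α ⬝ᵥ y) • α) = x ⬝ᵥ y := by
  simp only [sub_dotProduct, dotProduct_sub, smul_dotProduct, dotProduct_smul, hα, smul_eq_mul,
    dotProduct_comm x α]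
  ring

theorem reflection_reflection {α : Fin 8 → ℝ} (hα : α ⬝ᵥ α = 2) (x : Fin 8 → ℝ) :
    (x - (α ⬝ᵥ x) • α) - (α ⬝ᵥ (x - (α ⬝ᵥ x) • α)) • α = x := by
  simp only [dotProduct_sub, dotProduct_smul, hα, smul_eq_mul]
  module

theorem reflection_mem_E8Lattice_iff {α : Fin 8 → ℝ} (hα : α ∈ E8Roots) (x : Fin 8 → ℝ) :
    x - (α ⬝ᵥ x) • α ∈ E8Lattice ↔ x ∈ E8Lattice := by
  refine ⟨fun h => ?_, sub_smul_mem_E8Lattice hα.1⟩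
  have := sub_smul_mem_E8Lattice hα.1 h
  rwa [reflection_reflection hα.2] at this

theorem WeylE8_le_e8Orthogonal : WeylE8 ≤ e8Orthogonal := by
  rw [WeylE8, Subgroup.closure_le]
  rintro s ⟨α, hα, hs⟩
  refine ⟨fun x y => ?_, fun x => ?_⟩
  · rw [hs, hs, reflection_dot hα.2]
  · rw [hs, reflection_mem_E8Lattice_iff hα]

/-- The reflection in a root, as an element of the Weyl group. -/
theorem exists_reflection {α : Fin 8 → ℝ} (hα : α ∈ E8Roots) :
    ∃ s ∈ WeylE8, ∀ x, s x = x - (α ⬝ᵥ x) • α := by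
  let f : (Fin 8 → ℝ) →ₗ[ℝ] (Fin 8 → ℝ) :=
    { toFun := fun x => x - (α ⬝ᵥ x) • α
      map_add' := fun x y => by simp only [dotProduct_add]; module
      map_smul' := fun c x => by simp only [dotProduct_smul, RingHom.id_apply, smul_eq_mul]; module }
  refine ⟨LinearEquiv.ofLinearMap f f ?_ ?_, Subgroup.subset_closure ⟨α, hα, fun x => rfl⟩,
    fun x => rfl⟩ <;>
  · refine LinearMap.ext fun x => ?_
    exact reflection_reflection hα.2 _

theorem dot_self_nonneg' (v : Fin 8 → ℝ) : 0 ≤ v ⬝ᵥ v :=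
  Finset.sum_nonneg fun i _ => mul_self_nonneg (v i)

/-- Composing g with a suitable Weyl element makes the image of the Weyl vector ρ strictly dominant.
It then equals ρ, so the composite permutes the roots of height one, which are the simple roots. The
diagram being rigid, the composite is the identity. -/
theorem e8Orthogonal_le_WeylE8 : e8Orthogonal ≤ WeylE8 := by
  intro g hg
  have hmem : ∀ w ∈ WeylE8, w * g ∈ e8Orthogonal := fun w hw =>
    mul_mem (WeylE8_le_e8Orthogonal hw) hg
  have hint : ∀ w ∈ WeylE8, ∃ n : ℤ, e8Rho ⬝ᵥ (w * g) e8Rho = n := fun w hw =>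
    E8Lattice.dot_int e8Rho_mem (((hmem w hw).2 _).2 e8Rho_mem)
  obtain ⟨m, ⟨w, hw, hwm⟩, hmax⟩ := Int.exists_greatest_of_bdd
    (P := fun n : ℤ => ∃ w ∈ WeylE8, e8Rho ⬝ᵥ (w * g) e8Rho = n)
    (by
      -- Expanding 0 ≤ |ρ - wgρ|² bounds the product by ρ · ρ, since wg is an isometry.
      obtain ⟨N, hN⟩ := E8Lattice.dot_int e8Rho_mem e8Rho_mem
      refine ⟨N, ?_⟩
      rintro z ⟨w, hw, hz⟩
      have h1 := (hmem w hw).1 e8Rho e8Rho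
      have h2 := dot_self_nonneg' (e8Rho - (w * g) e8Rho)
      simp only [sub_dotProduct, dotProduct_sub, h1, hz, hN,
        dotProduct_comm ((w * g) e8Rho) e8Rho] at h2
      have : (z : ℝ) ≤ N := by linarith
      exact_mod_cast this)
    (by
      obtain ⟨n, hn⟩ := hint 1 (one_mem _)
      exact ⟨n, 1, one_mem _, hn⟩)
  set h := w * g with hh
  have hO := hmem w hw
  set u := h e8Rho with hu
  -- Reflecting in a simple root changes ρ · u to ρ · u - u · αᵢ, so maximality gives u · αᵢ ≥ 0.
  -- Equality would make ρ orthogonal to the root h⁻¹αᵢ.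
  have hpos : ∀ i, 1 ≤ u ⬝ᵥ e8Simple i := by
    intro i
    obtain ⟨s, hs, hs'⟩ := exists_reflection (e8Simple_mem_roots i)
    have hsw : s * w ∈ WeylE8 := mul_mem hs hw
    obtain ⟨k, hk⟩ := hint _ hsw
    have hkm := hmax k ⟨_, hsw, hk⟩
    rw [mul_assoc, LinearEquiv.mul_apply, ← hh, hs', ← hu, dotProduct_sub, dotProduct_smul,
      e8Rho_dot_simple, hwm, smul_eq_mul, mul_one, dotProduct_comm] at hk
    obtain ⟨l, hl⟩ := E8Lattice.dot_int ((hO.2 _).2 e8Rho_mem) (e8Simple_mem i)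
    rw [← hu] at hl
    have hl0 : 0 ≤ l := by
      rw [hl] at hk
      have : m - l = k := by exact_mod_cast hk
      linarith
    have hne : l ≠ 0 := by
      rintro rfl
      have hr : h.symm (e8Simple i) ∈ E8Roots := by
        refine ⟨(hO.2 _).1 (by rw [LinearEquiv.apply_symm_apply]; exact e8Simple_mem i), ?_⟩
        rw [← hO.1, LinearEquiv.apply_symm_apply]; exact (e8Simple_mem_roots i).2
      apply (e8Rho_dot_root hr).1
      rw [← hO.1, LinearEquiv.apply_symm_apply, ← hu, hl, Int.cast_zero]
    rw [hl]
    have : 1 ≤ l := by omega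
    exact_mod_cast this
  have huρ : u = e8Rho := by
    -- ρ is a nonnegative combination of simple roots, on each of which u - ρ is nonnegative. With
    -- |u| = |ρ| this forces u = ρ.
    have h1 : 0 ≤ e8Rho ⬝ᵥ (u - e8Rho) := by
      rw [e8Rho_eq_sum, sum_dotProduct, ← e8Rho_eq_sum]
      refine Finset.sum_nonneg fun i _ => ?_
      rw [smul_dotProduct, dotProduct_comm, sub_dotProduct, e8Rho_dot_simple, smul_eq_mul]
      have hc : ∀ i, 0 ≤ e8RhoCoeff i := by decide
      exact mul_nonneg (by exact_mod_cast hc i) (by linarith [hpos i])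
    have h2 : u ⬝ᵥ u = e8Rho ⬝ᵥ e8Rho := hO.1 _ _
    have h3 : (u - e8Rho) ⬝ᵥ (u - e8Rho) ≤ 0 := by
      simp only [sub_dotProduct, dotProduct_sub, h2, dotProduct_comm u e8Rho] at h1 ⊢
      linarith
    have h4 := dotProduct_self_eq_zero.1 (le_antisymm h3 (dot_self_nonneg' _))
    exact sub_eq_zero.1 h4
  have hsimple : ∀ i, ∃ j, h (e8Simple i) = e8Simple j := by
    intro i
    refine (e8Rho_dot_root (β := h (e8Simple i)) ⟨(hO.2 _).2 (e8Simple_mem i), ?_⟩).2 ?_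
    · rw [hO.1]; exact (e8Simple_mem_roots i).2
    · rw [← huρ, hu, hO.1, e8Rho_dot_simple]
  choose p hp using hsimple
  have hC : ∀ i j, e8Cartan (p i) (p j) = e8Cartan i j := by
    intro i j
    have := hO.1 (e8Simple i) (e8Simple j)
    rw [hp, hp, e8Simple_dot_eq_cartan, e8Simple_dot_eq_cartan] at this
    exact_mod_cast this
  -- The order 0, 2, 3, 1, 4, 5, 6, 7 walks along the edges of the diagram, so each vertex is
  -- constrained by a neighbour already placed.
  obtain ⟨p0, p1, p2, p3, p4, p5, p6, p7⟩ := e8_diagram_rigid (p 0) (p 2) (hC _ _) (p 3) ⟨hC _ _, hC _ _⟩ (p 1) ⟨hC _ _, hC _ _, hC _ _⟩ (p 4) ⟨hC _ _, hC _ _, hC _ _, hC _ _⟩ (p 5) ⟨hC _ _, hC _ _, hC _ _, hC _ _, hC _ _⟩ (p 6) ⟨hC _ _, hC _ _, hC _ _, hC _ _, hC _ _, hC _ _⟩ (p 7) ⟨hC _ _, hC _ _, hC _ _, hC _ _, hC _ _, hC _ _, hC _ _⟩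
  have hpid : ∀ i, p i = i := by
    intro i
    fin_cases i <;> assumption
  have hone : h = 1 := by
    ext1 x
    refine sub_eq_zero.1 (eq_zero_of_dot_e8Simple fun i => ?_)
    rw [sub_dotProduct, sub_eq_zero, LinearEquiv.coe_one, id]
    conv_lhs => rw [← hpid i, ← hp]
    exact hO.1 _ _
  have : g = w⁻¹ := by
    rw [hh] at hone
    exact eq_inv_of_mul_eq_one_right hone
  rw [this]
  exact inv_mem hw

end E8

/-! ### Orthogonal representations of pairs of quaternions on ℝ⁸. -/

section Models

/-- The quaternion with the given coordinates. -/
def mkQ (a b c d : ℝ) : ℍ[ℝ] := ⟨a, b, c, d⟩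

@[simp] theorem re_mkQ (a b c d : ℝ) : (mkQ a b c d).re = a := rfl
@[simp] theorem imI_mkQ (a b c d : ℝ) : (mkQ a b c d).imI = b := rfl
@[simp] theorem imJ_mkQ (a b c d : ℝ) : (mkQ a b c d).imJ = c := rfl
@[simp] theorem imK_mkQ (a b c d : ℝ) : (mkQ a b c d).imK = d := rfl

/-- The ring of matrices that map the `E₈` lattice into itself. -/
def e8Ring : Subring (Matrix (Fin 8) (Fin 8) ℝ) where
  carrier := {A | ∀ v ∈ E8Lattice, A *ᵥ v ∈ E8Lattice}
  mul_mem' := fun {A B} hA hB v hv => by rw [← Matrix.mulVec_mulVec]; exact hA _ (hB _ hv)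
  one_mem' := fun v hv => by rwa [Matrix.one_mulVec]
  add_mem' := fun {A B} hA hB v hv => by
    rw [Matrix.add_mulVec]; exact E8Lattice.add_mem (hA v hv) (hB v hv)
  zero_mem' := fun v _ => by rw [Matrix.zero_mulVec]; exact E8Lattice.zero_mem
  neg_mem' := fun {A} hA v hv => by rw [Matrix.neg_mulVec]; exact E8Lattice.neg_mem (hA v hv)

/-- For a ≠ -1 a root is (1 + a)/|1 + a|, where |1 + a|² = 2 + 2 Re a; and -1 = i². -/
theorem exists_mul_self_eq_of_normSq_eq_one {a : ℍ[ℝ]} (ha : Quaternion.normSq a = 1) :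
    ∃ c : ℍ[ℝ], c * c = a := by
  rw [Quaternion.normSq_def'] at ha
  by_cases h : a.re = -1
  · have h1 : a.imI = 0 := by nlinarith [sq_nonneg a.imI, sq_nonneg a.imJ, sq_nonneg a.imK]
    have h2 : a.imJ = 0 := by nlinarith [sq_nonneg a.imI, sq_nonneg a.imJ, sq_nonneg a.imK]
    have h3 : a.imK = 0 := by nlinarith [sq_nonneg a.imI, sq_nonneg a.imJ, sq_nonneg a.imK]
    refine ⟨mkQ 0 1 0 0, ?_⟩
    ext <;> simp [h, h1, h2, h3]
  · have hre : -1 < a.re := by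
      refine lt_of_le_of_ne ?_ (Ne.symm h)
      nlinarith [sq_nonneg a.imI, sq_nonneg a.imJ, sq_nonneg a.imK]
    obtain ⟨r, hr⟩ : ∃ r : ℝ, r ^ 2 * (2 + 2 * a.re) = 1 := by
      refine ⟨(Real.sqrt (2 + 2 * a.re))⁻¹, ?_⟩
      rw [inv_pow, Real.sq_sqrt (by linarith)]
      exact inv_mul_cancel₀ (by linarith)
    refine ⟨r • (1 + a), ?_⟩
    ext <;> simp
    · linear_combination a.re * hr + r ^ 2 * (-1) * ha
    · linear_combination a.imI * hr
    · linear_combination a.imJ * hr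
    · linear_combination a.imK * hr

/-- An orthogonal action of pairs of quaternions on `ℝ⁸`. -/
structure IsOrthogonalModel (R : ℍ[ℝ] × ℍ[ℝ] →+* Matrix (Fin 8) (Fin 8) ℝ) : Prop where
  injective : Function.Injective R
  star_eq : ∀ x, R (star x) = (R x)ᵀ

theorem star_mul_self_of_normSq_eq_one {x : ℍ[ℝ] × ℍ[ℝ]} (h1 : Quaternion.normSq x.1 = 1)
    (h2 : Quaternion.normSq x.2 = 1) : star x * x = 1 := by
  ext1
  · simp [Quaternion.star_mul_self, h1]
  · simp [Quaternion.star_mul_self, h2]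

/-- The pair is the square of a pair of unit quaternions, whose matrix is orthogonal and so has
determinant with square one. -/
theorem IsOrthogonalModel.det_eq_one {R : ℍ[ℝ] × ℍ[ℝ] →+* Matrix (Fin 8) (Fin 8) ℝ}
    (hR : IsOrthogonalModel R) {x : ℍ[ℝ] × ℍ[ℝ]} (h1 : Quaternion.normSq x.1 = 1)
    (h2 : Quaternion.normSq x.2 = 1) : (R x).det = 1 := by
  obtain ⟨c, hc⟩ := exists_mul_self_eq_of_normSq_eq_one h1
  obtain ⟨d, hd⟩ := exists_mul_self_eq_of_normSq_eq_one h2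
  have hx : x = (c, d) * (c, d) := by ext1 <;> simp [hc, hd]
  have hn : ∀ {q r : ℍ[ℝ]}, q * q = r → Quaternion.normSq r = 1 → Quaternion.normSq q = 1 := by
    rintro q r rfl h
    rw [map_mul] at h
    nlinarith [Quaternion.normSq_nonneg (a := q)]
  have hs := star_mul_self_of_normSq_eq_one (x := (c, d)) (hn hc h1) (hn hd h2)
  have := congrArg (fun y => (R y).det) hs
  simp only [map_mul, hR.star_eq, Matrix.det_mul, Matrix.det_transpose, map_one, Matrix.det_one]
    at this
  rw [hx, map_mul, Matrix.det_mul, this]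

/-- A group of pairs of unit quaternions that preserves the `E₈` lattice in some orthogonal model
is a subgroup of `W⁺(E₈)`. -/
theorem IsOrthogonalModel.exists_mulEquiv {G : Type*} [Group G]
    {R : ℍ[ℝ] × ℍ[ℝ] →+* Matrix (Fin 8) (Fin 8) ℝ} (hR : IsOrthogonalModel R)
    (Ψ : G →* ℍ[ℝ] × ℍ[ℝ]) (hΨ : Function.Injective Ψ)
    (h1 : ∀ g, Quaternion.normSq (Ψ g).1 = 1) (h2 : ∀ g, Quaternion.normSq (Ψ g).2 = 1)
    (hlat : ∀ g, R (Ψ g) ∈ e8Ring) :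
    ∃ H : Subgroup WPlusE8, Nonempty (G ≃* H) := by
  let f : G →* Module.End ℝ (Fin 8 → ℝ) :=
    ((Matrix.toLinAlgEquiv' : _ ≃ₐ[ℝ] Module.End ℝ (Fin 8 → ℝ)) : _ →* _).comp
      ((R : _ →* Matrix (Fin 8) (Fin 8) ℝ).comp Ψ)
  let F : G →* ((Fin 8 → ℝ) ≃ₗ[ℝ] (Fin 8 → ℝ)) :=
    (LinearMap.GeneralLinearGroup.generalLinearEquiv ℝ (Fin 8 → ℝ)).toMonoidHom.comp f.toHomUnits
  have hF : ∀ g x, F g x = R (Ψ g) *ᵥ x := fun g x => rfl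
  have hFinj : Function.Injective F := by
    intro g h hgh
    apply hΨ
    apply hR.injective
    apply Matrix.toLin'.injective
    ext1 x
    refine LinearMap.ext fun y => ?_
    exact (hF g _).symm.trans ((DFunLike.congr_fun hgh _).trans (hF h _))
  have hlat' : ∀ g x, F g x ∈ E8Lattice ↔ x ∈ E8Lattice := by
    intro g x
    refine ⟨fun h => ?_, fun h => by rw [hF]; exact hlat g x h⟩
    have := hlat g⁻¹ _ h
    rw [← hF, map_inv] at this
    rwa [show (F g)⁻¹ (F g x) = x from (F g).symm_apply_apply x] at this
  have hdot : ∀ g x y, F g x ⬝ᵥ F g y = x ⬝ᵥ y := by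
    intro g x y
    rw [hF, hF, Matrix.dotProduct_mulVec, Matrix.vecMul_mulVec, ← hR.star_eq, ← map_mul,
      star_mul_self_of_normSq_eq_one (h1 g) (h2 g), map_one, Matrix.vecMul_one]
  have hmem : ∀ g, F g ∈ WPlusE8 := by
    intro g
    refine ⟨e8Orthogonal_le_WeylE8 ⟨hdot g, hlat' g⟩, MonoidHom.mem_ker.2 ?_⟩
    ext1
    rw [LinearEquiv.coe_det, Units.val_one]
    have : ((F g : (Fin 8 → ℝ) ≃ₗ[ℝ] (Fin 8 → ℝ)) : (Fin 8 → ℝ) →ₗ[ℝ] (Fin 8 → ℝ)) =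
        Matrix.toLin' (R (Ψ g)) := rfl
    rw [this, LinearMap.det_toLin', hR.det_eq_one (h1 g) (h2 g)]
  let F' : G →* WPlusE8 := F.codRestrict WPlusE8 hmem
  have hF' : Function.Injective F' := fun g h hgh => hFinj (congrArg Subtype.val hgh)
  exact ⟨F'.range, ⟨MonoidHom.ofInjective hF'⟩⟩

end Models

/-! ### Models from two complex structures and a commuting projection. -/

section PairData

/-- Two anticommuting orthogonal complex structures on `ℝ⁸` and an orthogonal projection that
commutes with them. -/
structure PairData where
  I : Matrix (Fin 8) (Fin 8) ℝ
  J : Matrix (Fin 8) (Fin 8) ℝ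
  E : Matrix (Fin 8) (Fin 8) ℝ
  I_mul_I : I * I = -1
  J_mul_J : J * J = -1
  J_mul_I : J * I = -(I * J)
  I_tr : Iᵀ = -I
  J_tr : Jᵀ = -J
  E_tr : Eᵀ = E
  E_mul_E : E * E = E
  E_mul_I : E * I = I * E
  E_mul_J : E * J = J * E
  E_ne_zero : E ≠ 0
  E_ne_one : E ≠ 1

namespace PairData

variable (P : PairData)

noncomputable def basis : QuaternionAlgebra.Basis (Matrix (Fin 8) (Fin 8) ℝ) (-1 : ℝ) 0 (-1) where
  i := P.I
  j := P.J
  k := P.I * P.J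
  i_mul_i := by rw [P.I_mul_I]; simp
  j_mul_j := by rw [P.J_mul_J]; simp
  i_mul_j := rfl
  j_mul_i := by rw [P.J_mul_I]; simp

/-- The action of the quaternions. -/
noncomputable def lam : ℍ[ℝ] →ₐ[ℝ] Matrix (Fin 8) (Fin 8) ℝ := P.basis.liftHom

theorem lam_apply (q : ℍ[ℝ]) :
    P.lam q = q.re • 1 + q.imI • P.I + q.imJ • P.J + q.imK • (P.I * P.J) := by
  rw [← Algebra.algebraMap_eq_smul_one]
  rfl

theorem E_mul_lam (q : ℍ[ℝ]) : P.E * P.lam q = P.lam q * P.E := by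
  simp only [lam_apply, mul_add, add_mul, mul_smul_comm, smul_mul_assoc, mul_one, one_mul,
    P.E_mul_I, P.E_mul_J]
  rw [← mul_assoc, P.E_mul_I, mul_assoc, P.E_mul_J, mul_assoc]

theorem lam_star (q : ℍ[ℝ]) : P.lam (star q) = (P.lam q)ᵀ := by
  simp only [lam_apply, Matrix.transpose_add, Matrix.transpose_smul, Matrix.transpose_mul,
    P.I_tr, P.J_tr, Matrix.transpose_one, Quaternion.re_star, Quaternion.imI_star,
    Quaternion.imJ_star, Quaternion.imK_star, neg_mul_neg, P.J_mul_I, neg_smul, smul_neg]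

/-- The action of pairs of quaternions. -/
noncomputable def hom : ℍ[ℝ] × ℍ[ℝ] →+* Matrix (Fin 8) (Fin 8) ℝ where
  toFun x := P.lam x.1 * P.E + P.lam x.2 * (1 - P.E)
  map_one' := by simp
  map_zero' := by simp
  map_add' x y := by simp only [Prod.fst_add, Prod.snd_add, map_add, add_mul]; abel
  map_mul' x y := by
    have h2 : ∀ a b : ℍ[ℝ], P.lam a * P.E * P.lam b = P.lam a * P.lam b * P.E := by
      intro a b
      rw [mul_assoc, P.E_mul_lam, mul_assoc]
    simp only [Prod.fst_mul, Prod.snd_mul, map_mul, mul_add, add_mul, mul_sub, sub_mul, mul_one,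
      ← mul_assoc, h2]
    simp only [mul_assoc, P.E_mul_E]
    abel

theorem hom_apply (a b : ℍ[ℝ]) : P.hom (a, b) = P.lam a * P.E + P.lam b * (1 - P.E) := rfl

/-- Multiplication by `P.E` separates the two components, and the action of a nonzero quaternion is
invertible, so injectivity only needs both complementary projections to be nonzero. -/
theorem isOrthogonalModel : IsOrthogonalModel P.hom where
  injective := by
    rw [injective_iff_map_eq_zero]
    rintro ⟨a, b⟩ h
    rw [hom_apply] at h
    have hE : (1 - P.E) * P.E = 0 := by rw [sub_mul, P.E_mul_E, one_mul, sub_self]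
    have hE' : P.E * (1 - P.E) = 0 := by rw [mul_sub, P.E_mul_E, mul_one, sub_self]
    have hE'' : (1 - P.E) * (1 - P.E) = 1 - P.E := by rw [mul_sub, hE, mul_one, sub_zero]
    have key : ∀ (q : ℍ[ℝ]) (X : Matrix (Fin 8) (Fin 8) ℝ), P.lam q * X = 0 → X ≠ 0 → q = 0 := by
      intro q X h hX
      by_contra hq
      apply hX
      have := congrArg (P.lam q⁻¹ * ·) h
      simpa [← mul_assoc, ← map_mul, inv_mul_cancel₀ hq] using this
    have ha : P.lam a * P.E = 0 := by
      have := congrArg (· * P.E) h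
      simpa [add_mul, mul_assoc, P.E_mul_E, hE] using this
    have hb : P.lam b * (1 - P.E) = 0 := by rwa [ha, zero_add] at h
    rw [key a _ ha P.E_ne_zero, key b _ hb (sub_ne_zero.2 P.E_ne_one.symm)]
    rfl
  star_eq := by
    rintro ⟨a, b⟩
    rw [Prod.star_def, hom_apply, hom_apply]
    simp only [lam_star, Matrix.transpose_add, Matrix.transpose_mul, Matrix.transpose_sub,
      P.E_tr, mul_sub, mul_one]
    simp only [← lam_star, P.E_mul_lam]

/-- Integer matrices as real matrices. -/
def ofIntMat : Matrix (Fin 8) (Fin 8) ℤ →+* Matrix (Fin 8) (Fin 8) ℝ :=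
  (Int.castRingHom ℝ).mapMatrix

theorem ofIntMat_tr (A : Matrix (Fin 8) (Fin 8) ℤ) : (ofIntMat A)ᵀ = ofIntMat Aᵀ := rfl

theorem ofIntMat_trace (A : Matrix (Fin 8) (Fin 8) ℤ) : (ofIntMat A).trace = (A.trace : ℝ) := by
  simp [Matrix.trace, ofIntMat]

/-- The data defined by integer matrices whose squares are scalars, after normalization. -/
noncomputable def ofInt (I J S : Matrix (Fin 8) (Fin 8) ℤ) (nI nJ nS : ℤ) (cI cJ cS : ℝ)
    (hI : I * I = -(nI : Matrix (Fin 8) (Fin 8) ℤ)) (hJ : J * J = -(nJ : Matrix (Fin 8) (Fin 8) ℤ))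
    (hS : S * S = (nS : Matrix (Fin 8) (Fin 8) ℤ)) (hJI : J * I = -(I * J))
    (hIt : Iᵀ = -I) (hJt : Jᵀ = -J) (hSt : Sᵀ = S) (hSI : S * I = I * S) (hSJ : S * J = J * S)
    (htr : S.trace = 0) (hcI : cI ^ 2 * nI = 1) (hcJ : cJ ^ 2 * nJ = 1) (hcS : cS ^ 2 * nS = 1) :
    PairData where
  I := cI • ofIntMat I
  J := cJ • ofIntMat J
  E := (1 / 2 : ℝ) • (1 + cS • ofIntMat S)
  I_mul_I := by
    rw [smul_mul_smul_comm, ← map_mul, hI, map_neg, map_intCast, ← pow_two, smul_neg,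
      ← zsmul_one (nI : ℤ), ← Int.cast_smul_eq_zsmul ℝ, smul_smul, hcI, one_smul]
  J_mul_J := by
    rw [smul_mul_smul_comm, ← map_mul, hJ, map_neg, map_intCast, ← pow_two, smul_neg,
      ← zsmul_one (nJ : ℤ), ← Int.cast_smul_eq_zsmul ℝ, smul_smul, hcJ, one_smul]
  J_mul_I := by
    rw [smul_mul_smul_comm, ← map_mul, hJI, map_neg, smul_mul_smul_comm, map_mul, smul_neg,
      mul_comm]
  I_tr := by rw [Matrix.transpose_smul, ofIntMat_tr, hIt, map_neg, smul_neg]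
  J_tr := by rw [Matrix.transpose_smul, ofIntMat_tr, hJt, map_neg, smul_neg]
  E_tr := by
    rw [Matrix.transpose_smul, Matrix.transpose_add, Matrix.transpose_smul, ofIntMat_tr, hSt,
      Matrix.transpose_one]
  E_mul_E := by
    have h : (cS • ofIntMat S) * (cS • ofIntMat S) = 1 := by
      rw [smul_mul_smul_comm, ← map_mul, hS, map_intCast, ← pow_two,
        ← zsmul_one (nS : ℤ), ← Int.cast_smul_eq_zsmul ℝ, smul_smul, hcS, one_smul]
    rw [smul_mul_smul_comm, mul_add, add_mul, add_mul, h]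
    simp only [mul_one, one_mul]
    module
  E_mul_I := by
    simp only [mul_add, add_mul, mul_smul_comm, smul_mul_assoc, mul_one, one_mul, ← map_mul, hSI]
    module
  E_mul_J := by
    simp only [mul_add, add_mul, mul_smul_comm, smul_mul_assoc, mul_one, one_mul, ← map_mul, hSJ]
    module
  -- Since S has trace zero, E has trace 4, whereas 0 and 1 have traces 0 and 8.
  E_ne_zero := by
    intro h
    have := congrArg Matrix.trace h
    simp [Matrix.trace_smul, Matrix.trace_add, ofIntMat_trace, htr] at this
  E_ne_one := by
    intro h
    have := congrArg Matrix.trace h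
    simp [Matrix.trace_smul, Matrix.trace_add, ofIntMat_trace, htr] at this

end PairData

/-- A sufficient criterion for half of an integer matrix to preserve the `E₈` lattice. -/
def HalfPreserves (N : Matrix (Fin 8) (Fin 8) ℤ) : Prop :=
  ∀ i, ((∀ j, (∑ k, N j k * e8Simple2 i k) % 4 = 0) ∨ (∀ j, (∑ k, N j k * e8Simple2 i k) % 4 = 2)) ∧
    (∑ j, ∑ k, N j k * e8Simple2 i k) % 8 = 0

instance (N : Matrix (Fin 8) (Fin 8) ℤ) : Decidable (HalfPreserves N) := by
  unfold HalfPreserves; infer_instance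

/-- Twice the fundamental weights of `E₈`. -/
def e8Weight2 : Fin 8 → Fin 8 → ℤ :=
  ![![0, 0, 0, 0, 0, 0, 0, 4], ![1, 1, 1, 1, 1, 1, 1, 5], ![-1, 1, 1, 1, 1, 1, 1, 7],
    ![0, 0, 2, 2, 2, 2, 2, 10], ![0, 0, 0, 2, 2, 2, 2, 8], ![0, 0, 0, 0, 2, 2, 2, 6],
    ![0, 0, 0, 0, 0, 2, 2, 4], ![0, 0, 0, 0, 0, 0, 2, 2]]

theorem half_mem_E8Lattice {n : Fin 8 → ℤ}
    (h : ((∀ j, n j % 2 = 0) ∨ (∀ j, n j % 2 = 1)) ∧ (∑ j, n j) % 4 = 0) :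
    (fun j => (n j : ℝ) / 2) ∈ E8Lattice := by
  obtain ⟨h1, h2⟩ := h
  refine ⟨?_, (∑ j, n j) / 4, ?_⟩
  · refine h1.imp (fun h1 j => ⟨n j / 2, ?_⟩) (fun h1 j => ⟨n j / 2, ?_⟩)
    · have : n j = 2 * (n j / 2) := by have := h1 j; omega
      have := congrArg (Int.cast : ℤ → ℝ) this
      push_cast at this
      linarith
    · have : n j = 2 * (n j / 2) + 1 := by have := h1 j; omega
      have := congrArg (Int.cast : ℤ → ℝ) this
      push_cast at this
      linarith
  · have : (∑ j, n j) = 4 * ((∑ j, n j) / 4) := by omega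
    have := congrArg (Int.cast : ℤ → ℝ) this
    simp only [Int.cast_sum, Int.cast_mul, Int.cast_ofNat] at this
    rw [← Finset.sum_div, this]; ring

/-- The fundamental weights belong to the lattice, since E₈ is self-dual; the coefficients of v are
its integral products with them. -/
theorem exists_coeff_of_mem_E8Lattice {v : Fin 8 → ℝ} (hv : v ∈ E8Lattice) :
    ∃ c : Fin 8 → ℤ, v = ∑ i, (c i : ℝ) • e8Simple i := by
  have hw : ∀ i, (fun j => (e8Weight2 i j : ℝ) / 2) ∈ E8Lattice := by
    have : ∀ i, ((∀ j, e8Weight2 i j % 2 = 0) ∨ (∀ j, e8Weight2 i j % 2 = 1)) ∧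
      (∑ j, e8Weight2 i j) % 4 = 0 := by decide
    exact fun i => half_mem_E8Lattice (this i)
  choose c hc using fun i => E8Lattice.dot_int (hw i) hv
  refine ⟨c, ?_⟩
  ext j
  simp only [← hc, Finset.sum_apply, Pi.smul_apply, smul_eq_mul, e8Simple, dotProduct,
    Finset.sum_mul]
  rw [Finset.sum_comm]
  -- Duality of weights and simple roots; the factor 4 appears because both families are doubled.
  have h : ∀ k j, ∑ i, e8Weight2 i k * e8Simple2 i j = if k = j then 4 else 0 := by decide
  have h' : ∀ k, ∑ i, (e8Weight2 i k : ℝ) / 2 * v k * ((e8Simple2 i j : ℝ) / 2) =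
      if k = j then v k else 0 := by
    intro k
    have := congrArg (Int.cast : ℤ → ℝ) (h k j)
    simp only [Int.cast_sum, Int.cast_mul] at this
    calc _ = (∑ i, (e8Weight2 i k : ℝ) * (e8Simple2 i j : ℝ)) * (v k / 4) := by
          rw [Finset.sum_mul]; exact Finset.sum_congr rfl fun i _ => by ring
      _ = _ := by rw [this]; split_ifs <;> simp; ring
  simp [h']

/-- It suffices to test simple roots. N/2 sends α to N(2α)/4, so being integral or half-integral is
a condition modulo 4, and the even coordinate sum is one modulo 8. -/
theorem HalfPreserves.mem_e8Ring {N : Matrix (Fin 8) (Fin 8) ℤ} (h : HalfPreserves N) :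
    (1 / 2 : ℝ) • PairData.ofIntMat N ∈ e8Ring := by
  intro v hv
  obtain ⟨c, rfl⟩ := exists_coeff_of_mem_E8Lattice hv
  rw [Matrix.mulVec_sum]
  refine e8AddSubgroup.sum_mem fun i _ => ?_
  rw [Matrix.mulVec_smul]
  refine E8Lattice.zsmul_mem ?_ _
  obtain ⟨h1, h2⟩ := h i
  have key : ((1 / 2 : ℝ) • PairData.ofIntMat N) *ᵥ e8Simple i =
      fun j => (((∑ k, N j k * e8Simple2 i k) / 2 : ℤ) : ℝ) / 2 := by
    ext j
    have hd : (∑ k, N j k * e8Simple2 i k) = 2 * ((∑ k, N j k * e8Simple2 i k) / 2) := by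
      rcases h1 with h1 | h1 <;> · have := h1 j; omega
    have hd' := congrArg (Int.cast : ℤ → ℝ) hd
    rw [Int.cast_mul, Int.cast_ofNat] at hd'
    have : (((1 / 2 : ℝ) • PairData.ofIntMat N) *ᵥ e8Simple i) j =
        ((∑ k, N j k * e8Simple2 i k : ℤ) : ℝ) / 4 := by
      rw [Matrix.smul_mulVec, Pi.smul_apply]
      simp only [Matrix.mulVec, dotProduct, PairData.ofIntMat, RingHom.mapMatrix_apply,
        Matrix.map_apply, e8Simple, Int.cast_sum, Int.cast_mul, smul_eq_mul, Finset.mul_sum,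
        Finset.sum_div, eq_intCast]
      exact Finset.sum_congr rfl fun k _ => by ring
    rw [this, hd']; ring
  rw [key]
  refine half_mem_E8Lattice ⟨?_, ?_⟩
  · exact h1.imp (fun h1 j => by have := h1 j; omega) (fun h1 j => by have := h1 j; omega)
  · have : ∀ j, (∑ k, N j k * e8Simple2 i k) = 2 * ((∑ k, N j k * e8Simple2 i k) / 2) := by
      intro j
      rcases h1 with h1 | h1 <;> · have := h1 j; omega
    rw [Finset.sum_congr rfl fun j _ => this j, ← Finset.mul_sum] at h2
    omega

end PairData

/-! ### Five explicit models on the E₈ lattice. -/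

section E8Models

/-- Left multiplication by `i` on pairs of quaternions. -/
def matI : Matrix (Fin 8) (Fin 8) ℤ :=
  Matrix.of ![![0, -1, 0, 0, 0, 0, 0, 0], ![1, 0, 0, 0, 0, 0, 0, 0], ![0, 0, 0, -1, 0, 0, 0, 0],
    ![0, 0, 1, 0, 0, 0, 0, 0], ![0, 0, 0, 0, 0, -1, 0, 0], ![0, 0, 0, 0, 1, 0, 0, 0],
    ![0, 0, 0, 0, 0, 0, 0, -1], ![0, 0, 0, 0, 0, 0, 1, 0]]

/-- Left multiplication by `j` on pairs of quaternions. -/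
def matJ : Matrix (Fin 8) (Fin 8) ℤ :=
  Matrix.of ![![0, 0, -1, 0, 0, 0, 0, 0], ![0, 0, 0, 1, 0, 0, 0, 0], ![1, 0, 0, 0, 0, 0, 0, 0],
    ![0, -1, 0, 0, 0, 0, 0, 0], ![0, 0, 0, 0, 0, 0, -1, 0], ![0, 0, 0, 0, 0, 0, 0, 1],
    ![0, 0, 0, 0, 1, 0, 0, 0], ![0, 0, 0, 0, 0, -1, 0, 0]]

/-- The involution with the two summands as eigenspaces. -/
def matS₁ : Matrix (Fin 8) (Fin 8) ℤ :=
  Matrix.of ![![1, 0, 0, 0, 0, 0, 0, 0], ![0, 1, 0, 0, 0, 0, 0, 0], ![0, 0, 1, 0, 0, 0, 0, 0],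
    ![0, 0, 0, 1, 0, 0, 0, 0], ![0, 0, 0, 0, -1, 0, 0, 0], ![0, 0, 0, 0, 0, -1, 0, 0],
    ![0, 0, 0, 0, 0, 0, -1, 0], ![0, 0, 0, 0, 0, 0, 0, -1]]

/-- A square root of two that commutes with left multiplications. -/
def matS₂ : Matrix (Fin 8) (Fin 8) ℤ :=
  Matrix.of ![![1, 0, 0, 0, 1, 0, 0, 0], ![0, 1, 0, 0, 0, 1, 0, 0], ![0, 0, 1, 0, 0, 0, 1, 0],
    ![0, 0, 0, 1, 0, 0, 0, 1], ![1, 0, 0, 0, -1, 0, 0, 0], ![0, 1, 0, 0, 0, -1, 0, 0],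
    ![0, 0, 1, 0, 0, 0, -1, 0], ![0, 0, 0, 1, 0, 0, 0, -1]]

/-- A square root of five that commutes with left multiplications. -/
def matS₅ : Matrix (Fin 8) (Fin 8) ℤ :=
  Matrix.of ![![1, 0, 0, 0, 1, 1, -1, 1], ![0, 1, 0, 0, -1, 1, -1, -1], ![0, 0, 1, 0, 1, 1, 1, -1],
    ![0, 0, 0, 1, -1, 1, 1, 1], ![1, -1, 1, -1, -1, 0, 0, 0], ![1, 1, 1, 1, 0, -1, 0, 0],
    ![-1, -1, 1, 1, 0, 0, -1, 0], ![1, -1, -1, 1, 0, 0, 0, -1]]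

/-- Left multiplication by `j` and by `k` on the two summands. -/
def matJ₃ : Matrix (Fin 8) (Fin 8) ℤ :=
  Matrix.of ![![0, 0, -1, 0, 0, 0, 0, 0], ![0, 0, 0, 1, 0, 0, 0, 0], ![1, 0, 0, 0, 0, 0, 0, 0],
    ![0, -1, 0, 0, 0, 0, 0, 0], ![0, 0, 0, 0, 0, 0, 0, -1], ![0, 0, 0, 0, 0, 0, -1, 0],
    ![0, 0, 0, 0, 0, 1, 0, 0], ![0, 0, 0, 0, 1, 0, 0, 0]]

/-- A square root of three that commutes with `matI` and `matJ₃`. -/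
def matS₃ : Matrix (Fin 8) (Fin 8) ℤ :=
  Matrix.of ![![1, 0, 0, 0, 1, 1, 0, 0], ![0, 1, 0, 0, -1, 1, 0, 0], ![0, 0, 1, 0, 0, 0, 1, 1],
    ![0, 0, 0, 1, 0, 0, -1, 1], ![1, -1, 0, 0, -1, 0, 0, 0], ![1, 1, 0, 0, 0, -1, 0, 0],
    ![0, 0, 1, -1, 0, 0, -1, 0], ![0, 0, 1, 1, 0, 0, 0, -1]]

/-- Left multiplication by `i + j + k`. -/
def matθ : Matrix (Fin 8) (Fin 8) ℤ :=
  Matrix.of ![![0, -1, -1, -1, 0, 0, 0, 0], ![1, 0, -1, 1, 0, 0, 0, 0], ![1, 1, 0, -1, 0, 0, 0, 0],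
    ![1, -1, 1, 0, 0, 0, 0, 0], ![0, 0, 0, 0, 0, -1, -1, -1], ![0, 0, 0, 0, 1, 0, -1, 1],
    ![0, 0, 0, 0, 1, 1, 0, -1], ![0, 0, 0, 0, 1, -1, 1, 0]]

/-- Twice a complex structure that anticommutes with `matθ`. -/
def matJ₉ : Matrix (Fin 8) (Fin 8) ℤ :=
  Matrix.of ![![0, -1, 1, 0, 0, -1, 1, 0], ![1, 0, 0, -1, 1, 0, 0, -1], ![-1, 0, 0, -1, -1, 0, 0, -1],
    ![0, 1, 1, 0, 0, 1, 1, 0], ![0, -1, 1, 0, 0, 1, -1, 0], ![1, 0, 0, -1, -1, 0, 0, 1],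
    ![-1, 0, 0, -1, 1, 0, 0, 1], ![0, 1, 1, 0, 0, -1, -1, 0]]

/-- Three times an involution that commutes with `matθ` and `matJ₉`. -/
def matT : Matrix (Fin 8) (Fin 8) ℤ :=
  Matrix.of ![![-1, 0, 1, -1, 1, -1, -2, 0], ![0, -1, -1, -1, 1, 1, 0, 2], ![1, -1, 1, 0, 0, 2, -1, -1],
    ![-1, -1, 0, 1, 2, 0, 1, -1], ![1, 1, 0, 2, 1, 0, -1, 1], ![-1, 1, 2, 0, 0, 1, 1, 1],
    ![-2, 0, -1, 1, -1, 1, -1, 0], ![0, 2, -1, -1, 1, 1, 0, -1]]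

/-- The set acts on the `E₈` lattice in some orthogonal model. -/
def IsE8Embeddable (S : Set (ℍ[ℝ] × ℍ[ℝ])) : Prop :=
  ∃ R : ℍ[ℝ] × ℍ[ℝ] →+* Matrix (Fin 8) (Fin 8) ℝ, IsOrthogonalModel R ∧ ∀ x ∈ S, R x ∈ e8Ring

theorem IsE8Embeddable.of_image {S : Set (ℍ[ℝ] × ℍ[ℝ])} (σ : ℍ[ℝ] × ℍ[ℝ] →+* ℍ[ℝ] × ℍ[ℝ])
    (hσ : Function.Injective σ) (hstar : ∀ x, σ (star x) = star (σ x))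
    (h : IsE8Embeddable (σ '' S)) : IsE8Embeddable S := by
  obtain ⟨R, hR, hS⟩ := h
  refine ⟨R.comp σ, ⟨hR.injective.comp hσ, fun x => ?_⟩, fun x hx => hS _ ⟨x, hx, rfl⟩⟩
  rw [RingHom.comp_apply, hstar, hR.star_eq, RingHom.comp_apply]

theorem intCast_smul_mem_e8Ring {A : Matrix (Fin 8) (Fin 8) ℝ} (hA : A ∈ e8Ring) (n : ℤ) :
    (n : ℝ) • A ∈ e8Ring := by
  rw [Int.cast_smul_eq_zsmul]
  exact e8Ring.zsmul_mem hA n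

namespace PairData

/-- With E = (1 + cS S)/2 the half-sum of a and b acts through λ and their half-difference through λ
times cS S. For conjugate quadratic surds the half-difference carries the square root that cS
cancels. -/
theorem ofInt_hom {I J S : Matrix (Fin 8) (Fin 8) ℤ} {nI nJ nS : ℤ} {cI cJ cS : ℝ}
    (hI hJ hS hJI hIt hJt hSt hSI hSJ htr hcI hcJ hcS) (a b : ℍ[ℝ]) :
    (ofInt I J S nI nJ nS cI cJ cS hI hJ hS hJI hIt hJt hSt hSI hSJ htr hcI hcJ hcS).hom (a, b) =
      ((a.re + b.re) / 2) • 1 + ((a.re - b.re) / 2 * cS) • ofIntMat S +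
      (((a.imI + b.imI) / 2 * cI) • ofIntMat I +
        ((a.imI - b.imI) / 2 * cS * cI) • ofIntMat (I * S)) +
      (((a.imJ + b.imJ) / 2 * cJ) • ofIntMat J +
        ((a.imJ - b.imJ) / 2 * cS * cJ) • ofIntMat (J * S)) +
      (((a.imK + b.imK) / 2 * cI * cJ) • ofIntMat (I * J) +
        ((a.imK - b.imK) / 2 * cS * cI * cJ) • ofIntMat (I * J * S)) := by
  rw [hom_apply, lam_apply, lam_apply]
  simp only [ofInt, map_mul, mul_add, add_mul, mul_sub, mul_smul_comm, smul_mul_assoc, mul_one,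
    one_mul, smul_add]
  module

/-- The model in which the two quaternions act on the two summands. -/
noncomputable def split : PairData :=
  ofInt matI matJ matS₁ 1 1 1 1 1 1 (by decide +kernel) (by decide +kernel) (by decide +kernel)
    (by decide +kernel) (by decide +kernel) (by decide +kernel) (by decide +kernel)
    (by decide +kernel) (by decide +kernel) (by decide +kernel) (by norm_num) (by norm_num)
    (by norm_num)

theorem inv_sqrt_sq_mul {n : ℤ} (hn : 0 < n) : (Real.sqrt n)⁻¹ ^ 2 * n = 1 := by
  have : (0 : ℝ) < n := by exact_mod_cast hn
  rw [inv_pow, Real.sq_sqrt this.le, inv_mul_cancel₀ this.ne']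

/-- The model over `ℚ(√2)`. -/
noncomputable def octahedral : PairData :=
  ofInt matI matJ matS₂ 1 1 2 1 1 (Real.sqrt (2 : ℤ))⁻¹ (by decide +kernel) (by decide +kernel)
    (by decide +kernel) (by decide +kernel) (by decide +kernel) (by decide +kernel)
    (by decide +kernel) (by decide +kernel) (by decide +kernel) (by decide +kernel) (by norm_num)
    (by norm_num) (inv_sqrt_sq_mul (by norm_num))

/-- The model over `ℚ(√5)`. -/
noncomputable def icosahedral : PairData :=
  ofInt matI matJ matS₅ 1 1 5 1 1 (Real.sqrt (5 : ℤ))⁻¹ (by decide +kernel) (by decide +kernel)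
    (by decide +kernel) (by decide +kernel) (by decide +kernel) (by decide +kernel)
    (by decide +kernel) (by decide +kernel) (by decide +kernel) (by decide +kernel) (by norm_num)
    (by norm_num) (inv_sqrt_sq_mul (by norm_num))

/-- The model over `ℚ(√3)`. -/
noncomputable def dicyclic : PairData :=
  ofInt matI matJ₃ matS₃ 1 1 3 1 1 (Real.sqrt (3 : ℤ))⁻¹ (by decide +kernel) (by decide +kernel)
    (by decide +kernel) (by decide +kernel) (by decide +kernel) (by decide +kernel)
    (by decide +kernel) (by decide +kernel) (by decide +kernel) (by decide +kernel) (by norm_num)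
    (by norm_num) (inv_sqrt_sq_mul (by norm_num))

/-- The model for two commuting elements of order three that act on orthogonal subspaces. -/
noncomputable def bihexagonal : PairData :=
  ofInt matθ matJ₉ matT 3 4 9 (Real.sqrt (3 : ℤ))⁻¹ (1 / 2) (1 / 3) (by decide +kernel)
    (by decide +kernel) (by decide +kernel) (by decide +kernel) (by decide +kernel)
    (by decide +kernel) (by decide +kernel) (by decide +kernel) (by decide +kernel)
    (by decide +kernel) (inv_sqrt_sq_mul (by norm_num)) (by norm_num) (by norm_num)

end PairData

/-- The coordinates of a pair of quaternions are conjugate elements of `½ ℤ[r]`. -/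
structure HasCoeffs (r r' : ℝ) (p₀ p₁ p₂ p₃ q₀ q₁ q₂ q₃ : ℤ) (x : ℍ[ℝ] × ℍ[ℝ]) : Prop where
  re₁ : 2 * x.1.re = p₀ + q₀ * r
  re₂ : 2 * x.2.re = p₀ + q₀ * r'
  imI₁ : 2 * x.1.imI = p₁ + q₁ * r
  imI₂ : 2 * x.2.imI = p₁ + q₁ * r'
  imJ₁ : 2 * x.1.imJ = p₂ + q₂ * r
  imJ₂ : 2 * x.2.imJ = p₂ + q₂ * r'
  imK₁ : 2 * x.1.imK = p₃ + q₃ * r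
  imK₂ : 2 * x.2.imK = p₃ + q₃ * r'

open PairData

/-- Here s is the square root normalizing S and u ± v s are the conjugate generators; no
irrationality other than those of u and v survives. The surds √2 and √3 use u = 0, v = 1, the golden
ratio u = v = 1/2. -/
theorem ofInt_hom_of_hasCoeffs {I J S : Matrix (Fin 8) (Fin 8) ℤ} {nI nJ nS : ℤ} {cS : ℝ}
    (hI hJ hS hJI hIt hJt hSt hSI hSJ htr hcI hcJ hcS) {s u v : ℝ} (hs : s * cS = 1)
    {p₀ p₁ p₂ p₃ q₀ q₁ q₂ q₃ : ℤ} {x : ℍ[ℝ] × ℍ[ℝ]}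
    (h : HasCoeffs (u + v * s) (u - v * s) p₀ p₁ p₂ p₃ q₀ q₁ q₂ q₃ x) :
    (ofInt I J S nI nJ nS 1 1 cS hI hJ hS hJI hIt hJt hSt hSI hSJ htr hcI hcJ hcS).hom x =
      ((p₀ + q₀ * u) / 2 : ℝ) • 1 + (q₀ * v / 2 : ℝ) • ofIntMat S +
      (((p₁ + q₁ * u) / 2 : ℝ) • ofIntMat I + (q₁ * v / 2 : ℝ) • ofIntMat (I * S)) +
      (((p₂ + q₂ * u) / 2 : ℝ) • ofIntMat J + (q₂ * v / 2 : ℝ) • ofIntMat (J * S)) +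
      (((p₃ + q₃ * u) / 2 : ℝ) • ofIntMat (I * J) + (q₃ * v / 2 : ℝ) • ofIntMat (I * J * S)) := by
  obtain ⟨a, b⟩ := x
  rw [ofInt_hom]
  obtain ⟨h1, h2, h3, h4, h5, h6, h7, h8⟩ := h
  simp only [mul_one] at *
  congr 1
  · congr 1
    · congr 1
      · congr 1
        · congr 1; linear_combination (h1 + h2) / 4
        · congr 1; linear_combination cS / 4 * (h1 - h2) + q₀ * v / 2 * hs
      · congr 1
        · congr 1; linear_combination (h3 + h4) / 4
        · congr 1; linear_combination cS / 4 * (h3 - h4) + q₁ * v / 2 * hs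
    · congr 1
      · congr 1; linear_combination (h5 + h6) / 4
      · congr 1; linear_combination cS / 4 * (h5 - h6) + q₂ * v / 2 * hs
  · congr 1
    · congr 1; linear_combination (h7 + h8) / 4
    · congr 1; linear_combination cS / 4 * (h7 - h8) + q₃ * v / 2 * hs

end E8Models

/-! ### Orders of pairs of quaternions that preserve E₈. -/

section Embeddings

open PairData

theorem ofIntMat_zsmul (n : ℤ) (N : Matrix (Fin 8) (Fin 8) ℤ) :
    ofIntMat (n • N) = (n : ℝ) • ofIntMat N := by
  rw [map_zsmul, Int.cast_smul_eq_zsmul]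

theorem ofIntMat_mem_e8Ring {N : Matrix (Fin 8) (Fin 8) ℤ} (h : HalfPreserves ((2 : ℤ) • N)) :
    ofIntMat N ∈ e8Ring := by
  have := h.mem_e8Ring
  rwa [ofIntMat_zsmul, smul_smul, Int.cast_ofNat, one_div_mul_cancel two_ne_zero, one_smul] at this

theorem quarter_mem_e8Ring {N : Matrix (Fin 8) (Fin 8) ℤ} (h2 : N = (2 : ℤ) • N.map (· / 2))
    (h : HalfPreserves (N.map (· / 2))) : (1 / 4 : ℝ) • ofIntMat N ∈ e8Ring := by
  have := h.mem_e8Ring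
  rwa [h2, ofIntMat_zsmul, smul_smul, show (1 / 4 : ℝ) * (2 : ℤ) = 1 / 2 by norm_num]

/-- The congruences describe the span of the Hurwitz quaternions, √2 and the elements (i - 1)/√2, (j
- 1)/√2, (k - 1)/√2. Each generator acts by an integral or half-integral matrix preserving E₈. -/
theorem octahedral_mem {p₀ p₁ p₂ p₃ q₀ q₁ q₂ q₃ : ℤ} {x : ℍ[ℝ] × ℍ[ℝ]}
    (h : HasCoeffs √2 (-√2) p₀ p₁ p₂ p₃ q₀ q₁ q₂ q₃ x) (h1 : 2 ∣ p₁ - p₀)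
    (h2 : 2 ∣ p₂ - p₀) (h3 : 2 ∣ p₃ - p₀) (hq : 2 ∣ q₀ + q₁ + q₂ + q₃) :
    octahedral.hom x ∈ e8Ring := by
  have hI : ofIntMat matI ∈ e8Ring := ofIntMat_mem_e8Ring (by decide +kernel)
  have hJ : ofIntMat matJ ∈ e8Ring := ofIntMat_mem_e8Ring (by decide +kernel)
  have hK : ofIntMat (matI * matJ) ∈ e8Ring := ofIntMat_mem_e8Ring (by decide +kernel)
  have hS : ofIntMat matS₂ ∈ e8Ring := ofIntMat_mem_e8Ring (by decide +kernel)
  have hω : (1 / 2 : ℝ) • ofIntMat (1 + matI + matJ + matI * matJ) ∈ e8Ring :=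
    HalfPreserves.mem_e8Ring (by decide +kernel)
  have hSI : (1 / 2 : ℝ) • ofIntMat (matI * matS₂ - matS₂) ∈ e8Ring :=
    HalfPreserves.mem_e8Ring (by decide +kernel)
  have hSJ : (1 / 2 : ℝ) • ofIntMat (matJ * matS₂ - matS₂) ∈ e8Ring :=
    HalfPreserves.mem_e8Ring (by decide +kernel)
  have hSK : (1 / 2 : ℝ) • ofIntMat (matI * matJ * matS₂ - matS₂) ∈ e8Ring :=
    HalfPreserves.mem_e8Ring (by decide +kernel)
  obtain ⟨a₁, h1⟩ := h1
  obtain ⟨a₂, h2⟩ := h2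
  obtain ⟨a₃, h3⟩ := h3
  obtain ⟨c, hq⟩ := hq
  obtain rfl : p₁ = p₀ + 2 * a₁ := by omega
  obtain rfl : p₂ = p₀ + 2 * a₂ := by omega
  obtain rfl : p₃ = p₀ + 2 * a₃ := by omega
  obtain rfl : q₀ = 2 * c - q₁ - q₂ - q₃ := by omega
  rw [octahedral, ofInt_hom_of_hasCoeffs (s := √2) (u := 0) (v := 1)
    (hs := by rw [Int.cast_ofNat]; exact mul_inv_cancel₀ (by positivity))
    (h := by rw [zero_add, zero_sub, one_mul]; exact h)]
  have hmem := add_mem (add_mem (add_mem (add_mem (add_mem (add_mem (add_mem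
    (intCast_smul_mem_e8Ring hω p₀) (intCast_smul_mem_e8Ring hI a₁))
    (intCast_smul_mem_e8Ring hJ a₂)) (intCast_smul_mem_e8Ring hK a₃))
    (intCast_smul_mem_e8Ring hSI q₁)) (intCast_smul_mem_e8Ring hSJ q₂))
    (intCast_smul_mem_e8Ring hSK q₃)) (intCast_smul_mem_e8Ring hS c)
  convert hmem using 1
  simp only [map_add, map_sub, map_one]
  push_cast
  module

/-- The congruences describe the span of 1, i, j, k and of (1 + √3 i)/2, (i + √3)/2, (j + √3 k)/2,
(k + √3 j)/2. -/
theorem dicyclic_mem {p₀ p₁ p₂ p₃ q₀ q₁ q₂ q₃ : ℤ} {x : ℍ[ℝ] × ℍ[ℝ]}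
    (h : HasCoeffs √3 (-√3) p₀ p₁ p₂ p₃ q₀ q₁ q₂ q₃ x) (h0 : 2 ∣ p₀ - q₁)
    (h1 : 2 ∣ p₁ - q₀) (h2 : 2 ∣ p₂ - q₃) (h3 : 2 ∣ p₃ - q₂) :
    dicyclic.hom x ∈ e8Ring := by
  have hI : ofIntMat matI ∈ e8Ring := ofIntMat_mem_e8Ring (by decide +kernel)
  have hJ : ofIntMat matJ₃ ∈ e8Ring := ofIntMat_mem_e8Ring (by decide +kernel)
  have hK : ofIntMat (matI * matJ₃) ∈ e8Ring := ofIntMat_mem_e8Ring (by decide +kernel)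
  have hA : (1 / 2 : ℝ) • ofIntMat (1 + matI * matS₃) ∈ e8Ring :=
    HalfPreserves.mem_e8Ring (by decide +kernel)
  have hB : (1 / 2 : ℝ) • ofIntMat (matI + matS₃) ∈ e8Ring :=
    HalfPreserves.mem_e8Ring (by decide +kernel)
  have hC : (1 / 2 : ℝ) • ofIntMat (matJ₃ + matI * matJ₃ * matS₃) ∈ e8Ring :=
    HalfPreserves.mem_e8Ring (by decide +kernel)
  have hD : (1 / 2 : ℝ) • ofIntMat (matI * matJ₃ + matJ₃ * matS₃) ∈ e8Ring :=
    HalfPreserves.mem_e8Ring (by decide +kernel)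
  obtain ⟨a₀, h0⟩ := h0
  obtain ⟨a₁, h1⟩ := h1
  obtain ⟨a₂, h2⟩ := h2
  obtain ⟨a₃, h3⟩ := h3
  obtain rfl : p₀ = q₁ + 2 * a₀ := by omega
  obtain rfl : p₁ = q₀ + 2 * a₁ := by omega
  obtain rfl : p₂ = q₃ + 2 * a₂ := by omega
  obtain rfl : p₃ = q₂ + 2 * a₃ := by omega
  rw [dicyclic, ofInt_hom_of_hasCoeffs (s := √3) (u := 0) (v := 1)
    (hs := by rw [Int.cast_ofNat]; exact mul_inv_cancel₀ (by positivity))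
    (h := by rw [zero_add, zero_sub, one_mul]; exact h)]
  have hmem := add_mem (add_mem (add_mem (add_mem (add_mem (add_mem (add_mem
    (intCast_smul_mem_e8Ring hA q₁) (intCast_smul_mem_e8Ring hB q₀))
    (intCast_smul_mem_e8Ring hC q₃)) (intCast_smul_mem_e8Ring hD q₂))
    (intCast_smul_mem_e8Ring e8Ring.one_mem a₀)) (intCast_smul_mem_e8Ring hI a₁))
    (intCast_smul_mem_e8Ring hJ a₂)) (intCast_smul_mem_e8Ring hK a₃)
  convert hmem using 1
  simp only [map_add, map_one]
  push_cast
  module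

open Real in
/-- Membership for the icosian ring, generated over `ℤ[φ]` by `1`, `i`, `(1 + i + j + k) / 2` and
`(φ + (φ - 1) i + j) / 2`. -/
theorem icosahedral_mem {p₀ p₁ p₂ p₃ q₀ q₁ q₂ q₃ : ℤ} {x : ℍ[ℝ] × ℍ[ℝ]}
    (h : HasCoeffs goldenRatio goldenConj p₀ p₁ p₂ p₃ q₀ q₁ q₂ q₃ x)
    (hp0 : 2 ∣ p₀ - p₃ - (q₂ - q₃)) (hq0 : 2 ∣ q₀ - q₃ - (p₂ - p₃) - (q₂ - q₃))
    (hp1 : 2 ∣ p₁ - p₃ - (q₂ - q₃) + (p₂ - p₃)) (hq1 : 2 ∣ q₁ - q₃ - (p₂ - p₃)) :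
    icosahedral.hom x ∈ e8Ring := by
  have hI : ofIntMat matI ∈ e8Ring := ofIntMat_mem_e8Ring (by decide +kernel)
  have hφ : (1 / 2 : ℝ) • ofIntMat (1 + matS₅) ∈ e8Ring :=
    HalfPreserves.mem_e8Ring (by decide +kernel)
  have hφI : (1 / 2 : ℝ) • ofIntMat (matI + matI * matS₅) ∈ e8Ring :=
    HalfPreserves.mem_e8Ring (by decide +kernel)
  have hω : (1 / 2 : ℝ) • ofIntMat (1 + matI + matJ + matI * matJ) ∈ e8Ring :=
    HalfPreserves.mem_e8Ring (by decide +kernel)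
  have hωφ : (1 / 4 : ℝ) • ofIntMat (1 + matS₅ + (matI + matI * matS₅) + (matJ + matJ * matS₅) +
      (matI * matJ + matI * matJ * matS₅)) ∈ e8Ring :=
    quarter_mem_e8Ring (by decide +kernel) (by decide +kernel)
  have hA : (1 / 4 : ℝ) • ofIntMat (1 + matS₅ + (matI * matS₅ - matI) + (2 : ℤ) • matJ) ∈ e8Ring :=
    quarter_mem_e8Ring (by decide +kernel) (by decide +kernel)
  have hAφ : (1 / 4 : ℝ) • ofIntMat ((3 : ℤ) • 1 + matS₅ + (2 : ℤ) • matI + matJ + matJ * matS₅) ∈ e8Ring :=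
    quarter_mem_e8Ring (by decide +kernel) (by decide +kernel)
  obtain ⟨c₀, hp0⟩ := hp0
  obtain ⟨d₀, hq0⟩ := hq0
  obtain ⟨c₁, hp1⟩ := hp1
  obtain ⟨d₁, hq1⟩ := hq1
  obtain rfl : p₀ = 2 * c₀ + p₃ + (q₂ - q₃) := by omega
  obtain rfl : q₀ = 2 * d₀ + q₃ + (p₂ - p₃) + (q₂ - q₃) := by omega
  obtain rfl : p₁ = 2 * c₁ + p₃ + (q₂ - q₃) - (p₂ - p₃) := by omega
  obtain rfl : q₁ = 2 * d₁ + q₃ + (p₂ - p₃) := by omega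
  rw [icosahedral, ofInt_hom_of_hasCoeffs (s := √5) (u := 1 / 2) (v := 1 / 2)
    (hs := by rw [Int.cast_ofNat]; exact mul_inv_cancel₀ (by positivity))
    (h := by
      rw [show 1 / 2 + 1 / 2 * √5 = goldenRatio by rw [goldenRatio]; ring,
        show 1 / 2 - 1 / 2 * √5 = goldenConj by rw [goldenConj]; ring]
      exact h)]
  have hmem := add_mem (add_mem (add_mem (add_mem (add_mem (add_mem (add_mem
    (intCast_smul_mem_e8Ring hω p₃) (intCast_smul_mem_e8Ring hωφ q₃))
    (intCast_smul_mem_e8Ring hA (p₂ - p₃))) (intCast_smul_mem_e8Ring hAφ (q₂ - q₃)))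
    (intCast_smul_mem_e8Ring e8Ring.one_mem c₀)) (intCast_smul_mem_e8Ring hφ d₀))
    (intCast_smul_mem_e8Ring hI c₁)) (intCast_smul_mem_e8Ring hφI d₁)
  convert hmem using 1
  simp only [map_add, map_sub, map_one, ofIntMat_zsmul]
  push_cast
  module

/-- Membership for pairs of Hurwitz quaternions that are congruent modulo `1 + i`. -/
theorem split_mem {p₀ p₁ p₂ p₃ q₀ q₁ q₂ q₃ : ℤ} {x : ℍ[ℝ] × ℍ[ℝ]}
    (h0 : 2 * x.1.re = p₀) (h1 : 2 * x.1.imI = p₁) (h2 : 2 * x.1.imJ = p₂) (h3 : 2 * x.1.imK = p₃)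
    (k0 : 2 * x.2.re = q₀) (k1 : 2 * x.2.imI = q₁) (k2 : 2 * x.2.imJ = q₂) (k3 : 2 * x.2.imK = q₃)
    (hp1 : 2 ∣ p₁ - p₀) (hp2 : 2 ∣ p₂ - p₀) (hp3 : 2 ∣ p₃ - p₀) (hq0 : 2 ∣ q₀ - p₀)
    (hq1 : 2 ∣ q₁ - p₀) (hq2 : 2 ∣ q₂ - p₀) (hq3 : 2 ∣ q₃ - p₀)
    (hs : 4 ∣ p₀ + p₁ + p₂ + p₃ - (q₀ + q₁ + q₂ + q₃)) : split.hom x ∈ e8Ring := by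
  have hI : ofIntMat matI ∈ e8Ring := ofIntMat_mem_e8Ring (by decide +kernel)
  have hJ : ofIntMat matJ ∈ e8Ring := ofIntMat_mem_e8Ring (by decide +kernel)
  have hK : ofIntMat (matI * matJ) ∈ e8Ring := ofIntMat_mem_e8Ring (by decide +kernel)
  have hω : (1 / 2 : ℝ) • ofIntMat (1 + matI + matJ + matI * matJ) ∈ e8Ring :=
    HalfPreserves.mem_e8Ring (by decide +kernel)
  have hS : ofIntMat matS₁ ∈ e8Ring := ofIntMat_mem_e8Ring (by decide +kernel)
  -- As (1 - S)/2 is the projection to the second summand, this is the pair (0, 1 + i); likewise (0,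
  -- 1 + j) and (0, 1 + k) below. With the diagonal Hurwitz quaternions and S = (1, -1) they span
  -- all pairs congruent modulo 1 + i.
  have hSI : (1 / 2 : ℝ) • ofIntMat (1 + matI - (matS₁ + matI * matS₁)) ∈ e8Ring :=
    HalfPreserves.mem_e8Ring (by decide +kernel)
  have hSJ : (1 / 2 : ℝ) • ofIntMat (1 + matJ - (matS₁ + matJ * matS₁)) ∈ e8Ring :=
    HalfPreserves.mem_e8Ring (by decide +kernel)
  have hSK : (1 / 2 : ℝ) • ofIntMat (1 + matI * matJ - (matS₁ + matI * matJ * matS₁)) ∈ e8Ring :=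
    HalfPreserves.mem_e8Ring (by decide +kernel)
  obtain ⟨a₁, hp1⟩ := hp1
  obtain ⟨a₂, hp2⟩ := hp2
  obtain ⟨a₃, hp3⟩ := hp3
  obtain ⟨b₀, hq0⟩ := hq0
  obtain ⟨b₁, hq1⟩ := hq1
  obtain ⟨b₂, hq2⟩ := hq2
  obtain ⟨b₃, hq3⟩ := hq3
  obtain ⟨c, hs⟩ := hs
  obtain rfl : p₁ = p₀ + 2 * a₁ := by omega
  obtain rfl : p₂ = p₀ + 2 * a₂ := by omega
  obtain rfl : p₃ = p₀ + 2 * a₃ := by omega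
  obtain rfl : q₁ = p₀ + 2 * b₁ := by omega
  obtain rfl : q₂ = p₀ + 2 * b₂ := by omega
  obtain rfl : q₃ = p₀ + 2 * b₃ := by omega
  obtain rfl : b₀ = a₁ + a₂ + a₃ - b₁ - b₂ - b₃ - 2 * c := by omega
  obtain rfl : q₀ = p₀ + 2 * (a₁ + a₂ + a₃ - b₁ - b₂ - b₃ - 2 * c) := by omega
  obtain ⟨a, b⟩ := x
  rw [split, ofInt_hom]
  obtain rfl : a = mkQ (p₀ / 2) (p₀ / 2 + a₁) (p₀ / 2 + a₂) (p₀ / 2 + a₃) := by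
    push_cast at *
    ext <;> simp <;> linarith
  obtain rfl : b = mkQ (p₀ / 2 + (a₁ + a₂ + a₃ - b₁ - b₂ - b₃ - 2 * c)) (p₀ / 2 + b₁) (p₀ / 2 + b₂)
      (p₀ / 2 + b₃) := by
    push_cast at *
    ext <;> simp <;> linarith
  have hmem := add_mem (add_mem (add_mem (add_mem (add_mem (add_mem (add_mem (add_mem
    (intCast_smul_mem_e8Ring hω p₀) (intCast_smul_mem_e8Ring hI a₁))
    (intCast_smul_mem_e8Ring hJ a₂)) (intCast_smul_mem_e8Ring hK a₃))
    (intCast_smul_mem_e8Ring hSI (b₁ - a₁))) (intCast_smul_mem_e8Ring hSJ (b₂ - a₂)))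
    (intCast_smul_mem_e8Ring hSK (b₃ - a₃)))
    (intCast_smul_mem_e8Ring e8Ring.one_mem (a₁ + a₂ + a₃ - b₁ - b₂ - b₃ - c)))
    (intCast_smul_mem_e8Ring hS (c - (a₁ + a₂ + a₃ - b₁ - b₂ - b₃)))
  convert hmem using 1
  simp only [map_add, map_sub, map_one, re_mkQ, imI_mkQ, imJ_mkQ, imK_mkQ]
  push_cast
  module

/-- The quaternion `(-1 + √3 i) / 2`. -/
noncomputable def qω : ℍ[ℝ] := mkQ (-1 / 2) (√3 / 2) 0 0

/-- The quaternion `j`. -/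
def qj : ℍ[ℝ] := mkQ 0 0 1 0

theorem bihexagonal_mem_left : bihexagonal.hom (qω, 1) ∈ e8Ring := by
  -- The pair acts as (3 - 3T + 3θ + θT)/12. Subtracting the identity leaves M/2 with M integral, so
  -- the criterion applies to 2 + M.
  obtain ⟨M, hM, hP⟩ : ∃ M : Matrix (Fin 8) (Fin 8) ℤ, (3 : ℤ) • matθ + matθ * matT - (9 : ℤ) • 1 -
      (3 : ℤ) • matT = (6 : ℤ) • M ∧ HalfPreserves ((2 : ℤ) • 1 + M) :=
    ⟨((3 : ℤ) • matθ + matθ * matT - (9 : ℤ) • 1 - (3 : ℤ) • matT).map (· / 6),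
      by decide +kernel, by decide +kernel⟩
  have h := hP.mem_e8Ring
  have hM' : ofIntMat M = (1 / 6 : ℝ) • ofIntMat ((6 : ℤ) • M) := by
    rw [ofIntMat_zsmul, smul_smul]; norm_num
  have hs : √3 * (√3)⁻¹ = 1 := mul_inv_cancel₀ (by positivity)
  have e1 : √3 / 2 / 2 * (√3)⁻¹ = 1 / 4 := by linear_combination hs / 4
  have e2 : √3 / 2 / 2 * (1 / 3) * (√3)⁻¹ = 1 / 12 := by linear_combination hs / 12
  rw [bihexagonal, ofInt_hom]
  convert h using 1
  rw [map_add, hM', ← hM]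
  simp only [map_add, map_sub, map_one, ofIntMat_zsmul, qω, re_mkQ, imI_mkQ, imJ_mkQ, imK_mkQ,
    Quaternion.re_one, Quaternion.imI_one, Quaternion.imJ_one, Quaternion.imK_one, Int.cast_ofNat,
    add_zero, sub_zero, e1, e2, zero_div, zero_mul, zero_smul]
  module

theorem bihexagonal_mem_right : bihexagonal.hom (1, qω) ∈ e8Ring := by
  obtain ⟨M, hM, hP⟩ : ∃ M : Matrix (Fin 8) (Fin 8) ℤ, (3 : ℤ) • matθ - matθ * matT - (9 : ℤ) • 1 +
      (3 : ℤ) • matT = (6 : ℤ) • M ∧ HalfPreserves ((2 : ℤ) • 1 + M) :=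
    ⟨((3 : ℤ) • matθ - matθ * matT - (9 : ℤ) • 1 + (3 : ℤ) • matT).map (· / 6),
      by decide +kernel, by decide +kernel⟩
  have h := hP.mem_e8Ring
  have hM' : ofIntMat M = (1 / 6 : ℝ) • ofIntMat ((6 : ℤ) • M) := by
    rw [ofIntMat_zsmul, smul_smul]; norm_num
  have hs : √3 * (√3)⁻¹ = 1 := mul_inv_cancel₀ (by positivity)
  have e1 : √3 / 2 / 2 * (√3)⁻¹ = 1 / 4 := by linear_combination hs / 4
  have e3 : -(√3 / 2) / 2 * (1 / 3) * (√3)⁻¹ = -1 / 12 := by linear_combination -hs / 12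
  rw [bihexagonal, ofInt_hom]
  convert h using 1
  rw [map_add, hM', ← hM]
  simp only [map_add, map_sub, map_one, ofIntMat_zsmul, qω, re_mkQ, imI_mkQ, imJ_mkQ, imK_mkQ,
    Quaternion.re_one, Quaternion.imI_one, Quaternion.imJ_one, Quaternion.imK_one, Int.cast_ofNat,
    add_zero, zero_add, sub_zero, zero_sub, e1, e3, zero_div, zero_mul, zero_smul]
  module

theorem bihexagonal_mem_j : bihexagonal.hom (qj, qj) ∈ e8Ring := by
  have h : (1 / 2 : ℝ) • ofIntMat matJ₉ ∈ e8Ring := HalfPreserves.mem_e8Ring (by decide +kernel)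
  rw [bihexagonal, ofInt_hom]
  convert h using 1
  simp [qj]

end Embeddings

/-! ### Unit quaternions, conjugation and frames. -/

section UnitQuaternions

open Quaternion

theorem Quaternion.re_mul_comm (a b : ℍ[ℝ]) : (a * b).re = (b * a).re := by
  simp only [re_mul]; ring

theorem Quaternion.re_mul_add_re_mul_star (a b : ℍ[ℝ]) :
    (a * b).re + (a * star b).re = 2 * a.re * b.re := by
  simp only [re_mul, re_star, imI_star, imJ_star, imK_star]; ring

theorem Quaternion.mul_self_add_one {a : ℍ[ℝ]} (ha : normSq a = 1) :
    a * a + 1 = (2 * a.re) • a := by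
  rw [normSq_def'] at ha
  ext <;> simp
  · linear_combination -ha
  all_goals ring

theorem Quaternion.mul_self_eq {a : ℍ[ℝ]} (ha : normSq a = 1) :
    a * a = (2 * a.re) • a - 1 := eq_sub_of_add_eq (mul_self_add_one ha)

theorem Quaternion.re_mul_self {a : ℍ[ℝ]} (ha : normSq a = 1) :
    (a * a).re = 2 * a.re ^ 2 - 1 := by
  rw [mul_self_eq ha]; simp; ring

theorem Quaternion.eq_one_of_re {a : ℍ[ℝ]} (ha : normSq a = 1) (h : a.re = 1) : a = 1 := by
  rw [normSq_def', h] at ha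
  have h1 : a.imI = 0 := by nlinarith [sq_nonneg a.imI, sq_nonneg a.imJ, sq_nonneg a.imK]
  have h2 : a.imJ = 0 := by nlinarith [sq_nonneg a.imI, sq_nonneg a.imJ, sq_nonneg a.imK]
  have h3 : a.imK = 0 := by nlinarith [sq_nonneg a.imI, sq_nonneg a.imJ, sq_nonneg a.imK]
  ext <;> simp [*]

theorem Quaternion.eq_neg_one_of_re {a : ℍ[ℝ]} (ha : normSq a = 1) (h : a.re = -1) : a = -1 := by
  rw [← neg_neg a, eq_one_of_re (a := -a) (by rw [normSq_neg, ha]) (by simp [h])]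

theorem Quaternion.abs_re_le {a : ℍ[ℝ]} (ha : normSq a = 1) : |a.re| ≤ 1 := by
  rw [normSq_def'] at ha
  rw [← sq_le_one_iff_abs_le_one]
  nlinarith [sq_nonneg a.imI, sq_nonneg a.imJ, sq_nonneg a.imK]

theorem Quaternion.mul_star_of_normSq {a : ℍ[ℝ]} (ha : normSq a = 1) : a * star a = 1 := by
  rw [self_mul_star, ha]; rfl

theorem Quaternion.star_mul_of_normSq {a : ℍ[ℝ]} (ha : normSq a = 1) : star a * a = 1 := by
  rw [star_mul_self, ha]; rfl

theorem Quaternion.mul_self_of_pure {a : ℍ[ℝ]} (ha : normSq a = 1) (h : a.re = 0) :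
    a * a = -1 := by
  rw [mul_self_eq ha, h]; simp

/-- Conjugation by a unit quaternion. -/
noncomputable def conjHom (p : ℍ[ℝ]) (hp : normSq p = 1) : ℍ[ℝ] →+* ℍ[ℝ] where
  toFun x := p * x * star p
  map_one' := by rw [mul_one, mul_star_of_normSq hp]
  map_zero' := by simp
  map_add' x y := by rw [mul_add, add_mul]
  map_mul' x y := by
    rw [show p * x * star p * (p * y * star p) = p * x * (star p * p) * y * star p by
      simp only [mul_assoc], star_mul_of_normSq hp, mul_one]
    simp only [mul_assoc]

theorem conjHom_apply (p : ℍ[ℝ]) (hp : normSq p = 1) (x : ℍ[ℝ]) :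
    conjHom p hp x = p * x * star p := rfl

theorem conjHom_re (p : ℍ[ℝ]) (hp : normSq p = 1) (x : ℍ[ℝ]) : (conjHom p hp x).re = x.re := by
  rw [conjHom_apply, re_mul_comm, ← mul_assoc, star_mul_of_normSq hp, one_mul]

theorem conjHom_star (p : ℍ[ℝ]) (hp : normSq p = 1) (x : ℍ[ℝ]) :
    conjHom p hp (star x) = star (conjHom p hp x) := by
  simp [conjHom_apply, mul_assoc]

theorem conjHom_injective (p : ℍ[ℝ]) (hp : normSq p = 1) : Function.Injective (conjHom p hp) :=
  (conjHom p hp).injective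

theorem conjHom_smul (p : ℍ[ℝ]) (hp : normSq p = 1) (r : ℝ) (x : ℍ[ℝ]) :
    conjHom p hp (r • x) = r • conjHom p hp x := by
  simp [conjHom_apply]

/-- An intertwiner p x = y p, rescaled to a unit, conjugates x to y. This avoids solving for
rotations explicitly. -/
theorem exists_normSq_eq_one_conj {p : ℍ[ℝ]} (hp : p ≠ 0) : ∃ q : ℍ[ℝ], ∃ hq : normSq q = 1,
    ∀ x y, p * x = y * p → conjHom q hq x = y := by
  have hn : 0 < normSq p := lt_of_le_of_ne normSq_nonneg fun h => hp (normSq_eq_zero.1 h.symm)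
  have hs : (√(normSq p))⁻¹ * (√(normSq p))⁻¹ * normSq p = 1 := by
    have := Real.mul_self_sqrt hn.le
    have h0 : √(normSq p) ≠ 0 := (Real.sqrt_pos.2 hn).ne'
    field_simp
    nlinarith
  have hq : normSq ((√(normSq p))⁻¹ • p) = 1 := by
    rw [normSq_smul, sq, hs]
  refine ⟨_, hq, fun x y h => ?_⟩
  rw [conjHom_apply, smul_mul_assoc, h, ← mul_smul_comm, mul_assoc, mul_star_of_normSq hq, mul_one]

/-- An orthonormal pair of pure quaternions. -/
structure IsFrame (x y : ℍ[ℝ]) : Prop where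
  normSq₁ : normSq x = 1
  normSq₂ : normSq y = 1
  re₁ : x.re = 0
  re₂ : y.re = 0
  orth : (x * y).re = 0

/-- The intertwiner i + x takes x to i, and j serves when x = -i. The image z of y is then
orthogonal to i, and 1 - jz commutes with i and takes z to j; when it vanishes, z = -j and i serves.
-/
theorem IsFrame.exists_conj {x y : ℍ[ℝ]} (h : IsFrame x y) : ∃ p : ℍ[ℝ], ∃ hp : normSq p = 1,
    conjHom p hp x = mkQ 0 1 0 0 ∧ conjHom p hp y = mkQ 0 0 1 0 := by
  obtain ⟨hx, hy, hx0, hy0, ho⟩ := h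
  have hxx := mul_self_of_pure hx hx0
  obtain ⟨p, hp, hpx⟩ : ∃ p : ℍ[ℝ], ∃ hp : normSq p = 1, conjHom p hp x = mkQ 0 1 0 0 := by
    by_cases h : mkQ 0 1 0 0 + x = 0
    · obtain rfl := eq_neg_of_add_eq_zero_right h
      have hj : mkQ 0 0 1 0 ≠ 0 := fun h => by simpa using congrArg QuaternionAlgebra.imJ h
      obtain ⟨q, hq, H⟩ := exists_normSq_eq_one_conj hj
      refine ⟨q, hq, H _ _ ?_⟩
      ext <;> simp
    · obtain ⟨q, hq, H⟩ := exists_normSq_eq_one_conj h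
      refine ⟨q, hq, H _ _ ?_⟩
      rw [add_mul, mul_add, hxx, add_comm]
      congr 1
      ext <;> simp
  set z := conjHom p hp y with hz
  have hz0 : z.re = 0 := by rw [hz, conjHom_re, hy0]
  have hzz : z * z = -1 := by rw [hz, ← map_mul, mul_self_of_pure hy hy0, map_neg, map_one]
  have hz1 : z.imI = 0 := by
    have h1 : (conjHom p hp x * z).re = 0 := by rw [hz, ← map_mul, conjHom_re, ho]
    rw [hpx] at h1
    simpa using h1
  obtain ⟨q, hq, hqx, hqy⟩ : ∃ q : ℍ[ℝ], ∃ hq : normSq q = 1,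
      conjHom q hq (mkQ 0 1 0 0) = mkQ 0 1 0 0 ∧ conjHom q hq z = mkQ 0 0 1 0 := by
    by_cases h : 1 - mkQ 0 0 1 0 * z = 0
    · have hz' : z = -mkQ 0 0 1 0 := by
        have h1 := congrArg QuaternionAlgebra.re h
        have h2 := congrArg QuaternionAlgebra.imI h
        simp at h1 h2
        ext
        · simp [hz0]
        · simp [hz1]
        · simp; linarith
        · simp; linarith
      have hj : mkQ 0 1 0 0 ≠ 0 := fun h => by simpa using congrArg QuaternionAlgebra.imI h
      obtain ⟨q, hq, H⟩ := exists_normSq_eq_one_conj hj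
      refine ⟨q, hq, H _ _ rfl, H _ _ ?_⟩
      rw [hz']
      ext <;> simp
    · obtain ⟨q, hq, H⟩ := exists_normSq_eq_one_conj h
      refine ⟨q, hq, H _ _ ?_, H _ _ ?_⟩
      · ext <;> simp [hz0, hz1]
      · rw [sub_mul, mul_sub, mul_assoc, hzz]
        ext <;> simp [hz0, hz1, add_comm]
  have hqp : normSq (q * p) = 1 := by rw [map_mul, hq, hp, one_mul]
  have hc : ∀ w, conjHom (q * p) hqp w = conjHom q hq (conjHom p hp w) := fun w => by
    simp [conjHom_apply, mul_assoc]
  exact ⟨q * p, hqp, by rw [hc, hpx, hqx], by rw [hc, hqy]⟩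

theorem exists_re_mul_eq_zero (x : ℍ[ℝ]) :
    ∃ y : ℍ[ℝ], normSq y = 1 ∧ y.re = 0 ∧ (x * y).re = 0 := by
  by_cases h' : x.imI ^ 2 + x.imJ ^ 2 = 0
  · have h1 : x.imI = 0 := by nlinarith [sq_nonneg x.imI, sq_nonneg x.imJ]
    exact ⟨mkQ 0 1 0 0, by simp [normSq_def'], rfl, by simp [h1]⟩
  · have hpos : 0 < x.imI ^ 2 + x.imJ ^ 2 :=
      lt_of_le_of_ne (by positivity) (Ne.symm h')
    set r := √(x.imI ^ 2 + x.imJ ^ 2)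
    have hr : r * r = x.imI ^ 2 + x.imJ ^ 2 := Real.mul_self_sqrt hpos.le
    have hr0 : r ≠ 0 := (Real.sqrt_pos.2 hpos).ne'
    refine ⟨mkQ 0 (-x.imJ / r) (x.imI / r) 0, ?_, rfl, ?_⟩
    · rw [normSq_def']
      simp
      field_simp
      linarith
    · simp
      ring

theorem exists_isFrame {x : ℍ[ℝ]} (hx : normSq x = 1) (h : x.re = 0) : ∃ y, IsFrame x y := by
  obtain ⟨y, h1, h2, h3⟩ := exists_re_mul_eq_zero x
  exact ⟨y, hx, h1, h, h2, h3⟩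

/-- Conjugation by a pair of unit quaternions. -/
noncomputable def conjPair (p q : ℍ[ℝ]) (hp : normSq p = 1) (hq : normSq q = 1) :
    ℍ[ℝ] × ℍ[ℝ] →+* ℍ[ℝ] × ℍ[ℝ] :=
  (conjHom p hp).prodMap (conjHom q hq)

theorem IsE8Embeddable.of_conj {S : Set (ℍ[ℝ] × ℍ[ℝ])} {R : ℍ[ℝ] × ℍ[ℝ] →+* Matrix (Fin 8) (Fin 8) ℝ}
    (hR : IsOrthogonalModel R) {p q : ℍ[ℝ]} (hp : normSq p = 1) (hq : normSq q = 1)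
    (h : ∀ x ∈ S, R (conjHom p hp x.1, conjHom q hq x.2) ∈ e8Ring) : IsE8Embeddable S := by
  refine IsE8Embeddable.of_image (conjPair p q hp hq) ?_ ?_ ⟨R, hR, ?_⟩
  · rintro ⟨a, b⟩ ⟨c, d⟩ h
    have h1 := congrArg Prod.fst h
    have h2 := congrArg Prod.snd h
    exact Prod.ext (conjHom_injective p hp h1) (conjHom_injective q hq h2)
  · rintro ⟨a, b⟩
    exact Prod.ext (conjHom_star p hp a) (conjHom_star q hq b)
  · rintro _ ⟨x, hx, rfl⟩
    exact h x hx

/-- The number `2 Re x` on both sides is `p + q r` and `p + q r'`. -/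
def HasTrace (r r' : ℝ) (p q : ℤ) (x : ℍ[ℝ] × ℍ[ℝ]) : Prop :=
  2 * x.1.re = p + q * r ∧ 2 * x.2.re = p + q * r'

/-- Once the frame is moved to (i, j), the coordinates of the moved x are the real parts of x, xX*,
xY*, x(XY)*, because conjugation preserves real parts. Arithmetic of traces thus becomes arithmetic
of coordinates. -/
theorem hasCoeffs_conj {r r' : ℝ} {p₀ p₁ p₂ p₃ q₀ q₁ q₂ q₃ : ℤ} {p q : ℍ[ℝ]}
    {hp : normSq p = 1} {hq : normSq q = 1} {X Y x : ℍ[ℝ] × ℍ[ℝ]}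
    (hX₁ : conjHom p hp X.1 = mkQ 0 1 0 0) (hX₂ : conjHom q hq X.2 = mkQ 0 1 0 0)
    (hY₁ : conjHom p hp Y.1 = mkQ 0 0 1 0) (hY₂ : conjHom q hq Y.2 = mkQ 0 0 1 0)
    (h0 : HasTrace r r' p₀ q₀ x) (h1 : HasTrace r r' p₁ q₁ (x * star X))
    (h2 : HasTrace r r' p₂ q₂ (x * star Y)) (h3 : HasTrace r r' p₃ q₃ (x * star (X * Y))) :
    HasCoeffs r r' p₀ p₁ p₂ p₃ q₀ q₁ q₂ q₃ (conjHom p hp x.1, conjHom q hq x.2) := by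
  have e1 : ∀ z : ℍ[ℝ], z.imI = (z * star (mkQ 0 1 0 0)).re := fun z => by simp
  have e2 : ∀ z : ℍ[ℝ], z.imJ = (z * star (mkQ 0 0 1 0)).re := fun z => by simp
  have e3 : ∀ z : ℍ[ℝ], z.imK = (z * star (mkQ 0 1 0 0 * mkQ 0 0 1 0)).re := fun z => by simp
  refine ⟨?_, ?_, ?_, ?_, ?_, ?_, ?_, ?_⟩
  · rw [conjHom_re]; exact h0.1
  · rw [conjHom_re]; exact h0.2
  · rw [e1, ← hX₁, ← conjHom_star, ← map_mul, conjHom_re]; exact h1.1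
  · rw [e1, ← hX₂, ← conjHom_star, ← map_mul, conjHom_re]; exact h1.2
  · rw [e2, ← hY₁, ← conjHom_star, ← map_mul, conjHom_re]; exact h2.1
  · rw [e2, ← hY₂, ← conjHom_star, ← map_mul, conjHom_re]; exact h2.2
  · rw [e3, ← hX₁, ← hY₁, ← map_mul, ← conjHom_star, ← map_mul, conjHom_re]; exact h3.1
  · rw [e3, ← hX₂, ← hY₂, ← map_mul, ← conjHom_star, ← map_mul, conjHom_re]; exact h3.2

end UnitQuaternions

/-! ### Arithmetic constraints on traces. -/

section Admissible

open Quaternion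

/-- The arithmetic properties of a group of pairs of unit quaternions that acts on an even
unimodular lattice of signature `(4, 4)`. -/
structure IsAdmissible (S : Set (ℍ[ℝ] × ℍ[ℝ])) : Prop where
  one_mem : (1, 1) ∈ S
  mul_mem : ∀ x ∈ S, ∀ y ∈ S, x * y ∈ S
  star_mem : ∀ x ∈ S, star x ∈ S
  neg_mem : ∀ x ∈ S, -x ∈ S
  normSq₁ : ∀ x ∈ S, normSq x.1 = 1
  normSq₂ : ∀ x ∈ S, normSq x.2 = 1
  add_int : ∀ x ∈ S, ∃ n : ℤ, 2 * x.1.re + 2 * x.2.re = n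
  mul_int : ∀ x ∈ S, ∃ n : ℤ, 2 * x.1.re * (2 * x.2.re) = n
  int_of_eq : ∀ x ∈ S, x.1.re = x.2.re → ∃ n : ℤ, 2 * x.1.re = n
  not_sixth₁ : ∀ x ∈ S, 2 * x.1.re = 1 → x.2 = 1 → False
  not_sixth₂ : ∀ x ∈ S, x.1 = 1 → 2 * x.2.re = 1 → False
  not_dicyclic₁ : ((-1, 1) : ℍ[ℝ] × ℍ[ℝ]) ∈ S → ∀ x ∈ S, ∀ y ∈ S, 2 * x.1.re = -1 → y.1.re = 0 →
    (x.1 * y.1).re = 0 → False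
  not_dicyclic₂ : ((-1, 1) : ℍ[ℝ] × ℍ[ℝ]) ∈ S → ∀ x ∈ S, ∀ y ∈ S, 2 * x.2.re = -1 → y.2.re = 0 →
    (x.2 * y.2).re = 0 → False

/-- Two numbers of absolute value at most two with integral elementary symmetric functions. -/
theorem conjugates_cases {t s : ℝ} (ht : |t| ≤ 2) (hs : |s| ≤ 2) {m n : ℤ} (hm : t + s = m)
    (hn : t * s = n) (he : t = s → ∃ k : ℤ, t = k) :
    (∃ a b : ℤ, t = a ∧ s = b) ∨ ∃ ε : ℤ, (ε = 1 ∨ ε = -1) ∧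
      ((t = ε * √2 ∧ s = ε * -√2) ∨ (t = ε * √3 ∧ s = ε * -√3) ∨
       (t = ε * Real.goldenRatio ∧ s = ε * Real.goldenConj) ∨
       (t = ε * Real.goldenConj ∧ s = ε * Real.goldenRatio)) := by
  have hte := abs_le.1 ht
  have hse := abs_le.1 hs
  -- Write t, s = m/2 ± e. For even m, e² is an integer E; for odd m it is E + 1/4. In both cases e²
  -- ≤ 4 leaves finitely many E.
  obtain ⟨w, rfl | rfl⟩ := Int.even_or_odd' m
  · obtain ⟨e, rfl⟩ : ∃ e, t = w + e := ⟨t - w, by ring⟩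
    obtain rfl : s = w - e := by push_cast at hm; linarith
    obtain ⟨E, hE⟩ : ∃ E : ℤ, E = w ^ 2 - n := ⟨_, rfl⟩
    have hee : e ^ 2 = E := by rw [hE]; push_cast; linarith [hn]
    have h4 : e ^ 2 ≤ 4 := by nlinarith
    have hE4 : E ≤ 4 := by exact_mod_cast hee ▸ h4
    have hE0 : 0 ≤ E := by exact_mod_cast hee ▸ sq_nonneg e
    -- If |e| > 1, the bounds |w ± e| ≤ 2 leave room only for w = 0.
    have hw : (1 : ℝ) < e ^ 2 → w = 0 := fun h1 => by
      have h2 : |(w : ℝ)| < 1 := by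
        by_contra! h2
        have h3 : 1 < |e| := by rwa [← one_lt_sq_iff_one_lt_abs]
        rcases le_abs.1 h2 with h | h <;> rcases lt_abs.1 h3 with h' | h' <;> linarith
      exact Int.abs_lt_one_iff.1 (by exact_mod_cast h2)
    interval_cases E
    · obtain rfl : e = 0 := by simpa using hee
      exact Or.inl ⟨w, w, by simp, by simp⟩
    · have : e = 1 ∨ e = -1 := by
        have h1 : e ^ 2 = 1 ^ 2 := by simpa using hee
        simpa using sq_eq_sq_iff_eq_or_eq_neg.1 h1
      rcases this with rfl | rfl
      · exact Or.inl ⟨w + 1, w - 1, by simp, by simp⟩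
      · exact Or.inl ⟨w - 1, w + 1, by simp; ring, by simp⟩
    · obtain rfl := hw (by rw [hee]; norm_num)
      have h2 : √2 ^ 2 = 2 := Real.sq_sqrt (by norm_num)
      have : e ^ 2 = √2 ^ 2 := by rw [hee, h2]; norm_num
      rcases sq_eq_sq_iff_eq_or_eq_neg.1 this with rfl | rfl
      · exact Or.inr ⟨1, Or.inl rfl, Or.inl (by simp)⟩
      · exact Or.inr ⟨-1, Or.inr rfl, Or.inl (by simp)⟩
    · obtain rfl := hw (by rw [hee]; norm_num)
      have h2 : √3 ^ 2 = 3 := Real.sq_sqrt (by norm_num)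
      have : e ^ 2 = √3 ^ 2 := by rw [hee, h2]; norm_num
      rcases sq_eq_sq_iff_eq_or_eq_neg.1 this with rfl | rfl
      · exact Or.inr ⟨1, Or.inl rfl, Or.inr (Or.inl (by simp))⟩
      · exact Or.inr ⟨-1, Or.inr rfl, Or.inr (Or.inl (by simp))⟩
    · have : e ^ 2 = 2 ^ 2 := by rw [hee]; norm_num
      rcases sq_eq_sq_iff_eq_or_eq_neg.1 this with rfl | rfl
      · exact Or.inl ⟨w + 2, w - 2, by simp, by simp⟩
      · exact Or.inl ⟨w - 2, w + 2, by simp; ring, by simp⟩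
  · obtain ⟨e, rfl⟩ : ∃ e, t = w + 1 / 2 + e := ⟨t - w - 1 / 2, by ring⟩
    obtain rfl : s = w + 1 / 2 - e := by push_cast at hm; linarith
    obtain ⟨E, hE⟩ : ∃ E : ℤ, E = w ^ 2 + w - n := ⟨_, rfl⟩
    have hee : e ^ 2 = E + 1 / 4 := by rw [hE]; push_cast; linarith [hn]
    have h4 : e ^ 2 ≤ 4 := by nlinarith
    have hE4 : E < 4 := by
      have : (E : ℝ) < 4 := by linarith
      exact_mod_cast this
    have hE0 : -1 < E := by
      have : (-1 : ℝ) < E := by linarith [sq_nonneg e]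
      exact_mod_cast this
    interval_cases E
    · have : e ^ 2 = (1 / 2) ^ 2 := by rw [hee]; norm_num
      rcases sq_eq_sq_iff_eq_or_eq_neg.1 this with rfl | rfl
      · exact Or.inl ⟨w + 1, w, by push_cast; ring, by ring⟩
      · exact Or.inl ⟨w, w + 1, by ring, by push_cast; ring⟩
    · have h5 : √5 ^ 2 = 5 := Real.sq_sqrt (by norm_num)
      have h5' : 2 < √5 := by rw [Real.lt_sqrt] <;> norm_num
      have h7 : e ^ 2 = (√5 / 2) ^ 2 := by rw [hee, div_pow, h5]; norm_num
      have hw : w = 0 ∨ w = -1 := by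
        have h8 : |e| = √5 / 2 := by
          rw [← Real.sqrt_sq_eq_abs, h7, Real.sqrt_sq (by positivity)]
        have h9 := le_abs_self e
        have h10 := neg_abs_le e
        have h1 : (w : ℝ) < 1 := by
          rcases abs_cases e with h | h <;> linarith
        have h2 : (-2 : ℝ) < w := by
          rcases abs_cases e with h | h <;> linarith
        have h1' : w < 1 := by exact_mod_cast h1
        have h2' : -2 < w := by exact_mod_cast h2
        omega
      rcases sq_eq_sq_iff_eq_or_eq_neg.1 h7 with rfl | rfl <;> rcases hw with rfl | rfl
      · exact Or.inr ⟨1, Or.inl rfl, Or.inr (Or.inr (Or.inl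
          ⟨by simp [Real.goldenRatio]; ring, by simp [Real.goldenConj]; ring⟩))⟩
      · exact Or.inr ⟨-1, Or.inr rfl, Or.inr (Or.inr (Or.inr
          ⟨by simp [Real.goldenConj]; ring, by simp [Real.goldenRatio]; ring⟩))⟩
      · exact Or.inr ⟨1, Or.inl rfl, Or.inr (Or.inr (Or.inr
          ⟨by simp [Real.goldenConj]; ring, by simp [Real.goldenRatio]; ring⟩))⟩
      · exact Or.inr ⟨-1, Or.inr rfl, Or.inr (Or.inr (Or.inl
          ⟨by simp [Real.goldenRatio]; ring, by simp [Real.goldenConj]; ring⟩))⟩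
    · have : e ^ 2 = (3 / 2) ^ 2 := by rw [hee]; norm_num
      rcases sq_eq_sq_iff_eq_or_eq_neg.1 this with rfl | rfl
      · exact Or.inl ⟨w + 2, w - 1, by push_cast; ring, by push_cast; ring⟩
      · exact Or.inl ⟨w - 1, w + 2, by push_cast; ring, by push_cast; ring⟩
    -- Now e² = 13/4, so |e| > 3/2 and the bounds force -1 < w < 0.
    · exfalso
      have h3 : 3 / 2 < |e| := by
        rw [← abs_of_pos (show (0 : ℝ) < 3 / 2 by norm_num), ← sq_lt_sq, hee]; norm_num
      have h1 : (w : ℝ) < 0 := by rcases lt_abs.1 h3 with h | h <;> linarith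
      have h2 : (-1 : ℝ) < w := by rcases lt_abs.1 h3 with h | h <;> linarith
      have h1' : w < 0 := by exact_mod_cast h1
      have h2' : -1 < w := by exact_mod_cast h2
      omega

namespace IsAdmissible

variable {S : Set (ℍ[ℝ] × ℍ[ℝ])} (h : IsAdmissible S)
include h

theorem abs_le₁ {x} (hx : x ∈ S) : |2 * x.1.re| ≤ 2 := by
  rw [abs_mul, abs_two]; linarith [abs_re_le (h.normSq₁ x hx)]

theorem abs_le₂ {x} (hx : x ∈ S) : |2 * x.2.re| ≤ 2 := by
  rw [abs_mul, abs_two]; linarith [abs_re_le (h.normSq₂ x hx)]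

theorem re_sq₁ {x} (hx : x ∈ S) : 2 * (x * x).1.re = (2 * x.1.re) ^ 2 - 2 := by
  rw [Prod.fst_mul, re_mul_self (h.normSq₁ x hx)]; ring

theorem re_sq₂ {x} (hx : x ∈ S) : 2 * (x * x).2.re = (2 * x.2.re) ^ 2 - 2 := by
  rw [Prod.snd_mul, re_mul_self (h.normSq₂ x hx)]; ring

theorem eq_one₁ {x} (hx : x ∈ S) (ht : 2 * x.1.re = 2) : x.1 = 1 :=
  eq_one_of_re (h.normSq₁ x hx) (by linarith)

theorem eq_one₂ {x} (hx : x ∈ S) (ht : 2 * x.2.re = 2) : x.2 = 1 :=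
  eq_one_of_re (h.normSq₂ x hx) (by linarith)

theorem eq_neg_one₁ {x} (hx : x ∈ S) (ht : 2 * x.1.re = -2) : x.1 = -1 :=
  eq_neg_one_of_re (h.normSq₁ x hx) (by linarith)

theorem swap : IsAdmissible {x | x.swap ∈ S} where
  one_mem := h.one_mem
  mul_mem x hx y hy := h.mul_mem _ hx _ hy
  star_mem x hx := h.star_mem _ hx
  neg_mem x hx := h.neg_mem _ hx
  normSq₁ x hx := h.normSq₂ _ hx
  normSq₂ x hx := h.normSq₁ _ hx
  add_int x hx := by simpa [add_comm] using h.add_int _ hx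
  mul_int x hx := by simpa [mul_comm] using h.mul_int _ hx
  int_of_eq x hx he := by
    obtain ⟨n, hn⟩ := h.int_of_eq _ hx he.symm
    exact ⟨n, by rw [he]; exact hn⟩
  not_sixth₁ x hx h1 h2 := h.not_sixth₂ _ hx h2 h1
  not_sixth₂ x hx h1 h2 := h.not_sixth₁ _ hx h2 h1
  not_dicyclic₁ hC x hx y hy := h.not_dicyclic₂ (by simpa using h.neg_mem _ hC) _ hx _ hy
  not_dicyclic₂ hC x hx y hy := h.not_dicyclic₁ (by simpa using h.neg_mem _ hC) _ hx _ hy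

theorem trace_cases {x} (hx : x ∈ S) :
    (∃ a b : ℤ, 2 * x.1.re = a ∧ 2 * x.2.re = b) ∨ ∃ ε : ℤ, (ε = 1 ∨ ε = -1) ∧
      ((2 * x.1.re = ε * √2 ∧ 2 * x.2.re = ε * -√2) ∨ (2 * x.1.re = ε * √3 ∧ 2 * x.2.re = ε * -√3) ∨
       (2 * x.1.re = ε * Real.goldenRatio ∧ 2 * x.2.re = ε * Real.goldenConj) ∨
       (2 * x.1.re = ε * Real.goldenConj ∧ 2 * x.2.re = ε * Real.goldenRatio)) := by
  obtain ⟨m, hm⟩ := h.add_int x hx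
  obtain ⟨n, hn⟩ := h.mul_int x hx
  exact conjugates_cases (h.abs_le₁ hx) (h.abs_le₂ hx) hm hn
    fun he => h.int_of_eq x hx (by linarith)

/-- Up to sign, the pairs (1, 2) and (2, 1) are excluded as sixth roots acting on one side. Any
other odd difference outside the listed exceptions becomes such a pair after squaring, by t ↦ t² -
2. -/
theorem even_sub_or {x} (hx : x ∈ S) {a b : ℤ} (ha : 2 * x.1.re = a) (hb : 2 * x.2.re = b) :
    2 ∣ a - b ∨ (a = 2 ∧ b = -1) ∨ (a = -2 ∧ b = 1) ∨ (a = -1 ∧ b = 2) ∨ (a = 1 ∧ b = -2) := by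
  have key₁ : ∀ x ∈ S, 2 * x.1.re = 1 → 2 * x.2.re = 2 → False := fun x hx h1 h2 =>
    h.not_sixth₁ x hx h1 (h.eq_one₂ hx h2)
  have key₂ : ∀ x ∈ S, 2 * x.1.re = 2 → 2 * x.2.re = 1 → False := fun x hx h1 h2 =>
    h.not_sixth₂ x hx (h.eq_one₁ hx h1) h2
  have key₁' : ∀ x ∈ S, 2 * x.1.re = -1 → 2 * x.2.re = -2 → False := fun x hx h1 h2 =>
    key₁ (-x) (h.neg_mem x hx) (by simp; linarith) (by simp; linarith)
  have key₂' : ∀ x ∈ S, 2 * x.1.re = -2 → 2 * x.2.re = -1 → False := fun x hx h1 h2 =>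
    key₂ (-x) (h.neg_mem x hx) (by simp; linarith) (by simp; linarith)
  have hxx := h.mul_mem x hx x hx
  have s1 := h.re_sq₁ hx
  have s2 := h.re_sq₂ hx
  have ha2 := abs_le.1 (ha ▸ h.abs_le₁ hx)
  have hb2 := abs_le.1 (hb ▸ h.abs_le₂ hx)
  have ha3 : -2 ≤ a := by exact_mod_cast ha2.1
  have ha4 : a ≤ 2 := by exact_mod_cast ha2.2
  have hb3 : -2 ≤ b := by exact_mod_cast hb2.1
  have hb4 : b ≤ 2 := by exact_mod_cast hb2.2
  rw [ha] at s1
  rw [hb] at s2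
  interval_cases a <;> interval_cases b <;> first
    | (left; decide)
    | (right; decide)
    | exact (key₁ x hx (by simpa using ha) (by simpa using hb)).elim
    | exact (key₂ x hx (by simpa using ha) (by simpa using hb)).elim
    | exact (key₁' x hx (by simpa using ha) (by simpa using hb)).elim
    | exact (key₂' x hx (by simpa using ha) (by simpa using hb)).elim
    | (refine (key₁' _ hxx ?_ ?_).elim <;> [rw [s1]; rw [s2]] <;> norm_num; done)
    | (refine (key₂' _ hxx ?_ ?_).elim <;> [rw [s1]; rw [s2]] <;> norm_num; done)

/-- Unequal traces of equal parity would yield (-1, 1) or its negative, from the element itself, its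
square, or its cube, where t ↦ t³ - 3t. -/
theorem eq_or (hC : ((-1, 1) : ℍ[ℝ] × ℍ[ℝ]) ∉ S) {x} (hx : x ∈ S) {a b : ℤ} (ha : 2 * x.1.re = a)
    (hb : 2 * x.2.re = b) :
    a = b ∨ (a = 2 ∧ b = -1) ∨ (a = -2 ∧ b = 1) ∨ (a = -1 ∧ b = 2) ∨ (a = 1 ∧ b = -2) := by
  have key : ∀ x ∈ S, 2 * x.1.re = -2 → 2 * x.2.re = 2 → False := fun x hx h1 h2 =>
    hC (by rw [← h.eq_neg_one₁ hx h1, ← h.eq_one₂ hx h2]; exact hx)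
  have key' : ∀ x ∈ S, 2 * x.1.re = 2 → 2 * x.2.re = -2 → False := fun x hx h1 h2 =>
    key (-x) (h.neg_mem x hx) (by simp; linarith) (by simp; linarith)
  have cube : ∀ y : ℍ[ℝ], normSq y = 1 → 2 * (y * (y * y)).re = (2 * y.re) ^ 3 - 3 * (2 * y.re) := by
    intro y hy
    rw [mul_self_eq hy, mul_sub, mul_smul_comm, mul_self_eq hy]
    simp
    ring
  have hxx := h.mul_mem x hx x hx
  have hx3 := h.mul_mem x hx _ hxx
  have s1 := h.re_sq₁ hx
  have s2 := h.re_sq₂ hx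
  have c1 : 2 * (x * (x * x)).1.re = _ := cube _ (h.normSq₁ x hx)
  have c2 : 2 * (x * (x * x)).2.re = _ := cube _ (h.normSq₂ x hx)
  rcases h.even_sub_or hx ha hb with hd | hd
  swap
  · exact Or.inr hd
  have ha2 := abs_le.1 (ha ▸ h.abs_le₁ hx)
  have hb2 := abs_le.1 (hb ▸ h.abs_le₂ hx)
  have ha3 : -2 ≤ a := by exact_mod_cast ha2.1
  have ha4 : a ≤ 2 := by exact_mod_cast ha2.2
  have hb3 : -2 ≤ b := by exact_mod_cast hb2.1
  have hb4 : b ≤ 2 := by exact_mod_cast hb2.2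
  rw [ha] at s1 c1
  rw [hb] at s2 c2
  interval_cases a <;> interval_cases b <;> first
    | (left; rfl)
    | (exfalso; omega)
    | exact (key x hx (by simpa using ha) (by simpa using hb)).elim
    | exact (key' x hx (by simpa using ha) (by simpa using hb)).elim
    | (refine (key _ hxx ?_ ?_).elim <;> [rw [s1]; rw [s2]] <;> norm_num; done)
    | (refine (key' _ hxx ?_ ?_).elim <;> [rw [s1]; rw [s2]] <;> norm_num; done)
    | (refine (key _ hx3 ?_ ?_).elim <;> [rw [c1]; rw [c2]] <;> norm_num; done)
    | (refine (key' _ hx3 ?_ ?_).elim <;> [rw [c1]; rw [c2]] <;> norm_num; done)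

/-- The identity tr(xy) + tr(xy*) = tr x tr y is summed over the two sides. -/
theorem mul_add_mul_int {x y} (hx : x ∈ S) (hy : y ∈ S) :
    ∃ n : ℤ, 2 * x.1.re * (2 * y.1.re) + 2 * x.2.re * (2 * y.2.re) = n := by
  obtain ⟨m, hm⟩ := h.add_int _ (h.mul_mem x hx y hy)
  obtain ⟨n, hn⟩ := h.add_int _ (h.mul_mem x hx _ (h.star_mem y hy))
  refine ⟨m + n, ?_⟩
  push_cast
  rw [← hm, ← hn]
  have h1 := re_mul_add_re_mul_star x.1 y.1
  have h2 := re_mul_add_re_mul_star x.2 y.2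
  simp only [Prod.fst_mul, Prod.snd_mul, Prod.fst_star, Prod.snd_star]
  linear_combination -2 * h1 - 2 * h2

end IsAdmissible

theorem IsE8Embeddable.of_swap {S : Set (ℍ[ℝ] × ℍ[ℝ])} (h : IsE8Embeddable {x | x.swap ∈ S}) :
    IsE8Embeddable S := by
  refine IsE8Embeddable.of_image (RingEquiv.prodComm : ℍ[ℝ] × ℍ[ℝ] ≃+* ℍ[ℝ] × ℍ[ℝ]).toRingHom
    (RingEquiv.injective _) (fun x => rfl) ?_
  obtain ⟨R, hR, hS⟩ := h
  refine ⟨R, hR, ?_⟩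
  rintro _ ⟨x, hx, rfl⟩
  exact hS _ (by simpa using hx)

end Admissible

/-! ### Coordinates in a frame and quadratic surds. -/

section Frames

open Quaternion

theorem IsFrame.parseval {X Y : ℍ[ℝ]} (h : IsFrame X Y) (x : ℍ[ℝ]) :
    x.re ^ 2 + (x * star X).re ^ 2 + (x * star Y).re ^ 2 + (x * star (X * Y)).re ^ 2 = normSq x := by
  obtain ⟨p, hp, hX, hY⟩ := h.exists_conj
  have hn : normSq (conjHom p hp x) = normSq x := by
    rw [conjHom_apply, map_mul, map_mul, normSq_star, hp]; ring
  rw [← conjHom_re p hp x, ← conjHom_re p hp (x * star X), ← conjHom_re p hp (x * star Y),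
    ← conjHom_re p hp (x * star (X * Y))]
  simp only [map_mul, conjHom_star, hX, hY]
  rw [← hn, normSq_def']
  simp

theorem IsFrame.re_eq_zero {X Y x : ℍ[ℝ]} (h : IsFrame X Y) (hx : normSq x = 1)
    (hs : (2 * x.re) ^ 2 + (2 * (x * star X).re) ^ 2 = 4) :
    (x * star Y).re = 0 ∧ (x * star (X * Y)).re = 0 := by
  have h1 := h.parseval x
  rw [hx] at h1
  constructor
  all_goals
    refine pow_eq_zero_iff two_ne_zero |>.1 (le_antisymm ?_ (sq_nonneg _))
    nlinarith [sq_nonneg (x * star Y).re, sq_nonneg (x * star (X * Y)).re]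

/-- If c projects to the plane of 1 and X with squared length 1/2, then cXc* is orthogonal to X.
This produces frames inside a group. -/
theorem re_mul_conj {X c : ℍ[ℝ]} (hX : normSq X = 1) (h0 : X.re = 0) (hc : normSq c = 1) :
    (X * (c * X * star c)).re = 1 - 2 * (c.re ^ 2 + (c * star X).re ^ 2) := by
  have h1 := re_mul_add_re_mul_star (X * c) (X * star c)
  have h2 : (X * c * star (X * star c)).re = (c * c).re := by
    rw [star_mul, star_star, mul_assoc, ← mul_assoc c, re_mul_comm, mul_assoc, star_mul_of_normSq hX,
      mul_one]
  have h3 : (X * c).re = -(c * star X).re := by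
    rw [star_eq_neg.2 h0, mul_neg, re_neg, neg_neg, re_mul_comm]
  have h4 : (X * star c).re = (c * star X).re := by
    rw [← re_star, star_mul, star_star]
  rw [h2, re_mul_self hc, h3, h4] at h1
  rw [show X * (c * X * star c) = X * c * (X * star c) by simp only [mul_assoc]]
  linarith

/-- The frames may differ on the two sides and need not come from S; only the traces of S against
them have to be conjugate and to satisfy the congruences of the model. -/
theorem IsE8Embeddable.of_frame {S : Set (ℍ[ℝ] × ℍ[ℝ])}
    {R : ℍ[ℝ] × ℍ[ℝ] →+* Matrix (Fin 8) (Fin 8) ℝ} (hR : IsOrthogonalModel R) {r r' : ℝ}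
    {X Y : ℍ[ℝ] × ℍ[ℝ]} (h₁ : IsFrame X.1 Y.1) (h₂ : IsFrame X.2 Y.2)
    (H : ∀ x ∈ S, ∃ p₀ p₁ p₂ p₃ q₀ q₁ q₂ q₃ : ℤ, HasTrace r r' p₀ q₀ x ∧
      HasTrace r r' p₁ q₁ (x * star X) ∧ HasTrace r r' p₂ q₂ (x * star Y) ∧
      HasTrace r r' p₃ q₃ (x * star (X * Y)) ∧
      ∀ z, HasCoeffs r r' p₀ p₁ p₂ p₃ q₀ q₁ q₂ q₃ z → R z ∈ e8Ring) : IsE8Embeddable S := by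
  obtain ⟨p, hp, hX₁, hY₁⟩ := h₁.exists_conj
  obtain ⟨q, hq, hX₂, hY₂⟩ := h₂.exists_conj
  refine IsE8Embeddable.of_conj hR hp hq fun x hx => ?_
  obtain ⟨p₀, p₁, p₂, p₃, q₀, q₁, q₂, q₃, t0, t1, t2, t3, hz⟩ := H x hx
  exact hz _ (hasCoeffs_conj hX₁ hX₂ hY₁ hY₂ t0 t1 t2 t3)

theorem Irrational.int_add_mul_inj {r : ℝ} (hr : Irrational r) {a b c d : ℤ}
    (h : (a : ℝ) + b * r = c + d * r) : a = c ∧ b = d := by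
  have hbd : b = d := by
    by_contra hne
    have h1 : ((b - d : ℤ) : ℝ) ≠ 0 := by exact_mod_cast sub_ne_zero.2 hne
    have h2 : r = ((c - a : ℤ) : ℝ) / ((b - d : ℤ) : ℝ) := by
      rw [eq_div_iff h1]; push_cast; linarith
    exact hr ⟨((c - a : ℤ) : ℚ) / ((b - d : ℤ) : ℚ), by rw [h2]; push_cast; rfl⟩
  subst hbd
  have : (a : ℝ) = c := by linarith
  exact ⟨by exact_mod_cast this, rfl⟩

theorem irrational_sqrt_three : Irrational √3 := by
  simpa using Nat.Prime.irrational_sqrt Nat.prime_three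

/-- The coefficients of `2`, `1`, `0`, `r` and their negatives. -/
def IsSurdCoeff (p q : ℤ) : Prop :=
  (q = 0 ∧ -2 ≤ p ∧ p ≤ 2) ∨ (p = 0 ∧ (q = 1 ∨ q = -1))

theorem HasTrace.zero_of_re {r r' : ℝ} {x : ℍ[ℝ] × ℍ[ℝ]} (h1 : x.1.re = 0) (h2 : x.2.re = 0) :
    HasTrace r r' 0 0 x := ⟨by simp [h1], by simp [h2]⟩

theorem HasTrace.re_eq_zero {r r' : ℝ} {x : ℍ[ℝ] × ℍ[ℝ]} (h : HasTrace r r' 0 0 x) :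
    x.1.re = 0 ∧ x.2.re = 0 := by
  obtain ⟨h1, h2⟩ := h
  constructor
  · simpa using h1
  · simpa using h2

/-- The norm equation in terms of the integral coefficients of a quadratic surd. -/
theorem sum_sq_of_hasTrace {d : ℤ} {r : ℝ} (hr : r ^ 2 = d) (hirr : Irrational r)
    {p₀ p₁ p₂ p₃ q₀ q₁ q₂ q₃ : ℤ} {X Y x : ℍ[ℝ] × ℍ[ℝ]} (hF : IsFrame X.1 Y.1) (hx : normSq x.1 = 1)
    (t0 : HasTrace r (-r) p₀ q₀ x) (t1 : HasTrace r (-r) p₁ q₁ (x * star X))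
    (t2 : HasTrace r (-r) p₂ q₂ (x * star Y)) (t3 : HasTrace r (-r) p₃ q₃ (x * star (X * Y))) :
    p₀ ^ 2 + p₁ ^ 2 + p₂ ^ 2 + p₃ ^ 2 + d * (q₀ ^ 2 + q₁ ^ 2 + q₂ ^ 2 + q₃ ^ 2) = 4 := by
  have h := hF.parseval x.1
  rw [hx] at h
  have e0 := t0.1
  have e1 := t1.1
  have e2 := t2.1
  have e3 := t3.1
  simp only [Prod.fst_mul, Prod.fst_star] at e1 e2 e3
  refine (hirr.int_add_mul_inj (b := 2 * (p₀ * q₀ + p₁ * q₁ + p₂ * q₂ + p₃ * q₃)) (d := 0) ?_).1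
  push_cast
  have h4 : (2 * x.1.re) ^ 2 + (2 * (x.1 * star X.1).re) ^ 2 + (2 * (x.1 * star Y.1).re) ^ 2 +
    (2 * (x.1 * star (X.1 * Y.1)).re) ^ 2 = 4 := by linarith
  rw [e0, e1, e2, e3] at h4
  rw [← hr]
  linarith

end Frames

/-! ### Groups with a trace √3 or √2. -/

namespace IsAdmissible

open Quaternion

variable {S : Set (ℍ[ℝ] × ℍ[ℝ])}

/-- The element a has order twelve and X = a³ is pure. Every element lies in the plane of 1 and X or
orthogonal to it, so the group is cyclic of order twelve or dicyclic. An orthogonal element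
completes the frame; if there is none, any completion works with zero coordinates. -/
theorem isE8Embeddable_of_sqrt_three (h : IsAdmissible S)
    (hT : ∀ y ∈ S, ∃ p q : ℤ, HasTrace √3 (-√3) p q y ∧ IsSurdCoeff p q)
    {a : ℍ[ℝ] × ℍ[ℝ]} (ha : a ∈ S) (hta : HasTrace √3 (-√3) 0 1 a) : IsE8Embeddable S := by
  have h3 : √3 ^ 2 = ((3 : ℤ) : ℝ) := by rw [Real.sq_sqrt] <;> norm_num
  have h3' : √3 * √3 = 3 := Real.mul_self_sqrt (by norm_num)
  obtain ⟨ha1, ha2⟩ := hta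
  obtain ⟨X, hXdef⟩ : ∃ X, X = a * (a * a) := ⟨_, rfl⟩
  have hXS : X ∈ S := hXdef ▸ h.mul_mem _ ha _ (h.mul_mem _ ha _ ha)
  have hX₁ : X.1 = (2 : ℝ) • a.1 - (√3 : ℝ) • 1 := by
    rw [hXdef, Prod.fst_mul, Prod.fst_mul, mul_self_eq (h.normSq₁ a ha), ha1, mul_sub, mul_smul_comm,
      mul_self_eq (h.normSq₁ a ha), ha1, smul_sub, smul_smul]
    simp only [Int.cast_zero, Int.cast_one, zero_add, one_mul, h3', mul_one]
    module
  have hX₂ : X.2 = (2 : ℝ) • a.2 + (√3 : ℝ) • 1 := by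
    rw [hXdef, Prod.snd_mul, Prod.snd_mul, mul_self_eq (h.normSq₂ a ha), ha2, mul_sub, mul_smul_comm,
      mul_self_eq (h.normSq₂ a ha), ha2, smul_sub, smul_smul]
    simp only [Int.cast_zero, Int.cast_one, zero_add, one_mul, neg_mul_neg, h3', mul_one]
    module
  have hX₁0 : X.1.re = 0 := by rw [hX₁]; simp at ha1 ⊢; linarith
  have hX₂0 : X.2.re = 0 := by rw [hX₂]; simp at ha2 ⊢; linarith
  -- On the first side 2a = √3 + X, so the traces of ya and ya* are half-integral combinations of
  -- those of y and yX*. Their admissibility gives the congruences, and a finite check leaves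
  -- projections to the plane that are zero or of length one on both sides.
  have key : ∀ y ∈ S, ∃ p₀ p₁ q₀ q₁ : ℤ, HasTrace √3 (-√3) p₀ q₀ y ∧
      HasTrace √3 (-√3) p₁ q₁ (y * star X) ∧ 2 ∣ p₀ - q₁ ∧ 2 ∣ p₁ - q₀ ∧
      ((p₀ = 0 ∧ p₁ = 0 ∧ q₀ = 0 ∧ q₁ = 0) ∨
        (p₀ ^ 2 + p₁ ^ 2 + 3 * (q₀ ^ 2 + q₁ ^ 2) = 4 ∧ p₀ * q₀ + p₁ * q₁ = 0)) := by
    intro y hy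
    obtain ⟨p₀, q₀, t0, c0⟩ := hT y hy
    obtain ⟨p₁, q₁, t1, c1⟩ := hT _ (h.mul_mem y hy _ (h.star_mem X hXS))
    obtain ⟨m, n, tm, cm⟩ := hT _ (h.mul_mem y hy _ ha)
    obtain ⟨m', n', tm', cm'⟩ := hT _ (h.mul_mem y hy _ (h.star_mem a ha))
    have e0 := t0.1
    have e1 := t1.1
    have em := tm.1
    have em' := tm'.1
    simp only [Prod.fst_mul, Prod.fst_star] at e1 em em'
    have f1 := re_mul_add_re_mul_star y.1 a.1
    have f2 : (y.1 * star X.1).re = 2 * (y.1 * star a.1).re - √3 * y.1.re := by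
      rw [hX₁, star_sub, mul_sub]; simp
    have f3 : 2 * (m + n * √3) = (p₁ + q₁ * √3) * -1 + √3 * (p₀ + q₀ * √3) := by
      simp only [Int.cast_zero, Int.cast_one, zero_add, one_mul] at ha1
      rw [← em, ← e0, ← e1]
      linear_combination 4 * f1 + 2 * f2 + 4 * y.1.re * ha1
    have f3' : 2 * (m' + n' * √3) = (p₁ + q₁ * √3) + √3 * (p₀ + q₀ * √3) := by
      rw [← em', ← e0, ← e1]
      linear_combination - 2 * f2
    have g := irrational_sqrt_three.int_add_mul_inj (a := 2 * m) (b := 2 * n) (c := -p₁ + 3 * q₀)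
      (d := -q₁ + p₀) (by push_cast; linear_combination f3 + q₀ * h3')
    have g' := irrational_sqrt_three.int_add_mul_inj (a := 2 * m') (b := 2 * n') (c := p₁ + 3 * q₀)
      (d := q₁ + p₀) (by push_cast; linear_combination f3' + q₀ * h3')
    refine ⟨p₀, p₁, q₀, q₁, t0, t1, by omega, by omega, ?_⟩
    simp only [IsSurdCoeff] at c0 c1 cm cm'
    obtain ⟨g1, g2⟩ := g
    obtain ⟨g1', g2'⟩ := g'
    have b0 : -2 ≤ p₀ := by omega
    have b1 : p₀ ≤ 2 := by omega
    have b2 : -2 ≤ p₁ := by omega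
    have b3 : p₁ ≤ 2 := by omega
    rcases c0 with ⟨rfl, -⟩ | ⟨rfl, rfl | rfl⟩ <;> rcases c1 with ⟨rfl, -⟩ | ⟨rfl, rfl | rfl⟩ <;>
      first
      | omega
      | (interval_cases p₀ <;> first | omega | (interval_cases p₁ <;> omega))
      | (interval_cases p₁ <;> omega)
  by_cases hc : ∃ c ∈ S, HasTrace √3 (-√3) 0 0 c ∧ HasTrace √3 (-√3) 0 0 (c * star X)
  · obtain ⟨Y, hYS, hY0, hY1⟩ := hc
    have hF₁ : IsFrame X.1 Y.1 := ⟨h.normSq₁ X hXS, h.normSq₁ Y hYS, hX₁0, hY0.re_eq_zero.1, by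
      have := hY1.re_eq_zero.1
      simp only [Prod.fst_mul, Prod.fst_star, star_eq_neg.2 hX₁0, mul_neg, re_neg, neg_eq_zero] at this
      rw [re_mul_comm, this]⟩
    have hF₂ : IsFrame X.2 Y.2 := ⟨h.normSq₂ X hXS, h.normSq₂ Y hYS, hX₂0, hY0.re_eq_zero.2, by
      have := hY1.re_eq_zero.2
      simp only [Prod.snd_mul, Prod.snd_star, star_eq_neg.2 hX₂0, mul_neg, re_neg, neg_eq_zero] at this
      rw [re_mul_comm, this]⟩
    refine IsE8Embeddable.of_frame (r := √3) (r' := -√3) PairData.dicyclic.isOrthogonalModel hF₁ hF₂ fun x hx => ?_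
    obtain ⟨p₀, p₁, q₀, q₁, t0, t1, d0, d1, -⟩ := key x hx
    obtain ⟨p₂, p₃, q₂, q₃, t2, t3, d2, d3, -⟩ := key _ (h.mul_mem x hx _ (h.star_mem Y hYS))
    rw [mul_assoc, ← star_mul] at t3
    exact ⟨p₀, p₁, p₂, p₃, q₀, q₁, q₂, q₃, t0, t1, t2, t3, fun z hz => dicyclic_mem hz d0 d1 d2 d3⟩
  · obtain ⟨Y₁, hF₁⟩ := exists_isFrame (h.normSq₁ X hXS) hX₁0
    obtain ⟨Y₂, hF₂⟩ := exists_isFrame (h.normSq₂ X hXS) hX₂0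
    refine IsE8Embeddable.of_frame (r := √3) (r' := -√3) (Y := (Y₁, Y₂)) PairData.dicyclic.isOrthogonalModel hF₁ hF₂
      fun x hx => ?_
    obtain ⟨p₀, p₁, q₀, q₁, t0, t1, d0, d1, ⟨rfl, rfl, rfl, rfl⟩ | ⟨hN, hN'⟩⟩ := key x hx
    · exact (hc ⟨x, hx, t0, t1⟩).elim
    have hN₁ : ((p₀ : ℝ) ^ 2 + p₁ ^ 2 + 3 * (q₀ ^ 2 + q₁ ^ 2) = 4) := by exact_mod_cast hN
    have hN₂ : ((p₀ : ℝ) * q₀ + p₁ * q₁ = 0) := by exact_mod_cast hN'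
    have e0 := t0.1
    have e1 := t1.1
    have e0' := t0.2
    have e1' := t1.2
    simp only [Prod.fst_mul, Prod.fst_star, Prod.snd_mul, Prod.snd_star] at e1 e1'
    have s1 : (2 * x.1.re) ^ 2 + (2 * (x.1 * star X.1).re) ^ 2 = 4 := by
      rw [e0, e1]
      linear_combination hN₁ + 2 * √3 * hN₂ + (q₀ ^ 2 + q₁ ^ 2) * h3'
    have s2 : (2 * x.2.re) ^ 2 + (2 * (x.2 * star X.2).re) ^ 2 = 4 := by
      rw [e0', e1']
      linear_combination hN₁ - 2 * √3 * hN₂ + (q₀ ^ 2 + q₁ ^ 2) * h3'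
    have o1 := hF₁.re_eq_zero (h.normSq₁ x hx) s1
    have o2 := hF₂.re_eq_zero (h.normSq₂ x hx) s2
    exact ⟨p₀, p₁, 0, 0, q₀, q₁, 0, 0, t0, t1, HasTrace.zero_of_re o1.1 o2.1,
      HasTrace.zero_of_re o1.2 o2.2, fun z hz => dicyclic_mem hz d0 d1 (by simp) (by simp)⟩

/-- The element a has order eight and X = a² is pure. If some c projects to the plane of 1 and X as
(±1 ± X)/2, then cXc* completes a frame, as in the binary octahedral group. Otherwise every element
lies in the plane or orthogonal to it, and the group is cyclic or generalized quaternion. -/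
theorem isE8Embeddable_of_sqrt_two (h : IsAdmissible S)
    (hT : ∀ y ∈ S, ∃ p q : ℤ, HasTrace √2 (-√2) p q y ∧ IsSurdCoeff p q)
    {a : ℍ[ℝ] × ℍ[ℝ]} (ha : a ∈ S) (hta : HasTrace √2 (-√2) 0 1 a) : IsE8Embeddable S := by
  have h2 : √2 ^ 2 = ((2 : ℤ) : ℝ) := by rw [Real.sq_sqrt] <;> norm_num
  have h2' : √2 * √2 = 2 := Real.mul_self_sqrt (by norm_num)
  obtain ⟨ha1, ha2⟩ := hta
  simp only [Int.cast_zero, Int.cast_one, zero_add, one_mul] at ha1 ha2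
  obtain ⟨X, hXdef⟩ : ∃ X, X = a * a := ⟨_, rfl⟩
  have hXS : X ∈ S := hXdef ▸ h.mul_mem _ ha _ ha
  have hX₁ : X.1 = √2 • a.1 - 1 := by
    rw [hXdef, Prod.fst_mul, mul_self_eq (h.normSq₁ a ha), ha1]
  have hX₂ : X.2 = -√2 • a.2 - 1 := by
    rw [hXdef, Prod.snd_mul, mul_self_eq (h.normSq₂ a ha), ha2]
  have hX₁0 : X.1.re = 0 := by
    rw [hX₁]; simp only [re_sub, re_smul, re_one, smul_eq_mul]; linear_combination √2 / 2 * ha1 + h2' / 2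
  have hX₂0 : X.2.re = 0 := by
    rw [hX₂]; simp only [re_sub, re_smul, re_one, smul_eq_mul]; linear_combination -√2 / 2 * ha2 + h2' / 2
  -- Comparison of the coefficients of 1 and √2 in yY* = √2 yc* - y.
  have half : ∀ y ∈ S, ∀ p₀ q₀ p₁ q₁ m n : ℤ, ∀ c Y : ℍ[ℝ] × ℍ[ℝ], Y.1 = √2 • c.1 - 1 →
      HasTrace √2 (-√2) p₀ q₀ y → HasTrace √2 (-√2) p₁ q₁ (y * star Y) →
      HasTrace √2 (-√2) m n (y * star c) → 2 * n = p₀ + p₁ ∧ m = q₀ + q₁ := by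
    intro y hy p₀ q₀ p₁ q₁ m n c Y hY t0 t1 tm
    have e0 := t0.1
    have e1 := t1.1
    have em := tm.1
    simp only [Prod.fst_mul, Prod.fst_star] at e1 em
    have f : (y.1 * star Y.1).re = √2 * (y.1 * star c.1).re - y.1.re := by
      rw [hY, star_sub, mul_sub]; simp
    have g := irrational_sqrt_two.int_add_mul_inj (a := 2 * n) (b := m) (c := p₀ + p₁)
      (d := q₀ + q₁) (by push_cast; linear_combination -√2 * em - 2 * f + e0 + e1 - n * h2')
    exact g
  have hXX : ∀ {y : ℍ[ℝ] × ℍ[ℝ]} {p q : ℤ}, HasTrace √2 (-√2) p q y →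
      HasTrace √2 (-√2) (-p) (-q) (y * star X * star X) := fun {y p q} t => by
    have e : ∀ z w : ℍ[ℝ], normSq w = 1 → w.re = 0 → z * star w * star w = -z := fun z w hw hw' => by
      rw [mul_assoc, ← star_mul, mul_self_of_pure hw hw']; simp
    obtain ⟨e1, e2⟩ := t
    constructor
    · simp only [Prod.fst_mul, Prod.fst_star, e _ _ (h.normSq₁ X hXS) hX₁0, re_neg]
      push_cast; linarith
    · simp only [Prod.snd_mul, Prod.snd_star, e _ _ (h.normSq₂ X hXS) hX₂0, re_neg]
      push_cast; linarith
  have key : ∀ y ∈ S, ∃ p₀ p₁ q₀ q₁ : ℤ, HasTrace √2 (-√2) p₀ q₀ y ∧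
      HasTrace √2 (-√2) p₁ q₁ (y * star X) ∧ 2 ∣ p₁ - p₀ ∧
      ((p₀ = 0 ∧ p₁ = 0 ∧ q₀ = 0 ∧ q₁ = 0) ∨
        (2 ∣ p₀ ∧ p₀ ^ 2 + p₁ ^ 2 + 2 * (q₀ ^ 2 + q₁ ^ 2) = 4 ∧ p₀ * q₀ + p₁ * q₁ = 0) ∨
        (p₀ ^ 2 = 1 ∧ p₁ ^ 2 = 1 ∧ q₀ = 0 ∧ q₁ = 0) ∨
        (p₀ = 0 ∧ p₁ = 0 ∧ q₀ ^ 2 + q₁ ^ 2 = 1 ∧ q₀ * q₁ = 0)) := by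
    intro y hy
    obtain ⟨p₀, q₀, t0, c0⟩ := hT y hy
    obtain ⟨p₁, q₁, t1, c1⟩ := hT _ (h.mul_mem y hy _ (h.star_mem X hXS))
    obtain ⟨m, n, tm, cm⟩ := hT _ (h.mul_mem y hy _ (h.star_mem a ha))
    obtain ⟨g1, g2⟩ := half y hy _ _ _ _ _ _ a X hX₁ t0 t1 tm
    have hyX := h.mul_mem y hy _ (h.star_mem X hXS)
    obtain ⟨m', n', tm', cm'⟩ := hT _ (h.mul_mem _ hyX _ (h.star_mem a ha))
    obtain ⟨g1', g2'⟩ := half _ hyX _ _ _ _ _ _ a X hX₁ t1 (hXX t0) tm'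
    refine ⟨p₀, p₁, q₀, q₁, t0, t1, by omega, ?_⟩
    simp only [IsSurdCoeff] at c0 c1 cm cm'
    have b0 : -2 ≤ p₀ := by omega
    have b1 : p₀ ≤ 2 := by omega
    have b2 : -2 ≤ p₁ := by omega
    have b3 : p₁ ≤ 2 := by omega
    rcases c0 with ⟨rfl, -⟩ | ⟨rfl, rfl | rfl⟩ <;> rcases c1 with ⟨rfl, -⟩ | ⟨rfl, rfl | rfl⟩ <;>
      first
      | omega
      | decide
      | (interval_cases p₀ <;> first | omega | (interval_cases p₁ <;> omega))
  have key' : ∀ Y ∈ S, IsFrame X.1 Y.1 → ∀ x ∈ S, ∃ p₀ p₁ p₂ p₃ q₀ q₁ q₂ q₃ : ℤ,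
      HasTrace √2 (-√2) p₀ q₀ x ∧ HasTrace √2 (-√2) p₁ q₁ (x * star X) ∧
      HasTrace √2 (-√2) p₂ q₂ (x * star Y) ∧ HasTrace √2 (-√2) p₃ q₃ (x * star (X * Y)) ∧
      2 ∣ p₁ - p₀ ∧ 2 ∣ p₃ - p₂ ∧
      p₀ ^ 2 + p₁ ^ 2 + p₂ ^ 2 + p₃ ^ 2 + 2 * (q₀ ^ 2 + q₁ ^ 2 + q₂ ^ 2 + q₃ ^ 2) = 4 := by
    intro Y hYS hF x hx
    obtain ⟨p₀, p₁, q₀, q₁, t0, t1, d, -⟩ := key x hx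
    obtain ⟨p₂, p₃, q₂, q₃, t2, t3, d', -⟩ := key _ (h.mul_mem x hx _ (h.star_mem Y hYS))
    rw [mul_assoc, ← star_mul] at t3
    exact ⟨p₀, p₁, p₂, p₃, q₀, q₁, q₂, q₃, t0, t1, t2, t3, d, d',
      sum_sq_of_hasTrace h2 irrational_sqrt_two hF (h.normSq₁ x hx) t0 t1 t2 t3⟩
  -- Four integers of equal parity have square sum divisible by 4, so the norm equation makes ∑ q²
  -- even, and ∑ q has the same parity.
  have even : ∀ p₀ p₁ p₂ p₃ q₀ q₁ q₂ q₃ : ℤ, 2 ∣ p₁ - p₀ → 2 ∣ p₂ - p₀ → 2 ∣ p₃ - p₂ →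
      p₀ ^ 2 + p₁ ^ 2 + p₂ ^ 2 + p₃ ^ 2 + 2 * (q₀ ^ 2 + q₁ ^ 2 + q₂ ^ 2 + q₃ ^ 2) = 4 →
      2 ∣ q₀ + q₁ + q₂ + q₃ := by
    intro p₀ p₁ p₂ p₃ q₀ q₁ q₂ q₃ h1 h2 h3 hN
    obtain ⟨u, hu⟩ := h1
    obtain ⟨v, hv⟩ := h2
    obtain ⟨w, hw⟩ := h3
    obtain rfl : p₁ = p₀ + 2 * u := by omega
    obtain rfl : p₂ = p₀ + 2 * v := by omega
    obtain rfl : p₃ = p₀ + 2 * v + 2 * w := by omega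
    have e : q₀ ^ 2 + q₁ ^ 2 + q₂ ^ 2 + q₃ ^ 2 = 2 * (1 - p₀ ^ 2 - p₀ * u - p₀ * v - u ^ 2 - v ^ 2 -
        p₀ * (v + w) - (v + w) ^ 2) + 0 := by linarith
    have e' : 2 ∣ q₀ ^ 2 + q₁ ^ 2 + q₂ ^ 2 + q₃ ^ 2 := ⟨_, by rw [e, add_zero]⟩
    simpa [← even_iff_two_dvd, Int.even_add, Int.even_pow] using e'
  by_cases hc : ∃ c ∈ S, ∃ p₀ p₁ : ℤ, p₀ ^ 2 = 1 ∧ p₁ ^ 2 = 1 ∧ HasTrace √2 (-√2) p₀ 0 c ∧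
      HasTrace √2 (-√2) p₁ 0 (c * star X)
  · obtain ⟨c, hcS, p₀, p₁, hp₀, hp₁, t0, t1⟩ := hc
    have hp₀' : (p₀ : ℝ) ^ 2 = 1 := by exact_mod_cast hp₀
    have hp₁' : (p₁ : ℝ) ^ 2 = 1 := by exact_mod_cast hp₁
    have hYS : c * X * star c ∈ S := h.mul_mem _ (h.mul_mem _ hcS _ hXS) _ (h.star_mem _ hcS)
    have hbS : c * a * star c ∈ S := h.mul_mem _ (h.mul_mem _ hcS _ ha) _ (h.star_mem _ hcS)
    have e0 := t0.1
    have e1 := t1.1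
    have e0' := t0.2
    have e1' := t1.2
    simp only [Prod.fst_mul, Prod.fst_star, Prod.snd_mul, Prod.snd_star, Int.cast_zero, zero_mul,
      add_zero] at e0 e1 e0' e1'
    have hF₁ : IsFrame X.1 (c * X * star c).1 := ⟨h.normSq₁ X hXS, h.normSq₁ _ hYS, hX₁0, by
      refine Eq.trans ?_ hX₁0; exact conjHom_re c.1 (h.normSq₁ c hcS) X.1, by
      refine (re_mul_conj (h.normSq₁ X hXS) hX₁0 (h.normSq₁ c hcS)).trans ?_
      linear_combination -(2 * c.1.re + p₀) / 2 * e0 - hp₀' / 2 - hp₁' / 2 -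
        (2 * (c.1 * star X.1).re + p₁) / 2 * e1⟩
    have hF₂ : IsFrame X.2 (c * X * star c).2 := ⟨h.normSq₂ X hXS, h.normSq₂ _ hYS, hX₂0, by
      refine Eq.trans ?_ hX₂0; exact conjHom_re c.2 (h.normSq₂ c hcS) X.2, by
      refine (re_mul_conj (h.normSq₂ X hXS) hX₂0 (h.normSq₂ c hcS)).trans ?_
      linear_combination -(2 * c.2.re + p₀) / 2 * e0' - hp₀' / 2 - hp₁' / 2 -
        (2 * (c.2 * star X.2).re + p₁) / 2 * e1'⟩
    refine IsE8Embeddable.of_frame (r := √2) (r' := -√2) PairData.octahedral.isOrthogonalModel hF₁ hF₂ fun x hx => ?_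
    obtain ⟨p₀, p₁, p₂, p₃, q₀, q₁, q₂, q₃, t0, t1, t2, t3, d, d', hN⟩ := key' _ hYS hF₁ x hx
    -- cac* is related to cXc* as a is to X, so `half` applies and gives the missing congruence
    -- between p₂ and p₀.
    obtain ⟨m, n, tm, cm⟩ := hT _ (h.mul_mem x hx _ (h.star_mem _ hbS))
    have hg := (half x hx _ _ _ _ _ _ (c * a * star c) (c * X * star c) (by
      simp only [Prod.fst_mul, Prod.fst_star, hX₁, mul_sub, sub_mul, mul_one,
        mul_star_of_normSq (h.normSq₁ c hcS), mul_smul_comm, smul_mul_assoc]) t0 t2 tm).1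
    exact ⟨p₀, p₁, p₂, p₃, q₀, q₁, q₂, q₃, t0, t1, t2, t3, fun z hz => octahedral_mem hz d (by omega)
      (by omega) (even _ _ _ _ _ _ _ _ d (by omega) d' hN)⟩
  have key₂ : ∀ y ∈ S, ∃ p₀ p₁ q₀ q₁ : ℤ, HasTrace √2 (-√2) p₀ q₀ y ∧
      HasTrace √2 (-√2) p₁ q₁ (y * star X) ∧ 2 ∣ p₁ - p₀ ∧
      ((p₀ = 0 ∧ p₁ = 0 ∧ q₀ = 0 ∧ q₁ = 0) ∨
        (2 ∣ p₀ ∧ p₀ ^ 2 + p₁ ^ 2 + 2 * (q₀ ^ 2 + q₁ ^ 2) = 4 ∧ p₀ * q₀ + p₁ * q₁ = 0)) := by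
    intro y hy
    obtain ⟨p₀, p₁, q₀, q₁, t0, t1, d, H | H | ⟨h1, h2, rfl, rfl⟩ | ⟨rfl, rfl, hq, hq'⟩⟩ := key y hy
    · exact ⟨p₀, p₁, q₀, q₁, t0, t1, d, Or.inl H⟩
    · exact ⟨p₀, p₁, q₀, q₁, t0, t1, d, Or.inr H⟩
    · exact (hc ⟨y, hy, p₀, p₁, h1, h2, t0, t1⟩).elim
    -- A projection of squared length 1/2 along 1 or X is turned by a* into (±1 ± X)/2, which has
    -- just been excluded.
    · have hy' := h.mul_mem y hy _ (h.star_mem a ha)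
      obtain ⟨m₀, m₁, n₀, n₁, s0, s1, -, hs⟩ := key _ hy'
      obtain ⟨g1, g2⟩ := half y hy _ _ _ _ _ _ a X hX₁ t0 t1 s0
      have s1' := s1
      rw [mul_assoc, ← star_mul, (show X * a = a * X by rw [hXdef, mul_assoc]), star_mul,
        ← mul_assoc] at s1
      obtain ⟨g3, g4⟩ := half _ (h.mul_mem y hy _ (h.star_mem X hXS)) _ _ _ _ _ _ a X hX₁ t1 (hXX t0) s1
      obtain rfl : n₀ = 0 := by omega
      obtain rfl : n₁ = 0 := by omega
      exact (hc ⟨_, hy', m₀, m₁, by rw [g2]; linarith, by rw [g4]; linarith, s0, s1'⟩).elim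
  by_cases hc : ∃ c ∈ S, HasTrace √2 (-√2) 0 0 c ∧ HasTrace √2 (-√2) 0 0 (c * star X)
  · obtain ⟨Y, hYS, hY0, hY1⟩ := hc
    have hF₁ : IsFrame X.1 Y.1 := ⟨h.normSq₁ X hXS, h.normSq₁ Y hYS, hX₁0, hY0.re_eq_zero.1, by
      have := hY1.re_eq_zero.1
      simp only [Prod.fst_mul, Prod.fst_star, star_eq_neg.2 hX₁0, mul_neg, re_neg, neg_eq_zero] at this
      rw [re_mul_comm, this]⟩
    have hF₂ : IsFrame X.2 Y.2 := ⟨h.normSq₂ X hXS, h.normSq₂ Y hYS, hX₂0, hY0.re_eq_zero.2, by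
      have := hY1.re_eq_zero.2
      simp only [Prod.snd_mul, Prod.snd_star, star_eq_neg.2 hX₂0, mul_neg, re_neg, neg_eq_zero] at this
      rw [re_mul_comm, this]⟩
    refine IsE8Embeddable.of_frame (r := √2) (r' := -√2) PairData.octahedral.isOrthogonalModel hF₁ hF₂
      fun x hx => ?_
    obtain ⟨p₀, p₁, q₀, q₁, t0, t1, d, H⟩ := key₂ x hx
    obtain ⟨p₂, p₃, q₂, q₃, t2, t3, d', H'⟩ := key₂ _ (h.mul_mem x hx _ (h.star_mem Y hYS))
    rw [mul_assoc, ← star_mul] at t3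
    have hN := sum_sq_of_hasTrace h2 irrational_sqrt_two hF₁ (h.normSq₁ x hx) t0 t1 t2 t3
    have e0 : 2 ∣ p₀ := by omega
    have e2 : 2 ∣ p₂ := by omega
    exact ⟨p₀, p₁, p₂, p₃, q₀, q₁, q₂, q₃, t0, t1, t2, t3, fun z hz => octahedral_mem hz d
      (by omega) (by omega) (even _ _ _ _ _ _ _ _ d (by omega) d' hN)⟩
  · obtain ⟨Y₁, hF₁⟩ := exists_isFrame (h.normSq₁ X hXS) hX₁0
    obtain ⟨Y₂, hF₂⟩ := exists_isFrame (h.normSq₂ X hXS) hX₂0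
    refine IsE8Embeddable.of_frame (r := √2) (r' := -√2) (Y := (Y₁, Y₂))
      PairData.octahedral.isOrthogonalModel hF₁ hF₂ fun x hx => ?_
    obtain ⟨p₀, p₁, q₀, q₁, t0, t1, d, ⟨rfl, rfl, rfl, rfl⟩ | ⟨he, hN, hN'⟩⟩ := key₂ x hx
    · exact (hc ⟨x, hx, t0, t1⟩).elim
    have hN₁ : ((p₀ : ℝ) ^ 2 + p₁ ^ 2 + 2 * (q₀ ^ 2 + q₁ ^ 2) = 4) := by exact_mod_cast hN
    have hN₂ : ((p₀ : ℝ) * q₀ + p₁ * q₁ = 0) := by exact_mod_cast hN'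
    have e0 := t0.1
    have e1 := t1.1
    have e0' := t0.2
    have e1' := t1.2
    simp only [Prod.fst_mul, Prod.fst_star, Prod.snd_mul, Prod.snd_star] at e1 e1'
    have s1 : (2 * x.1.re) ^ 2 + (2 * (x.1 * star X.1).re) ^ 2 = 4 := by
      rw [e0, e1]
      linear_combination hN₁ + 2 * √2 * hN₂ + (q₀ ^ 2 + q₁ ^ 2) * h2'
    have s2 : (2 * x.2.re) ^ 2 + (2 * (x.2 * star X.2).re) ^ 2 = 4 := by
      rw [e0', e1']
      linear_combination hN₁ - 2 * √2 * hN₂ + (q₀ ^ 2 + q₁ ^ 2) * h2'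
    have o1 := hF₁.re_eq_zero (h.normSq₁ x hx) s1
    have o2 := hF₂.re_eq_zero (h.normSq₂ x hx) s2
    exact ⟨p₀, p₁, 0, 0, q₀, q₁, 0, 0, t0, t1, HasTrace.zero_of_re o1.1 o2.1,
      HasTrace.zero_of_re o1.2 o2.2, fun z hz => octahedral_mem hz d (by omega) (by omega)
        (even p₀ p₁ 0 0 q₀ q₁ 0 0 d (by omega) (by omega) (by linarith))⟩

end IsAdmissible

/-! ### Frames from the golden ratio. -/

section Golden

open Quaternion

/-- Solves 2a = r + (r - 1) X + Y for Y. Only r² = r + 1 is assumed, so the golden ratio and its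
conjugate are treated together. -/
theorem isFrame_golden₁ {r : ℝ} (hr : r ^ 2 = r + 1) {a X : ℍ[ℝ]} (ha : normSq a = 1)
    (hX : normSq X = 1) (ha0 : 2 * a.re = r) (hX0 : X.re = 0) (hXa : 2 * (X * a).re = 1 - r) :
    IsFrame X ((2 : ℝ) • a - r • 1 - (r - 1) • X) := by
  refine ⟨hX, ?_, hX0, ?_, ?_⟩
  · rw [normSq_def'] at ha hX ⊢
    rw [re_mul, hX0] at hXa
    rw [hX0] at hX
    simp only [re_sub, imI_sub, imJ_sub, imK_sub, re_smul, imI_smul, imJ_smul, imK_smul, re_one,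
      imI_one, imJ_one, imK_one, smul_eq_mul, hX0]
    linear_combination 4 * ha + (r - 1) ^ 2 * hX + 2 * (r - 1) * hXa - 2 * r * ha0 - 2 * hr
  · simp [hX0]; linarith
  · rw [mul_sub, mul_sub, mul_smul_comm, mul_smul_comm, mul_smul_comm, mul_one,
      mul_self_of_pure hX hX0]
    simp only [re_sub, re_smul, re_neg, re_one, smul_eq_mul, hX0]
    linarith

/-- The same relation solved for X, with r = 1/(r - 1). -/
theorem isFrame_golden₂ {r : ℝ} (hr : r ^ 2 = r + 1) {a Y : ℍ[ℝ]} (ha : normSq a = 1)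
    (hY : normSq Y = 1) (ha0 : 2 * a.re = r) (hY0 : Y.re = 0) (hYa : 2 * (Y * a).re = -1) :
    IsFrame (r • ((2 : ℝ) • a - r • 1 - Y)) Y := by
  refine ⟨?_, hY, ?_, hY0, ?_⟩
  · rw [normSq_def'] at ha hY
    rw [re_mul, hY0] at hYa
    rw [hY0] at hY
    rw [normSq_smul, normSq_def']
    simp only [re_sub, imI_sub, imJ_sub, imK_sub, re_smul, imI_smul, imJ_smul, imK_smul, re_one,
      imI_one, imJ_one, imK_one, smul_eq_mul, hY0]
    linear_combination r ^ 2 * (4 * ha + hY + 2 * hYa - 2 * r * ha0) + (1 - r ^ 2 - r) * hr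
  · simp [hY0]; right; linarith
  · rw [smul_mul_assoc, sub_mul, sub_mul, smul_mul_assoc, smul_mul_assoc, one_mul,
      mul_self_of_pure hY hY0]
    rw [re_mul_comm] at hYa
    simp only [re_sub, re_smul, re_neg, re_one, smul_eq_mul, hY0]
    linear_combination r * hYa

/-- The vector n = 2a - r is orthogonal to d and has square length 3 - r = (r - 1)² + 1. Hence the
plane orthogonal to 1 and d contains an orthonormal pair with n = (r - 1) X + Y and XY = d; the
factor (2 + r)/5 is 1/(3 - r). -/
theorem isFrame_golden₃ {r : ℝ} (hr : r ^ 2 = r + 1) {a d : ℍ[ℝ]} (ha : normSq a = 1)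
    (hd : normSq d = 1) (ha0 : 2 * a.re = r) (hd0 : d.re = 0) (hda : (d * a).re = 0) :
    ∃ X Y : ℍ[ℝ], IsFrame X Y ∧ X * Y = d ∧ (2 : ℝ) • a - r • 1 = (r - 1) • X + Y ∧
      (5 : ℝ) • Y = (2 + r) • ((2 : ℝ) • a - r • 1 - (r - 1) • ((2 : ℝ) • a - r • 1) * d) ∧
      (5 : ℝ) • X = (2 + r) • ((r - 1) • ((2 : ℝ) • a - r • 1) + ((2 : ℝ) • a - r • 1) * d) := by
  obtain ⟨n, hn⟩ : ∃ n, n = (2 : ℝ) • a - r • 1 := ⟨_, rfl⟩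
  have hn0 : n.re = 0 := by rw [hn]; simp; linarith
  have hnn : n * n = (r - 3) • 1 := by
    rw [hn]
    have h1 := mul_self_eq ha
    rw [ha0] at h1
    simp only [sub_mul, mul_sub, smul_mul_assoc, mul_smul_comm, one_mul, mul_one, smul_sub, smul_smul,
      h1]
    rw [show r - 3 = r ^ 2 - 4 by linarith]
    module
  have hdn0 : (d * n).re = 0 := by
    rw [hn, mul_sub, mul_smul_comm, mul_smul_comm, mul_one]; simp [hd0, hda]
  have hdn : d * n = -(n * d) := by
    have h1 : star (n * d) = d * n := by
      rw [star_mul, star_eq_neg.2 hn0, star_eq_neg.2 hd0, neg_mul_neg]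
    have h2 : star (n * d) = -(n * d) := star_eq_neg.2 (by rw [re_mul_comm, hdn0])
    rw [← h1, h2]
  have hdd := mul_self_of_pure hd hd0
  have h5 : (2 + r) * (3 - r) = 5 := by linarith
  have e1 : n * (n * d) = (r - 3) • d := by rw [← mul_assoc, hnn]; simp
  have e2 : n * d * n = (3 - r) • d := by rw [mul_assoc, hdn, mul_neg, e1, ← neg_smul, neg_sub]
  have e3 : n * d * (n * d) = (r - 3) • 1 := by
    rw [← mul_assoc, e2, smul_mul_assoc, hdd, smul_neg, ← neg_smul, neg_sub]
  have hnd0 : (n * d).re = 0 := by rw [re_mul_comm, hdn0]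
  have hX0 : (((2 + r) / 5) • ((r - 1) • n + n * d)).re = 0 := by simp [hn0, hnd0]
  have hY0 : (((2 + r) / 5) • (n - (r - 1) • (n * d))).re = 0 := by simp [hn0, hnd0]
  have hXY : ((2 + r) / 5) • ((r - 1) • n + n * d) * ((2 + r) / 5) • (n - (r - 1) • (n * d)) = d := by
    simp only [smul_mul_assoc, mul_smul_comm, add_mul, mul_sub, hnn, e1, e2, e3, smul_smul, smul_sub,
      smul_add]
    have : (2 + r) ^ 2 * (3 - r) ^ 2 = 25 := by rw [← mul_pow, h5]; norm_num
    have h6 : (2 + r) / 5 * ((2 + r) / 5) * ((3 - r) + (r - 1) * (r - 1) * (3 - r)) = 1 := by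
      rw [show (3 - r) + (r - 1) * (r - 1) * (3 - r) = (3 - r) ^ 2 by linear_combination (3 - r) * hr]
      linear_combination this / 25
    refine Eq.trans ?_ (h6 ▸ one_smul ℝ d)
    module
  have hsq : ∀ z : ℍ[ℝ], z.re = 0 → z * z = -1 → normSq z = 1 := fun z h1 h2 => by
    have h3 := self_mul_star z
    rw [star_eq_neg.2 h1, mul_neg, h2, neg_neg] at h3
    simpa using (congrArg QuaternionAlgebra.re h3).symm
  have hc : (2 + r) / 5 * ((2 + r) / 5) * (-(3 - r) - (r - 1) * (r - 1) * (3 - r)) = -1 := by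
    have : (2 + r) ^ 2 * (3 - r) ^ 2 = 25 := by rw [← mul_pow, h5]; norm_num
    rw [show -(3 - r) - (r - 1) * (r - 1) * (3 - r) = -(3 - r) ^ 2 by
      linear_combination -(3 - r) * hr]
    linear_combination -this / 25
  refine ⟨((2 + r) / 5) • ((r - 1) • n + n * d), ((2 + r) / 5) • (n - (r - 1) • (n * d)),
    ⟨hsq _ hX0 ?_, hsq _ hY0 ?_, hX0, hY0, by rw [hXY, hd0]⟩, hXY, ?_, ?_, ?_⟩
  · simp only [smul_mul_assoc, mul_smul_comm, add_mul, mul_add, hnn, e1, e2, e3, smul_smul,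
      smul_add]
    rw [← one_smul ℝ (-1 : ℍ[ℝ]), smul_neg, ← neg_smul, ← hc]
    module
  · simp only [smul_mul_assoc, mul_smul_comm, sub_mul, mul_sub, hnn, e1, e2, e3, smul_smul,
      smul_sub]
    rw [← one_smul ℝ (-1 : ℍ[ℝ]), smul_neg, ← neg_smul, ← hc]
    module
  · rw [← hn]
    have h6 : (2 + r) / 5 * ((r - 1) * (r - 1) + 1) = 1 := by
      linear_combination (r + 1) / 5 * hr + 0 * h5
    refine (h6 ▸ one_smul ℝ n).symm.trans ?_
    module
  · rw [← hn, smul_smul, smul_mul_assoc]; congr 1; ring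
  · rw [← hn, smul_smul]; congr 1; ring

/-- The coefficients of `2`, `1`, `0`, the golden ratio, its conjugate and their negatives. -/
def goldenCoeffs : List (ℤ × ℤ) :=
  [(0, 0), (1, 0), (-1, 0), (2, 0), (-2, 0), (0, 1), (0, -1), (1, -1), (-1, 1)]

/-- The recurrence satisfied by the coefficients of the traces of `y * a ^ k`. -/
def goldenSeq (u v : ℤ × ℤ) : ℕ → ℤ × ℤ
  | 0 => u
  | 1 => v
  | k + 2 => ((goldenSeq u v (k + 1)).2 - (goldenSeq u v k).1,
      (goldenSeq u v (k + 1)).1 + (goldenSeq u v (k + 1)).2 - (goldenSeq u v k).2)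

/-- The sequence lists the traces of y aᵏ. A finite check shows that, unless it vanishes, admissible
traces force some y aᵏ to be ±1 or to be a pure element suitable for one of the two golden frames.
-/
theorem goldenSeq_cases {u v : ℤ × ℤ} (h : ∀ k, goldenSeq u v k ∈ goldenCoeffs) :
    (u = (0, 0) ∧ v = (0, 0)) ∨ ∃ k, goldenSeq u v k = (2, 0) ∨ goldenSeq u v k = (-2, 0) ∨
      (goldenSeq u v k = (0, 0) ∧ goldenSeq u v (k + 1) ∈ [((1 : ℤ), (0 : ℤ)), (-1, 0), (1, -1), (-1, 1)]) := by
  have key : ∀ u ∈ goldenCoeffs, ∀ v ∈ goldenCoeffs, (∀ k < 7, goldenSeq u v k ∈ goldenCoeffs) →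
    (u = (0, 0) ∧ v = (0, 0)) ∨ ∃ k < 5, goldenSeq u v k = (2, 0) ∨ goldenSeq u v k = (-2, 0) ∨
      (goldenSeq u v k = (0, 0) ∧ goldenSeq u v (k + 1) ∈ [((1 : ℤ), (0 : ℤ)), (-1, 0), (1, -1), (-1, 1)]) := by
    decide +kernel
  rcases key u (h 0) v (h 1) fun k _ => h k with H | ⟨k, -, H⟩
  · exact Or.inl H
  · exact Or.inr ⟨k, H⟩

theorem golden_coord₁ {r : ℝ} (hr : r ^ 2 = r + 1) {x a X : ℍ[ℝ]} {p₀ q₀ p₁ q₁ m n : ℤ}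
    (h0 : 2 * x.re = p₀ + q₀ * r) (h1 : 2 * (x * star X).re = p₁ + q₁ * r)
    (hm : 2 * (x * star a).re = m + n * r) :
    2 * (x * star ((2 : ℝ) • a - r • 1 - (r - 1) • X)).re =
      (2 * m - q₀ - (q₁ - p₁) : ℤ) + (2 * n - (p₀ + q₀) - p₁ : ℤ) * r := by
  simp only [star_sub, Quaternion.star_smul, star_one, mul_sub, mul_smul_comm, mul_one, re_sub, re_smul,
    smul_eq_mul]
  push_cast
  linear_combination 2 * hm - r * h0 - (r - 1) * h1 - (q₀ + q₁) * hr

theorem golden_coord₁' {r : ℝ} (hr : r ^ 2 = r + 1) {x a X : ℍ[ℝ]} (hX : normSq X = 1)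
    (hX0 : X.re = 0) {p₀ q₀ p₁ q₁ m n : ℤ}
    (h0 : 2 * x.re = p₀ + q₀ * r) (h1 : 2 * (x * star X).re = p₁ + q₁ * r)
    (hm : 2 * (x * star (X * a)).re = m + n * r) :
    2 * (x * star (X * ((2 : ℝ) • a - r • 1 - (r - 1) • X))).re =
      (2 * m - q₁ + (q₀ - p₀) : ℤ) + (2 * n - (p₁ + q₁) + p₀ : ℤ) * r := by
  simp only [mul_sub X, mul_smul_comm, mul_one, mul_self_of_pure hX hX0]
  simp only [star_sub, Quaternion.star_smul, star_one, smul_neg, sub_neg_eq_add, star_add,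
    mul_sub, mul_add, mul_smul_comm, mul_one, re_sub, re_add, re_smul, smul_eq_mul]
  push_cast
  linear_combination 2 * hm - r * h1 + (r - 1) * h0 - (q₁ - q₀) * hr

theorem golden_coord₂ {r : ℝ} (hr : r ^ 2 = r + 1) {x a Y : ℍ[ℝ]} {p₀ q₀ p₂ q₂ m n : ℤ}
    (h0 : 2 * x.re = p₀ + q₀ * r) (h2 : 2 * (x * star Y).re = p₂ + q₂ * r)
    (hm : 2 * (x * star a).re = m + n * r) :
    2 * (x * star (r • ((2 : ℝ) • a - r • 1 - Y))).re =
      (2 * n - p₀ - q₀ - q₂ : ℤ) + (2 * m - q₀ - p₂ + (2 * n - p₀ - q₀ - q₂) : ℤ) * r := by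
  simp only [star_sub, Quaternion.star_smul, star_one, mul_sub, mul_smul_comm, mul_one, re_sub, re_smul,
    smul_eq_mul]
  push_cast
  linear_combination 2 * r * hm - r * r * h0 - r * h2 + (2 * n - p₀ - q₂ - q₀ * r - q₀) * hr

theorem golden_coord₂' {r : ℝ} (hr : r ^ 2 = r + 1) {x a Y : ℍ[ℝ]} (hY : normSq Y = 1)
    (hY0 : Y.re = 0) {p₀ q₀ p₂ q₂ m n : ℤ}
    (h0 : 2 * x.re = p₀ + q₀ * r) (h2 : 2 * (x * star Y).re = p₂ + q₂ * r)
    (hm : 2 * (x * star (a * Y)).re = m + n * r) :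
    2 * (x * star (r • ((2 : ℝ) • a - r • 1 - Y) * Y)).re =
      (2 * n - (p₂ + q₂) + q₀ : ℤ) + (2 * m - q₂ + p₀ + (2 * n - (p₂ + q₂) + q₀) : ℤ) * r := by
  simp only [smul_mul_assoc, sub_mul _ _ Y, one_mul, mul_self_of_pure hY hY0]
  simp only [star_sub, Quaternion.star_smul, star_one, sub_neg_eq_add, star_add,
    mul_sub, mul_add, mul_smul_comm, mul_one, re_sub, re_add, re_smul, smul_eq_mul]
  push_cast
  linear_combination 2 * r * hm - r * r * h2 + r * h0 + (2 * n - p₂ - q₂ - q₂ * r + q₀) * hr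

end Golden

/-! ### Groups with a golden trace. -/

namespace IsAdmissible

open Quaternion Real

variable {S : Set (ℍ[ℝ] × ℍ[ℝ])}

/-- If some pure element has trace 1 - φ or -1 with a, it completes a frame in which the group
consists of icosians. Otherwise every element is ± a power of a* or orthogonal to the plane of 1 and
a, and the group is cyclic or dicyclic. -/
theorem isE8Embeddable_of_golden (h : IsAdmissible S)
    (hT : ∀ y ∈ S, ∃ p q : ℤ, HasTrace goldenRatio goldenConj p q y ∧ (p, q) ∈ goldenCoeffs)
    {a : ℍ[ℝ] × ℍ[ℝ]} (ha : a ∈ S) (hta : HasTrace goldenRatio goldenConj 0 1 a) :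
    IsE8Embeddable S := by
  have hr := goldenRatio_sq
  have hr' := goldenConj_sq
  obtain ⟨ha1, ha2⟩ := hta
  simp only [Int.cast_zero, Int.cast_one, zero_add, one_mul] at ha1 ha2
  have na1 := h.normSq₁ a ha
  have na2 := h.normSq₂ a ha
  by_cases hc₁ : ∃ X ∈ S, HasTrace goldenRatio goldenConj 0 0 X ∧
      HasTrace goldenRatio goldenConj 1 (-1) (X * a)
  · obtain ⟨X, hXS, hX0, hX1⟩ := hc₁
    have nX1 := h.normSq₁ X hXS
    have nX2 := h.normSq₂ X hXS
    obtain ⟨hX01, hX02⟩ := hX0.re_eq_zero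
    have hF₁ := isFrame_golden₁ hr na1 nX1 ha1 hX01 (by
      have := hX1.1; push_cast at this; rw [Prod.fst_mul] at this; linarith)
    have hF₂ := isFrame_golden₁ hr' na2 nX2 ha2 hX02 (by
      have := hX1.2; push_cast at this; rw [Prod.snd_mul] at this; linarith)
    refine IsE8Embeddable.of_frame (X := X) (Y := (_, _)) PairData.icosahedral.isOrthogonalModel hF₁ hF₂
      (r := goldenRatio) (r' := goldenConj) fun x hx => ?_
    obtain ⟨p₀, q₀, t0, -⟩ := hT x hx
    obtain ⟨p₁, q₁, t1, -⟩ := hT _ (h.mul_mem x hx _ (h.star_mem X hXS))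
    obtain ⟨m, n, t2, -⟩ := hT _ (h.mul_mem x hx _ (h.star_mem a ha))
    obtain ⟨m', n', t3, -⟩ := hT _ (h.mul_mem x hx _ (h.star_mem _ (h.mul_mem X hXS a ha)))
    exact ⟨p₀, p₁, _, _, q₀, q₁, _, _, t0, t1,
      ⟨golden_coord₁ hr t0.1 t1.1 t2.1, golden_coord₁ hr' t0.2 t1.2 t2.2⟩,
      ⟨golden_coord₁' hr nX1 hX01 t0.1 t1.1 t3.1, golden_coord₁' hr' nX2 hX02 t0.2 t1.2 t3.2⟩,
      fun z hz => icosahedral_mem hz (by omega) (by omega) (by omega) (by omega)⟩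
  by_cases hc₂ : ∃ Y ∈ S, HasTrace goldenRatio goldenConj 0 0 Y ∧
      HasTrace goldenRatio goldenConj (-1) 0 (Y * a)
  · obtain ⟨Y, hYS, hY0, hY1⟩ := hc₂
    have nY1 := h.normSq₁ Y hYS
    have nY2 := h.normSq₂ Y hYS
    obtain ⟨hY01, hY02⟩ := hY0.re_eq_zero
    have hF₁ := isFrame_golden₂ hr na1 nY1 ha1 hY01 (by
      have := hY1.1; push_cast at this; rw [Prod.fst_mul] at this; linarith)
    have hF₂ := isFrame_golden₂ hr' na2 nY2 ha2 hY02 (by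
      have := hY1.2; push_cast at this; rw [Prod.snd_mul] at this; linarith)
    refine IsE8Embeddable.of_frame (X := (_, _)) (Y := Y) PairData.icosahedral.isOrthogonalModel hF₁ hF₂
      (r := goldenRatio) (r' := goldenConj) fun x hx => ?_
    obtain ⟨p₀, q₀, t0, -⟩ := hT x hx
    obtain ⟨p₂, q₂, t2, -⟩ := hT _ (h.mul_mem x hx _ (h.star_mem Y hYS))
    obtain ⟨m, n, t1, -⟩ := hT _ (h.mul_mem x hx _ (h.star_mem a ha))
    obtain ⟨m', n', t3, -⟩ := hT _ (h.mul_mem x hx _ (h.star_mem _ (h.mul_mem a ha Y hYS)))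
    exact ⟨p₀, _, p₂, _, q₀, _, q₂, _, t0,
      ⟨golden_coord₂ hr t0.1 t2.1 t1.1, golden_coord₂ hr' t0.2 t2.2 t1.2⟩, t2,
      ⟨golden_coord₂' hr nY1 hY01 t0.1 t2.1 t3.1, golden_coord₂' hr' nY2 hY02 t0.2 t2.2 t3.2⟩,
      fun z hz => icosahedral_mem hz (by omega) (by omega) (by omega) (by omega)⟩
  have hpow : ∀ y ∈ S, ∀ k : ℕ, y * a ^ k ∈ S := fun y hy k => by
    induction k with
    | zero => simpa using hy
    | succ k ih => rw [pow_succ, ← mul_assoc]; exact h.mul_mem _ ih _ ha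
  have hneg : ∀ {p q : ℤ} {y : ℍ[ℝ] × ℍ[ℝ]}, HasTrace goldenRatio goldenConj p q y →
      HasTrace goldenRatio goldenConj (-p) (-q) (-y) := fun {p q y} t =>
    ⟨by have := t.1; simp; linarith, by have := t.2; simp; linarith⟩
  have hseq : ∀ y : ℍ[ℝ] × ℍ[ℝ], ∀ u v : ℤ × ℤ, HasTrace goldenRatio goldenConj u.1 u.2 y →
      HasTrace goldenRatio goldenConj v.1 v.2 (y * a) → ∀ k,
      HasTrace goldenRatio goldenConj (goldenSeq u v k).1 (goldenSeq u v k).2 (y * a ^ k) ∧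
      HasTrace goldenRatio goldenConj (goldenSeq u v (k + 1)).1 (goldenSeq u v (k + 1)).2
        (y * a ^ (k + 1)) := by
    intro y u v hu hv k
    induction k with
    | zero => simpa [goldenSeq] using ⟨hu, hv⟩
    | succ k ih =>
      refine ⟨ih.2, ?_⟩
      have e : ∀ b z : ℍ[ℝ], normSq b = 1 → (z * b ^ (k + 1 + 1)).re =
          2 * b.re * (z * b ^ (k + 1)).re - (z * b ^ k).re := fun b z hb => by
        rw [pow_add b (k + 1) 1, pow_one, pow_succ, mul_assoc, mul_self_eq hb, mul_sub, mul_sub,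
          mul_smul_comm, mul_smul_comm, mul_one, ← pow_succ]
        simp only [re_sub, re_smul, smul_eq_mul]
      obtain ⟨⟨a1, a2⟩, b1, b2⟩ := ih
      constructor
      · simp only [Prod.fst_mul, Prod.pow_fst, goldenSeq] at a1 b1 ⊢
        rw [e _ _ na1, ha1]
        push_cast
        linear_combination goldenRatio * b1 - a1 + (goldenSeq u v (k + 1)).2 * hr
      · simp only [Prod.snd_mul, Prod.pow_snd, goldenSeq] at a2 b2 ⊢
        rw [e _ _ na2, ha2]
        push_cast
        linear_combination goldenConj * b2 - a2 + (goldenSeq u v (k + 1)).2 * hr'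
  have hone : ∀ y ∈ S, HasTrace goldenRatio goldenConj 2 0 y → y = 1 := fun y hy t =>
    Prod.ext (h.eq_one₁ hy (by simpa using t.1)) (h.eq_one₂ hy (by simpa using t.2))
  have haa : ∀ k : ℕ, a ^ k * star a ^ k = 1 := fun k => by
    have h1 : a * star a = 1 := Prod.ext (mul_star_of_normSq na1) (mul_star_of_normSq na2)
    have h2 : star a * a = 1 := Prod.ext (star_mul_of_normSq na1) (star_mul_of_normSq na2)
    rw [← Commute.mul_pow (h1.trans h2.symm), h1, one_pow]
  have hdich : ∀ y ∈ S, (HasTrace goldenRatio goldenConj 0 0 y ∧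
      HasTrace goldenRatio goldenConj 0 0 (y * a)) ∨ ∃ k, y = star a ^ k ∨ y = -star a ^ k := by
    intro y hy
    obtain ⟨p₀, q₀, t0, -⟩ := hT y hy
    obtain ⟨p₁, q₁, t1, -⟩ := hT _ (h.mul_mem y hy a ha)
    have hk := hseq y (p₀, q₀) (p₁, q₁) t0 t1
    have hmem : ∀ k, goldenSeq (p₀, q₀) (p₁, q₁) k ∈ goldenCoeffs := fun k => by
      obtain ⟨p, q, t, ht⟩ := hT _ (hpow y hy k)
      have := goldenRatio_irrational.int_add_mul_inj (t.1.symm.trans (hk k).1.1)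
      exact (Prod.ext this.1 this.2 : (p, q) = _) ▸ ht
    rcases goldenSeq_cases hmem with ⟨h0, h1⟩ | ⟨k, hk' | hk' | ⟨hk', hk''⟩⟩
    · simp only [Prod.mk.injEq] at h0 h1
      rw [h0.1, h0.2] at t0
      rw [h1.1, h1.2] at t1
      exact Or.inl ⟨t0, t1⟩
    · have e := hone _ (hpow y hy k) (by have := (hk k).1; rwa [hk'] at this)
      refine Or.inr ⟨k, Or.inl ?_⟩
      rw [← one_mul (star a ^ k), ← e, mul_assoc, haa, mul_one]
    · have e := hone _ (h.neg_mem _ (hpow y hy k))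
        (by have := hneg (hk k).1; rw [hk'] at this; simpa using this)
      refine Or.inr ⟨k, Or.inr ?_⟩
      rw [← one_mul (star a ^ k), ← e, neg_mul, neg_neg, mul_assoc, haa, mul_one]
    · exfalso
      have t := (hk k).1
      have t' := (hk (k + 1)).1
      rw [hk'] at t
      rw [pow_succ, ← mul_assoc] at t'
      have hS := hpow y hy k
      have tn := hneg t
      have tn' := hneg t'
      rw [← neg_mul] at tn'
      simp only [List.mem_cons, List.not_mem_nil, or_false] at hk''
      rcases hk'' with e | e | e | e <;> rw [e] at t' tn'
      · exact hc₂ ⟨_, h.neg_mem _ hS, by simpa using tn, by simpa using tn'⟩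
      · exact hc₂ ⟨_, hS, t, t'⟩
      · exact hc₁ ⟨_, hS, t, t'⟩
      · exact hc₁ ⟨_, h.neg_mem _ hS, by simpa using tn, by simpa using tn'⟩
  -- d is an element of S orthogonal to 1 and a on both sides if one exists, and otherwise any such
  -- pair of unit quaternions.
  obtain ⟨d, nd1, nd2, hd1, hd2, hda1, hda2, hd⟩ : ∃ d : ℍ[ℝ] × ℍ[ℝ], normSq d.1 = 1 ∧ normSq d.2 = 1 ∧
      d.1.re = 0 ∧ d.2.re = 0 ∧ (d.1 * a.1).re = 0 ∧ (d.2 * a.2).re = 0 ∧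
      (d ∈ S ∨ ∀ y ∈ S, ∃ k, y = star a ^ k ∨ y = -star a ^ k) := by
    by_cases hd : ∃ d ∈ S, HasTrace goldenRatio goldenConj 0 0 d ∧
        HasTrace goldenRatio goldenConj 0 0 (d * a)
    · obtain ⟨d, hdS, h1, h2⟩ := hd
      exact ⟨d, h.normSq₁ d hdS, h.normSq₂ d hdS, h1.re_eq_zero.1, h1.re_eq_zero.2,
        h2.re_eq_zero.1, h2.re_eq_zero.2, Or.inl hdS⟩
    · have perp : ∀ b : ℍ[ℝ], ∃ y : ℍ[ℝ], normSq y = 1 ∧ y.re = 0 ∧ (y * b).re = 0 := fun b => by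
        obtain ⟨y, h1, h2, h3⟩ := exists_re_mul_eq_zero (b - (b.re : ℍ[ℝ]))
        refine ⟨y, h1, h2, ?_⟩
        rw [re_mul_comm, mul_sub, re_sub] at h3
        simpa [h2] using h3
      obtain ⟨d₁, n1, r1, o1⟩ := perp a.1
      obtain ⟨d₂, n2, r2, o2⟩ := perp a.2
      refine ⟨(d₁, d₂), n1, n2, r1, r2, o1, o2, Or.inr fun y hy => ?_⟩
      exact (hdich y hy).resolve_left fun H => hd ⟨y, hy, H⟩
  obtain ⟨X₁, Y₁, hF₁, hXY₁, hn₁, hY₁, hX₁⟩ := isFrame_golden₃ hr na1 nd1 ha1 hd1 hda1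
  obtain ⟨X₂, Y₂, hF₂, hXY₂, hn₂, -, -⟩ := isFrame_golden₃ hr' na2 nd2 ha2 hd2 hda2
  have hall : ∀ y ∈ S, ∃ k, y = star a ^ k ∨ y = -star a ^ k ∨ y = star a ^ k * d ∨
      y = -star a ^ k * d := by
    intro y hy
    rcases hd with hdS | hd
    swap
    · obtain ⟨k, hk | hk⟩ := hd y hy
      exacts [⟨k, Or.inl hk⟩, ⟨k, Or.inr (Or.inl hk)⟩]
    rcases hdich y hy with ⟨t0, t1⟩ | ⟨k, hk | hk⟩
    · have hdd : star d * d = 1 := Prod.ext (star_mul_of_normSq nd1) (star_mul_of_normSq nd2)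
      rcases hdich _ (h.mul_mem y hy _ (h.star_mem d hdS)) with ⟨s0, s1⟩ | ⟨k, hk | hk⟩
      -- If y and yd* were both orthogonal to the plane of 1 and a, all four coordinates of y in the
      -- frame (X₁, Y₁) would vanish.
      · exfalso
        have u0 := t0.re_eq_zero.1
        have u1 : (y.1 * a.1).re = 0 := t1.re_eq_zero.1
        have v0 : (y.1 * star d.1).re = 0 := s0.re_eq_zero.1
        have v1 : (y.1 * star d.1 * a.1).re = 0 := s1.re_eq_zero.1
        obtain ⟨n, hn⟩ : ∃ n, n = (2 : ℝ) • a.1 - goldenRatio • 1 := ⟨_, rfl⟩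
        have hn0 : star n = -n := star_eq_neg.2 (by rw [hn]; simp; linarith)
        have w0 : (y.1 * n).re = 0 := by
          rw [hn, mul_sub, mul_smul_comm, mul_smul_comm, mul_one, re_sub, re_smul, re_smul, u0, u1]
          simp
        have w1 : (y.1 * (star d.1 * n)).re = 0 := by
          rw [← mul_assoc, hn, mul_sub, mul_smul_comm, mul_smul_comm, mul_one, re_sub, re_smul,
            re_smul, v0, v1]
          simp
        rw [← hn] at hX₁ hY₁
        have hX : (y.1 * star X₁).re = 0 := by
          have e : (y.1 * star ((5 : ℝ) • X₁)).re = 0 := by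
            rw [hX₁]
            simp only [Quaternion.star_smul, star_add, star_mul, hn0, smul_neg, mul_neg, mul_add,
              mul_smul_comm, re_smul, re_add, re_neg, smul_eq_mul, w0, w1]
            simp
          rw [Quaternion.star_smul, mul_smul_comm, re_smul, smul_eq_mul] at e
          linarith
        have hY : (y.1 * star Y₁).re = 0 := by
          have e : (y.1 * star ((5 : ℝ) • Y₁)).re = 0 := by
            rw [hY₁]
            simp only [Quaternion.star_smul, star_sub, star_mul, hn0, smul_neg, mul_neg, mul_sub,
              mul_smul_comm, re_smul, re_sub, re_neg, smul_eq_mul, w0, w1, smul_mul_assoc]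
            simp
          rw [Quaternion.star_smul, mul_smul_comm, re_smul, smul_eq_mul] at e
          linarith
        have hP := hF₁.parseval y.1
        rw [hXY₁, u0, hX, hY, v0, h.normSq₁ y hy] at hP
        norm_num at hP
      · exact ⟨k, Or.inr (Or.inr (Or.inl (by rw [← hk, mul_assoc, hdd, mul_one])))⟩
      · exact ⟨k, Or.inr (Or.inr (Or.inr (by rw [← hk, mul_assoc, hdd, mul_one])))⟩
    · exact ⟨k, Or.inl hk⟩
    · exact ⟨k, Or.inr (Or.inl hk)⟩
  obtain ⟨p, hp, hpX, hpY⟩ := hF₁.exists_conj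
  obtain ⟨q, hq, hqX, hqY⟩ := hF₂.exists_conj
  refine IsE8Embeddable.of_conj PairData.icosahedral.isOrthogonalModel hp hq ?_
  have hd' : PairData.icosahedral.hom (conjPair p q hp hq d) ∈ e8Ring := by
    refine icosahedral_mem (p₀ := 0) (p₁ := 0) (p₂ := 0) (p₃ := 2) (q₀ := 0) (q₁ := 0) (q₂ := 0)
      (q₃ := 0) ?_ (by decide) (by decide) (by decide) (by decide)
    have e1 : (conjPair p q hp hq d).1 = mkQ 0 1 0 0 * mkQ 0 0 1 0 := by
      rw [← hpX, ← hpY, ← map_mul, hXY₁]; rfl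
    have e2 : (conjPair p q hp hq d).2 = mkQ 0 1 0 0 * mkQ 0 0 1 0 := by
      rw [← hqX, ← hqY, ← map_mul, hXY₂]; rfl
    constructor <;> simp [e1, e2]
  have ha' : PairData.icosahedral.hom (conjPair p q hp hq (star a)) ∈ e8Ring := by
    -- The doubled coordinates of a* are those of φ - (φ - 1) i - j.
    refine icosahedral_mem (p₀ := 0) (p₁ := 1) (p₂ := -1) (p₃ := 0) (q₀ := 1) (q₁ := -1) (q₂ := 0)
      (q₃ := 0) ?_ (by decide) (by decide) (by decide) (by decide)
    have e1 : (2 : ℝ) • (conjPair p q hp hq (star a)).1 =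
        star (goldenRatio • 1 + (goldenRatio - 1) • mkQ 0 1 0 0 + mkQ 0 0 1 0) := by
      rw [← hpX, ← hpY, ← map_one (conjHom p hp), ← conjHom_smul, ← conjHom_smul, ← map_add,
        ← map_add, ← conjHom_star, add_assoc, ← hn₁, add_sub_cancel, Quaternion.star_smul, conjHom_smul]
      rfl
    have e2 : (2 : ℝ) • (conjPair p q hp hq (star a)).2 =
        star (goldenConj • 1 + (goldenConj - 1) • mkQ 0 1 0 0 + mkQ 0 0 1 0) := by
      rw [← hqX, ← hqY, ← map_one (conjHom q hq), ← conjHom_smul, ← conjHom_smul, ← map_add,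
        ← map_add, ← conjHom_star, add_assoc, ← hn₂, add_sub_cancel, Quaternion.star_smul, conjHom_smul]
      rfl
    constructor
    · simpa using congrArg QuaternionAlgebra.re e1
    · simpa using congrArg QuaternionAlgebra.re e2
    · have := congrArg QuaternionAlgebra.imI e1; simp at this ⊢; linarith
    · have := congrArg QuaternionAlgebra.imI e2; simp at this ⊢; linarith
    · simpa using congrArg QuaternionAlgebra.imJ e1
    · simpa using congrArg QuaternionAlgebra.imJ e2
    · simpa using congrArg QuaternionAlgebra.imK e1
    · simpa using congrArg QuaternionAlgebra.imK e2
  have hak : ∀ k : ℕ, PairData.icosahedral.hom (conjPair p q hp hq (star a ^ k)) ∈ e8Ring := fun k => by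
    rw [map_pow, map_pow]; exact pow_mem ha' k
  intro y hy
  change PairData.icosahedral.hom (conjPair p q hp hq y) ∈ e8Ring
  obtain ⟨k, rfl | rfl | rfl | rfl⟩ := hall y hy
  · exact hak k
  · rw [map_neg, map_neg]; exact e8Ring.neg_mem (hak k)
  · rw [map_mul, map_mul]; exact e8Ring.mul_mem (hak k) hd'
  · rw [neg_mul, map_neg, map_neg, map_mul, map_mul]; exact e8Ring.neg_mem (e8Ring.mul_mem (hak k) hd')

end IsAdmissible

/-! ### Groups of unit quaternions with integral traces. -/

section Hurwitz

open Quaternion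

theorem conjHom_mul (p q : ℍ[ℝ]) (hp : normSq p = 1) (hq : normSq q = 1)
    (hpq : normSq (p * q) = 1) (x : ℍ[ℝ]) :
    conjHom (p * q) hpq x = conjHom p hp (conjHom q hq x) := by
  simp [conjHom_apply, mul_assoc]

theorem exists_conjHom_eq {x y : ℍ[ℝ]} (hx : normSq x = 1) (hy : normSq y = 1) (hx0 : x.re = 0)
    (hy0 : y.re = 0) : ∃ p : ℍ[ℝ], ∃ hp : normSq p = 1, conjHom p hp x = y := by
  obtain ⟨x', hx'⟩ := exists_isFrame hx hx0
  obtain ⟨y', hy'⟩ := exists_isFrame hy hy0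
  obtain ⟨p, hp, h1, -⟩ := hx'.exists_conj
  obtain ⟨q, hq, h2, -⟩ := hy'.exists_conj
  have hq' : normSq (star q) = 1 := by rw [normSq_star, hq]
  have hpq : normSq (star q * p) = 1 := by rw [map_mul, hq', hp, one_mul]
  refine ⟨star q * p, hpq, ?_⟩
  rw [conjHom_mul _ _ hq' hp, h1, ← h2, conjHom_apply, conjHom_apply, star_star, mul_assoc,
    mul_assoc, star_mul_of_normSq hq, mul_one, ← mul_assoc, star_mul_of_normSq hq, one_mul]

/-- A group of unit quaternions with integral traces and without binary dihedral subgroup of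
order twelve. -/
structure IsIntegralGroup (P : Set ℍ[ℝ]) : Prop where
  mul_mem : ∀ x ∈ P, ∀ y ∈ P, x * y ∈ P
  star_mem : ∀ x ∈ P, star x ∈ P
  neg_mem : ∀ x ∈ P, -x ∈ P
  normSq : ∀ x ∈ P, normSq x = 1
  int : ∀ x ∈ P, ∃ n : ℤ, 2 * x.re = n
  not_dicyclic : ∀ x ∈ P, ∀ y ∈ P, 2 * x.re = -1 → y.re = 0 → (x * y).re = 0 → False

/-- `2 x` has integral coordinates of equal parity. -/
def IsHurwitz (x : ℍ[ℝ]) (p₀ p₁ p₂ p₃ : ℤ) : Prop :=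
  2 * x.re = p₀ ∧ 2 * x.imI = p₁ ∧ 2 * x.imJ = p₂ ∧ 2 * x.imK = p₃ ∧
    2 ∣ p₁ - p₀ ∧ 2 ∣ p₂ - p₀ ∧ 2 ∣ p₃ - p₀

theorem even_sub_of_sum_sq {p₀ p₁ p₂ p₃ : ℤ} (h : p₀ ^ 2 + p₁ ^ 2 + p₂ ^ 2 + p₃ ^ 2 = 4) :
    2 ∣ p₁ - p₀ ∧ 2 ∣ p₂ - p₀ ∧ 2 ∣ p₃ - p₀ := by
  obtain ⟨a, rfl | rfl⟩ := Int.even_or_odd' p₀ <;> obtain ⟨b, rfl | rfl⟩ := Int.even_or_odd' p₁ <;>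
    obtain ⟨c, rfl | rfl⟩ := Int.even_or_odd' p₂ <;> obtain ⟨d, rfl | rfl⟩ := Int.even_or_odd' p₃ <;>
    ring_nf at h <;> omega

theorem IsFrame.hurwitz {X Y x p : ℍ[ℝ]} (hF : IsFrame X Y) {hp : Quaternion.normSq p = 1}
    (hX : conjHom p hp X = mkQ 0 1 0 0) (hY : conjHom p hp Y = mkQ 0 0 1 0)
    (hx : Quaternion.normSq x = 1) {p₀ p₁ p₂ p₃ : ℤ} (h0 : 2 * x.re = p₀)
    (h1 : 2 * (x * star X).re = p₁) (h2 : 2 * (x * star Y).re = p₂)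
    (h3 : 2 * (x * star (X * Y)).re = p₃) : IsHurwitz (conjHom p hp x) p₀ p₁ p₂ p₃ := by
  have hP := hF.parseval x
  have hsum : p₀ ^ 2 + p₁ ^ 2 + p₂ ^ 2 + p₃ ^ 2 = 4 := by
    have : (p₀ : ℝ) ^ 2 + p₁ ^ 2 + p₂ ^ 2 + p₃ ^ 2 = 4 := by
      rw [← h0, ← h1, ← h2, ← h3]; linarith
    exact_mod_cast this
  have e := hasCoeffs_conj (r := 0) (r' := 0) (q₀ := 0) (q₁ := 0) (q₂ := 0) (q₃ := 0)
    (X := (X, X)) (Y := (Y, Y)) (x := (x, x)) hX hX hY hY ⟨by simpa using h0, by simpa using h0⟩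
    ⟨by simpa using h1, by simpa using h1⟩ ⟨by simpa using h2, by simpa using h2⟩
    ⟨by simpa using h3, by simpa using h3⟩
  exact ⟨by simpa using e.re₁, by simpa using e.imI₁, by simpa using e.imJ₁, by simpa using e.imK₁,
    even_sub_of_sum_sq hsum⟩

/-- Let u, v be the traces of c and cg*, so u² + v² ≤ 4. The value 2 makes cgc* orthogonal to g and
0 makes c so, giving a frame in P; the value 1 gives a binary dihedral group of order twelve; 3 is
not a sum of two squares. Hence u² + v² = 4 and c lies in the plane of 1 and g. -/
theorem IsIntegralGroup.exists_hurwitz_of_pure {P : Set ℍ[ℝ]} (h : IsIntegralGroup P)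
    (hQ : ¬∃ X ∈ P, ∃ Y ∈ P, IsFrame X Y) {g : ℍ[ℝ]} (hgP : g ∈ P) (hg0 : g.re = 0) :
    ∃ p : ℍ[ℝ], ∃ hp : Quaternion.normSq p = 1, ∀ x ∈ P, ∃ p₀ p₁ p₂ p₃ : ℤ,
      IsHurwitz (conjHom p hp x) p₀ p₁ p₂ p₃ := by
  have ng := h.normSq g hgP
  have sg : star g = -g := star_eq_neg.2 hg0
  obtain ⟨Y, hF⟩ := exists_isFrame ng hg0
  obtain ⟨p, hp, hpX, hpY⟩ := hF.exists_conj
  refine ⟨p, hp, fun c hc => ?_⟩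
  have nc := h.normSq c hc
  have hcg := h.mul_mem c hc _ (h.star_mem g hgP)
  obtain ⟨u, hu⟩ := h.int c hc
  obtain ⟨v, hv⟩ := h.int _ hcg
  have hP := hF.parseval c
  rw [nc] at hP
  have huv : u ^ 2 + v ^ 2 ≤ 4 := by
    have : (u : ℝ) ^ 2 + v ^ 2 ≤ 4 := by
      rw [← hu, ← hv]; nlinarith [sq_nonneg (c * star Y).re, sq_nonneg (c * star (g * Y)).re]
    exact_mod_cast this
  have h2 : u ^ 2 + v ^ 2 ≠ 2 := fun e => by
    refine hQ ⟨g, hgP, _, h.mul_mem _ (h.mul_mem c hc g hgP) _ (h.star_mem c hc), ng,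
      h.normSq _ (h.mul_mem _ (h.mul_mem c hc g hgP) _ (h.star_mem c hc)), hg0, ?_, ?_⟩
    · exact (conjHom_re c nc g).trans hg0
    · rw [re_mul_conj ng hg0 nc]
      have e' : (u : ℝ) ^ 2 + v ^ 2 = 2 := by exact_mod_cast e
      rw [← hu, ← hv] at e'
      linarith
  have h0 : ¬(u = 0 ∧ v = 0) := by
    rintro ⟨rfl, rfl⟩
    have h1 : (c * star g).re = 0 := by simpa using hv
    refine hQ ⟨g, hgP, c, hc, ng, nc, hg0, by simpa using hu, ?_⟩
    rwa [sg, mul_neg, re_neg, neg_eq_zero, re_mul_comm] at h1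
  have dic : ∀ d ∈ P, (2 * d.re = 1 ∨ 2 * d.re = -1) → (d * g).re = 0 → False := by
    rintro d hd (e | e) e'
    · exact h.not_dicyclic _ (h.neg_mem d hd) g hgP (by simp; linarith) hg0 (by rw [neg_mul, re_neg, e', neg_zero])
    · exact h.not_dicyclic d hd g hgP e hg0 e'
  have h3 : ¬((u = 1 ∨ u = -1) ∧ v = 0) := by
    rintro ⟨e, rfl⟩
    refine dic c hc (by rcases e with rfl | rfl <;> simp [hu]) ?_
    rw [sg, mul_neg, re_neg] at hv
    push_cast at hv
    linarith
  have h4 : ¬((v = 1 ∨ v = -1) ∧ u = 0) := by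
    rintro ⟨e, rfl⟩
    refine dic _ hcg (by rcases e with rfl | rfl <;> rw [hv] <;> simp) ?_
    rw [mul_assoc, star_mul_of_normSq ng, mul_one]
    simpa using hu
  have hu2 : u ≤ 2 := by nlinarith
  have hu2' : -2 ≤ u := by nlinarith
  have hv2 : v ≤ 2 := by nlinarith
  have hv2' : -2 ≤ v := by nlinarith
  have huv4 : u ^ 2 + v ^ 2 = 4 := by
    interval_cases u <;> interval_cases v <;> omega
  obtain ⟨o1, o2⟩ := hF.re_eq_zero nc (by
    rw [hu, hv]; exact_mod_cast huv4)
  exact ⟨u, v, 0, 0, hF.hurwitz hpX hpY nc hu hv (by rw [o1]; simp) (by rw [o2]; simp)⟩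

/-- The traces of d, dc, dc* sum to zero. As each is ±1 or ±2, one of them is ±2, so d is up to sign
a power of c. -/
theorem IsIntegralGroup.exists_hurwitz_of_cubeRoot {P : Set ℍ[ℝ]} (h : IsIntegralGroup P)
    (hne : ∀ c ∈ P, ∀ n : ℤ, 2 * c.re = n → n = 1 ∨ n = -1 ∨ n = 2 ∨ n = -2) {c : ℍ[ℝ]}
    (hc : c ∈ P) (hc1 : 2 * c.re = -1) :
    ∃ p : ℍ[ℝ], ∃ hp : Quaternion.normSq p = 1, ∀ x ∈ P, ∃ p₀ p₁ p₂ p₃ : ℤ,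
      IsHurwitz (conjHom p hp x) p₀ p₁ p₂ p₃ := by
  have nc := h.normSq c hc
  obtain ⟨n, hn⟩ : ∃ n, n = (√3)⁻¹ • ((2 : ℝ) • c + 1) := ⟨_, rfl⟩
  have h3 : √3 * √3 = 3 := Real.mul_self_sqrt (by norm_num)
  have h30 : √3 ≠ 0 := by positivity
  have hcn : (2 : ℝ) • c = √3 • n - 1 := by
    rw [hn, smul_smul, mul_inv_cancel₀ h30, one_smul, add_sub_cancel_right]
  have h3i : (√3)⁻¹ ^ 2 = 1 / 3 := by rw [inv_pow, sq, h3]; norm_num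
  have n0 : n.re = 0 := by
    rw [hn, re_smul, re_add, re_smul, re_one, smul_eq_mul, smul_eq_mul, hc1]; simp
  have n1 : Quaternion.normSq n = 1 := by
    rw [normSq_def'] at nc
    rw [hn, normSq_smul, normSq_def', h3i]
    simp
    linear_combination 4 / 3 * nc + 2 / 3 * hc1
  -- The axis of c is rotated to (i + j + k)/√3, which makes c the Hurwitz unit (-1 + i + j + k)/2.
  obtain ⟨m, hm⟩ : ∃ m, m = (√3)⁻¹ • mkQ 0 1 1 1 := ⟨_, rfl⟩
  have m0 : m.re = 0 := by rw [hm]; simp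
  have m1 : Quaternion.normSq m = 1 := by
    rw [hm, normSq_smul, normSq_def', h3i]; simp; norm_num
  obtain ⟨p, hp, hpn⟩ := exists_conjHom_eq n1 m1 n0 m0
  have hpc : (2 : ℝ) • conjHom p hp c = mkQ (-1) 1 1 1 := by
    rw [← conjHom_smul, hcn, map_sub, conjHom_smul, hpn, hm, smul_smul, mul_inv_cancel₀ h30, one_smul,
      map_one]
    ext <;> simp
  have hpc' : (2 : ℝ) • conjHom p hp (star c) = mkQ (-1) (-1) (-1) (-1) := by
    rw [conjHom_star, ← Quaternion.star_smul, hpc]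
    ext <;> simp
  refine ⟨p, hp, fun d hd => ?_⟩
  have hdc := h.mul_mem d hd c hc
  have hds := h.mul_mem d hd _ (h.star_mem c hc)
  obtain ⟨u, hu⟩ := h.int d hd
  obtain ⟨v, hv⟩ := h.int _ hdc
  obtain ⟨w, hw⟩ := h.int _ hds
  have hsum : u + v + w = 0 := by
    have e := re_mul_add_re_mul_star d c
    have : (u : ℝ) + v + w = 0 := by
      rw [← hu, ← hv, ← hw]; linear_combination 2 * e + 2 * d.re * hc1
    exact_mod_cast this
  have hu' := hne _ hd _ hu
  have hv' := hne _ hdc _ hv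
  have hw' := hne _ hds _ hw
  have two : ∀ z ∈ P, 2 * z.re = 2 → z = 1 := fun z hz e =>
    eq_one_of_re (h.normSq z hz) (by linarith)
  have two' : ∀ z ∈ P, 2 * z.re = -2 → z = -1 := fun z hz e =>
    eq_neg_one_of_re (h.normSq z hz) (by linarith)
  have rc : ∀ z, d * c = z → d = z * star c := fun z hz => by
    rw [← hz, mul_assoc, mul_star_of_normSq nc, mul_one]
  have rs : ∀ z, d * star c = z → d = z * c := fun z hz => by
    rw [← hz, mul_assoc, star_mul_of_normSq nc, mul_one]
  have hd6 : d = 1 ∨ d = -1 ∨ d = star c ∨ d = -star c ∨ d = c ∨ d = -c := by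
    have : u = 2 ∨ u = -2 ∨ v = 2 ∨ v = -2 ∨ w = 2 ∨ w = -2 := by omega
    rcases this with rfl | rfl | rfl | rfl | rfl | rfl
    · exact Or.inl (two _ hd (by simpa using hu))
    · exact Or.inr (Or.inl (two' _ hd (by simpa using hu)))
    · have := rc _ (two _ hdc (by simpa using hv)); rw [one_mul] at this; exact Or.inr (Or.inr (Or.inl this))
    · have := rc _ (two' _ hdc (by simpa using hv)); rw [neg_one_mul] at this; exact Or.inr (Or.inr (Or.inr (Or.inl this)))
    · have := rs _ (two _ hds (by simpa using hw)); rw [one_mul] at this; exact Or.inr (Or.inr (Or.inr (Or.inr (Or.inl this))))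
    · have := rs _ (two' _ hds (by simpa using hw)); rw [neg_one_mul] at this; exact Or.inr (Or.inr (Or.inr (Or.inr (Or.inr this))))
  have co : ∀ (z : ℍ[ℝ]) (p₀ p₁ p₂ p₃ : ℤ), (2 : ℝ) • z = mkQ p₀ p₁ p₂ p₃ → 2 ∣ p₁ - p₀ →
      2 ∣ p₂ - p₀ → 2 ∣ p₃ - p₀ → ∃ p₀ p₁ p₂ p₃ : ℤ, IsHurwitz z p₀ p₁ p₂ p₃ := fun z p₀ p₁ p₂ p₃ e e1 e2 e3 =>
    ⟨p₀, p₁, p₂, p₃, by simpa using congrArg QuaternionAlgebra.re e,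
      by simpa using congrArg QuaternionAlgebra.imI e, by simpa using congrArg QuaternionAlgebra.imJ e,
      by simpa using congrArg QuaternionAlgebra.imK e, e1, e2, e3⟩
  rcases hd6 with rfl | rfl | rfl | rfl | rfl | rfl
  · exact co _ 2 0 0 0 (by rw [map_one]; ext <;> simp) (by decide) (by decide) (by decide)
  · exact co _ (-2) 0 0 0 (by rw [map_neg, map_one]; ext <;> simp) (by decide) (by decide) (by decide)
  · exact co _ (-1) (-1) (-1) (-1) (by rw [hpc']; simp) (by decide) (by decide) (by decide)
  · exact co _ 1 1 1 1 (by rw [map_neg, smul_neg, hpc']; ext <;> simp) (by decide) (by decide) (by decide)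
  · exact co _ (-1) 1 1 1 (by rw [hpc]; simp) (by decide) (by decide) (by decide)
  · exact co _ 1 (-1) (-1) (-1) (by rw [map_neg, smul_neg, hpc]; ext <;> simp) (by decide) (by decide)
      (by decide)

/-- With a frame in P the coordinates are integral traces, and the norm equation makes their doubles
congruent modulo 2. The remaining groups are handled by a pure element, by a cube root of unity, or
consist of ±1. -/
theorem IsIntegralGroup.exists_hurwitz {P : Set ℍ[ℝ]} (h : IsIntegralGroup P) :
    ∃ p : ℍ[ℝ], ∃ hp : Quaternion.normSq p = 1, ∀ x ∈ P, ∃ p₀ p₁ p₂ p₃ : ℤ,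
      IsHurwitz (conjHom p hp x) p₀ p₁ p₂ p₃ := by
  by_cases hQ : ∃ X ∈ P, ∃ Y ∈ P, IsFrame X Y
  · obtain ⟨X, hX, Y, hY, hF⟩ := hQ
    obtain ⟨p, hp, hpX, hpY⟩ := hF.exists_conj
    refine ⟨p, hp, fun x hx => ?_⟩
    obtain ⟨p₀, h0⟩ := h.int x hx
    obtain ⟨p₁, h1⟩ := h.int _ (h.mul_mem x hx _ (h.star_mem X hX))
    obtain ⟨p₂, h2⟩ := h.int _ (h.mul_mem x hx _ (h.star_mem Y hY))
    obtain ⟨p₃, h3⟩ := h.int _ (h.mul_mem x hx _ (h.star_mem _ (h.mul_mem X hX Y hY)))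
    exact ⟨p₀, p₁, p₂, p₃, hF.hurwitz hpX hpY (h.normSq x hx) h0 h1 h2 h3⟩
  by_cases hg : ∃ g ∈ P, g.re = 0
  · obtain ⟨g, hgP, hg0⟩ := hg
    exact h.exists_hurwitz_of_pure hQ hgP hg0
  have hne : ∀ c ∈ P, ∀ n : ℤ, 2 * c.re = n → n = 1 ∨ n = -1 ∨ n = 2 ∨ n = -2 := by
    intro c hc n hn
    have h1 := abs_le.1 (abs_re_le (h.normSq c hc))
    have h2 : (n : ℝ) ≤ 2 := by linarith
    have h3 : (-2 : ℝ) ≤ n := by linarith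
    have h2' : n ≤ 2 := by exact_mod_cast h2
    have h3' : -2 ≤ n := by exact_mod_cast h3
    have h4 : n ≠ 0 := by
      rintro rfl
      exact hg ⟨c, hc, by simpa using hn⟩
    omega
  by_cases hω : ∃ c ∈ P, 2 * c.re = -1
  · obtain ⟨c, hc, hc1⟩ := hω
    exact h.exists_hurwitz_of_cubeRoot hne hc hc1
  · refine ⟨1, by simp, fun c hc => ?_⟩
    obtain ⟨n, hn⟩ := h.int c hc
    have nc := h.normSq c hc
    rcases hne c hc n hn with rfl | rfl | rfl | rfl
    · exact (hω ⟨-c, h.neg_mem c hc, by simp at hn ⊢; linarith⟩).elim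
    · exact (hω ⟨c, hc, by simpa using hn⟩).elim
    · obtain rfl := eq_one_of_re nc (by push_cast at hn; linarith)
      exact ⟨2, 0, 0, 0, by simp, by simp, by simp, by simp, by decide, by decide, by decide⟩
    · obtain rfl := eq_neg_one_of_re nc (by push_cast at hn; linarith)
      exact ⟨-2, 0, 0, 0, by simp, by simp, by simp, by simp, by decide, by decide, by decide⟩

/-- Modulo 4, a product of odd numbers satisfies pq ≡ p + q - 1. For Hurwitz units with odd doubled
coordinates this detects equality of classes modulo 1 + i through the parity of the trace of xy*. -/
theorem four_dvd_sum_sub_iff {p₀ p₁ p₂ p₃ q₀ q₁ q₂ q₃ : ℤ} (hp : p₀ % 2 = 1) (hq : q₀ % 2 = 1)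
    (hp1 : 2 ∣ p₁ - p₀) (hp2 : 2 ∣ p₂ - p₀) (hp3 : 2 ∣ p₃ - p₀)
    (hq1 : 2 ∣ q₁ - q₀) (hq2 : 2 ∣ q₂ - q₀) (hq3 : 2 ∣ q₃ - q₀) :
    4 ∣ p₀ + p₁ + p₂ + p₃ - (q₀ + q₁ + q₂ + q₃) ↔ 4 ∣ p₀ * q₀ + p₁ * q₁ + p₂ * q₂ + p₃ * q₃ := by
  have odd : ∀ z : ℤ, z % 2 = 1 → ∃ w, z = 2 * w + 1 := fun z hz => ⟨z / 2, by omega⟩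
  obtain ⟨a₀, rfl⟩ := odd p₀ hp
  obtain ⟨a₁, rfl⟩ := odd p₁ (by omega)
  obtain ⟨a₂, rfl⟩ := odd p₂ (by omega)
  obtain ⟨a₃, rfl⟩ := odd p₃ (by omega)
  obtain ⟨b₀, rfl⟩ := odd q₀ hq
  obtain ⟨b₁, rfl⟩ := odd q₁ (by omega)
  obtain ⟨b₂, rfl⟩ := odd q₂ (by omega)
  obtain ⟨b₃, rfl⟩ := odd q₃ (by omega)
  ring_nf
  omega

theorem IsHurwitz.two_mul_re_mul_star {x y : ℍ[ℝ]} {p₀ p₁ p₂ p₃ q₀ q₁ q₂ q₃ : ℤ}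
    (hx : IsHurwitz x p₀ p₁ p₂ p₃) (hy : IsHurwitz y q₀ q₁ q₂ q₃) :
    4 * (x * star y).re = (p₀ * q₀ + p₁ * q₁ + p₂ * q₂ + p₃ * q₃ : ℤ) := by
  obtain ⟨a0, a1, a2, a3, -⟩ := hx
  obtain ⟨b0, b1, b2, b3, -⟩ := hy
  push_cast
  rw [← a0, ← a1, ← a2, ← a3, ← b0, ← b1, ← b2, ← b3]
  simp
  ring

end Hurwitz

/-! ### Groups generated by cube roots of unity on the two sides. -/

section Bihexagonal

open Quaternion

theorem isE8Embeddable_of_bihexagonal {S : Set (ℍ[ℝ] × ℍ[ℝ])} {Z₁ Z₂ J₁ J₂ ω₁ ω₂ : ℍ[ℝ]}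
    (hF₁ : IsFrame Z₁ J₁) (hF₂ : IsFrame Z₂ J₂) (hω₁ : (2 : ℝ) • ω₁ = √3 • Z₁ - 1)
    (hω₂ : (2 : ℝ) • ω₂ = √3 • Z₂ - 1)
    (hS : ∀ x ∈ S, ∃ k l : ℕ, x = (ω₁ ^ k, ω₂ ^ l) ∨ x = -(ω₁ ^ k, ω₂ ^ l) ∨
      x = (ω₁ ^ k, ω₂ ^ l) * (J₁, J₂) ∨ x = -((ω₁ ^ k, ω₂ ^ l) * (J₁, J₂))) : IsE8Embeddable S := by
  obtain ⟨p, hp, hpZ, hpJ⟩ := hF₁.exists_conj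
  obtain ⟨q, hq, hqZ, hqJ⟩ := hF₂.exists_conj
  refine IsE8Embeddable.of_conj PairData.bihexagonal.isOrthogonalModel hp hq fun x hx => ?_
  have e : ∀ (p : ℍ[ℝ]) (hp : normSq p = 1) (ω Z : ℍ[ℝ]), (2 : ℝ) • ω = √3 • Z - 1 →
      conjHom p hp Z = mkQ 0 1 0 0 → conjHom p hp ω = qω := fun p hp ω Z h1 h2 => by
    have h3 : (2 : ℝ) • conjHom p hp ω = (2 : ℝ) • qω := by
      rw [← conjHom_smul, h1, map_sub, conjHom_smul, h2, map_one]
      ext <;> simp [qω] <;> ring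
    simpa using h3
  have hpw : PairData.bihexagonal.hom (conjPair p q hp hq (ω₁, 1)) ∈ e8Ring := by
    convert bihexagonal_mem_left using 2
    exact Prod.ext (e p hp _ _ hω₁ hpZ) (map_one (conjHom q hq))
  have hqw : PairData.bihexagonal.hom (conjPair p q hp hq (1, ω₂)) ∈ e8Ring := by
    convert bihexagonal_mem_right using 2
    exact Prod.ext (map_one (conjHom p hp)) (e q hq _ _ hω₂ hqZ)
  have hJ : PairData.bihexagonal.hom (conjPair p q hp hq (J₁, J₂)) ∈ e8Ring := by
    convert bihexagonal_mem_j using 2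
    exact Prod.ext hpJ hqJ
  have hpow : ∀ k l : ℕ, PairData.bihexagonal.hom (conjPair p q hp hq (ω₁ ^ k, ω₂ ^ l)) ∈ e8Ring := by
    intro k l
    have : ((ω₁ ^ k, ω₂ ^ l) : ℍ[ℝ] × ℍ[ℝ]) = (ω₁, 1) ^ k * (1, ω₂) ^ l := by simp
    rw [this, map_mul, map_mul, map_pow, map_pow, map_pow, map_pow]
    exact mul_mem (pow_mem hpw k) (pow_mem hqw l)
  change PairData.bihexagonal.hom (conjPair p q hp hq x) ∈ e8Ring
  obtain ⟨k, l, rfl | rfl | rfl | rfl⟩ := hS x hx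
  · exact hpow k l
  · rw [map_neg, map_neg]; exact neg_mem (hpow k l)
  · rw [map_mul, map_mul]; exact mul_mem (hpow k l) hJ
  · rw [map_neg, map_neg, map_mul, map_mul]; exact neg_mem (mul_mem (hpow k l) hJ)

theorem exists_axis {ω : ℍ[ℝ]} (h : normSq ω = 1) (hω : 2 * ω.re = -1) :
    ∃ Z : ℍ[ℝ], normSq Z = 1 ∧ Z.re = 0 ∧ (2 : ℝ) • ω = √3 • Z - 1 := by
  have h3 : √3 * √3 = 3 := Real.mul_self_sqrt (by norm_num)
  have h30 : √3 ≠ 0 := by positivity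
  have h3i : (√3)⁻¹ ^ 2 = 1 / 3 := by rw [inv_pow, sq, h3]; norm_num
  refine ⟨(√3)⁻¹ • ((2 : ℝ) • ω + 1), ?_, ?_, ?_⟩
  · rw [normSq_def'] at h
    rw [normSq_smul, normSq_def', h3i]
    simp
    linear_combination 4 / 3 * h + 2 / 3 * hω
  · rw [re_smul, re_add, re_smul, re_one, smul_eq_mul, smul_eq_mul, hω]; simp
  · rw [smul_smul, mul_inv_cancel₀ h30, one_smul, add_sub_cancel_right]

theorem sqrt_three_mul_re {ω Z : ℍ[ℝ]} (h : (2 : ℝ) • ω = √3 • Z - 1) (x : ℍ[ℝ]) :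
    √3 * (x * Z).re = 2 * (x * ω).re + x.re := by
  have h1 : (x * ((2 : ℝ) • ω)).re = (x * (√3 • Z - 1)).re := by rw [h]
  simp only [mul_sub, mul_smul_comm, re_sub, re_smul, smul_eq_mul, mul_one] at h1
  linarith

/-- The projection of a unit quaternion to the plane of a cube root of unity has square length
`(u² + u v + v²) / 3`. -/
theorem IsFrame.cubeRoot_norm {Z J ω : ℍ[ℝ]} (hF : IsFrame Z J) (h : (2 : ℝ) • ω = √3 • Z - 1)
    {x : ℍ[ℝ]} (hx : normSq x = 1) {u v u' v' : ℝ} (hu : 2 * x.re = u) (hv : 2 * (x * ω).re = v)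
    (hu' : 2 * (x * star J).re = u') (hv' : 2 * (x * star J * ω).re = v') :
    (u ^ 2 + u * v + v ^ 2) + (u' ^ 2 + u' * v' + v' ^ 2) = 3 := by
  have h3 : √3 * √3 = 3 := Real.mul_self_sqrt (by norm_num)
  have h1 := hF.parseval x
  have e1 := sqrt_three_mul_re h x
  have e2 := sqrt_three_mul_re h (x * star J)
  rw [star_mul, star_eq_neg.2 hF.re₁, ← mul_assoc, mul_neg, mul_neg, re_neg, re_neg, hx] at h1
  rw [← hu, ← hv, ← hu', ← hv']
  have s1 : 3 * (x * Z).re ^ 2 = (2 * (x * ω).re + x.re) ^ 2 := by rw [← e1, mul_pow, sq √3, h3]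
  have s2 : 3 * (x * star J * Z).re ^ 2 = (2 * (x * star J * ω).re + (x * star J).re) ^ 2 := by
    rw [← e2, mul_pow, sq √3, h3]
  linear_combination 3 * h1 - s1 - s2

end Bihexagonal

/-! ### Hurwitz units modulo 1 + i. -/

section Hurwitz

open Quaternion

theorem normSq_conjHom {p x : ℍ[ℝ]} (hp : normSq p = 1) (hx : normSq x = 1) :
    normSq (conjHom p hp x) = 1 := by
  rw [conjHom_apply, map_mul, map_mul, normSq_star, hp, hx]; norm_num

theorem IsHurwitz.sum_eq_of_even {z : ℍ[ℝ]} {p₀ p₁ p₂ p₃ : ℤ} (h : IsHurwitz z p₀ p₁ p₂ p₃)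
    (hz : normSq z = 1) (h0 : 2 ∣ p₀) : ∃ m, p₀ + p₁ + p₂ + p₃ = 4 * m + 2 := by
  obtain ⟨a0, a1, a2, a3, e1, e2, e3⟩ := h
  have hN : p₀ ^ 2 + p₁ ^ 2 + p₂ ^ 2 + p₃ ^ 2 = 4 := by
    rw [normSq_def'] at hz
    have : (p₀ : ℝ) ^ 2 + p₁ ^ 2 + p₂ ^ 2 + p₃ ^ 2 = 4 := by
      rw [← a0, ← a1, ← a2, ← a3]; linarith
    exact_mod_cast this
  obtain ⟨a, rfl⟩ := h0
  obtain ⟨b, rfl⟩ : 2 ∣ p₁ := by omega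
  obtain ⟨c, rfl⟩ : 2 ∣ p₂ := by omega
  obtain ⟨d, rfl⟩ : 2 ∣ p₃ := by omega
  have h1 : a ^ 2 + b ^ 2 + c ^ 2 + d ^ 2 = 1 := by linarith
  have h2 : ¬Even (a + b + c + d) := by
    have : ¬Even (a ^ 2 + b ^ 2 + c ^ 2 + d ^ 2) := by rw [h1]; decide
    simpa [Int.even_add, Int.even_pow] using this
  obtain ⟨m, hm⟩ := Int.not_even_iff_odd.1 h2
  exact ⟨m, by linarith⟩

/-- Conjugation by (1 + i)/√2. It normalizes the Hurwitz units and interchanges the two nontrivial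
classes modulo 1 + i. -/
theorem exists_conjHom_quarter_turn : ∃ u : ℍ[ℝ], ∃ hu : normSq u = 1,
    ∀ z, conjHom u hu z = mkQ z.re z.imI (-z.imK) z.imJ := by
  have s2 : (√2)⁻¹ * (√2)⁻¹ = 1 / 2 := by
    rw [← mul_inv, Real.mul_self_sqrt] <;> norm_num
  refine ⟨mkQ (√2)⁻¹ (√2)⁻¹ 0 0, ?_, fun z => ?_⟩
  · rw [normSq_def']
    simp only [re_mkQ, imI_mkQ, imJ_mkQ, imK_mkQ]
    linarith
  · rw [conjHom_apply]
    ext <;> simp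
    · linear_combination 2 * z.re * s2
    · linear_combination 2 * z.imI * s2
    · linear_combination -2 * z.imK * s2
    · linear_combination 2 * z.imJ * s2

/-- One odd element whose classes on the two sides differ forces the classes of every odd element to
differ: the parity of the traces of xy* compares x with y on both sides at once. The quarter turn
then restores agreement. -/
theorem four_dvd_sum_of_quarter_turn {p₀ p₁ p₂ p₃ q₀ q₁ q₂ q₃ a₀ a₁ a₂ a₃ b₀ b₁ b₂ b₃ m n : ℤ}
    (hpq : 2 ∣ p₀ - q₀) (hab : 2 ∣ a₀ - b₀) (hao : a₀ % 2 = 1) (hmn : 2 ∣ m - n)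
    (tL : p₀ * a₀ + p₁ * a₁ + p₂ * a₂ + p₃ * a₃ = 2 * m)
    (tR : q₀ * b₀ + q₁ * b₁ + q₂ * b₂ + q₃ * b₃ = 2 * n)
    (hn4 : ¬4 ∣ a₀ + a₁ + a₂ + a₃ - (b₀ + b₁ + b₂ + b₃))
    (dP : 2 ∣ p₁ - p₀ ∧ 2 ∣ p₂ - p₀ ∧ 2 ∣ p₃ - p₀) (dQ : 2 ∣ q₁ - q₀ ∧ 2 ∣ q₂ - q₀ ∧ 2 ∣ q₃ - q₀)
    (dA : 2 ∣ a₁ - a₀ ∧ 2 ∣ a₂ - a₀ ∧ 2 ∣ a₃ - a₀) (dB : 2 ∣ b₁ - b₀ ∧ 2 ∣ b₂ - b₀ ∧ 2 ∣ b₃ - b₀)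
    (he : 2 ∣ p₀ → 4 ∣ p₀ + p₁ + p₂ + p₃ - (q₀ + q₁ + q₂ + q₃)) :
    4 ∣ p₀ + p₁ + p₂ + p₃ - (q₀ + q₁ + -q₃ + q₂) := by
  obtain ⟨dP1, dP2, dP3⟩ := dP
  obtain ⟨dQ1, dQ2, dQ3⟩ := dQ
  obtain ⟨dA1, dA2, dA3⟩ := dA
  obtain ⟨dB1, dB2, dB3⟩ := dB
  by_cases ho : 2 ∣ p₀
  · have := he ho
    omega
  · have i1 := four_dvd_sum_sub_iff (by omega) hao dP1 dP2 dP3 dA1 dA2 dA3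
    have i2 := four_dvd_sum_sub_iff (by omega) (by omega) dQ1 dQ2 dQ3 dB1 dB2 dB3
    rw [tL] at i1
    rw [tR] at i2
    have o1 : 4 ∣ 2 * m ↔ 4 ∣ 2 * n := by omega
    rw [← i1, ← i2] at o1
    clear i1 i2 tL tR he
    omega

end Hurwitz

/-! ### Admissible groups with integral traces. -/

namespace IsAdmissible

open Quaternion

variable {S : Set (ℍ[ℝ] × ℍ[ℝ])}

/-- Reduction modulo 1 + i sends Hurwitz units to a group of order three. Equal trace parity means
that the two reductions have the same kernel on S, so they agree or are inverse to each other; in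
the second case the right side is first conjugated by a quarter turn. -/
theorem isE8Embeddable_of_even (h : IsAdmissible S) (h₁ : IsIntegralGroup (Prod.fst '' S))
    (h₂ : IsIntegralGroup (Prod.snd '' S))
    (hpar : ∀ x ∈ S, ∀ a b : ℤ, 2 * x.1.re = a → 2 * x.2.re = b → 2 ∣ a - b) : IsE8Embeddable S := by
  obtain ⟨p, hp, H₁⟩ := h₁.exists_hurwitz
  obtain ⟨q, hq, H₂⟩ := h₂.exists_hurwitz
  have hco : ∀ x ∈ S, ∃ p₀ p₁ p₂ p₃ q₀ q₁ q₂ q₃ : ℤ, IsHurwitz (conjHom p hp x.1) p₀ p₁ p₂ p₃ ∧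
      IsHurwitz (conjHom q hq x.2) q₀ q₁ q₂ q₃ ∧ 2 ∣ p₀ - q₀ ∧
      (2 ∣ p₀ → 4 ∣ p₀ + p₁ + p₂ + p₃ - (q₀ + q₁ + q₂ + q₃)) := by
    intro x hx
    obtain ⟨p₀, p₁, p₂, p₃, hP⟩ := H₁ x.1 ⟨x, hx, rfl⟩
    obtain ⟨q₀, q₁, q₂, q₃, hQ⟩ := H₂ x.2 ⟨x, hx, rfl⟩
    have hpq : 2 ∣ p₀ - q₀ := hpar x hx p₀ q₀ (by rw [← hP.1, conjHom_re]) (by rw [← hQ.1, conjHom_re])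
    refine ⟨p₀, p₁, p₂, p₃, q₀, q₁, q₂, q₃, hP, hQ, hpq, fun he => ?_⟩
    obtain ⟨m, hm⟩ := hP.sum_eq_of_even (normSq_conjHom hp (h.normSq₁ x hx)) he
    obtain ⟨n, hn⟩ := hQ.sum_eq_of_even (normSq_conjHom hq (h.normSq₂ x hx)) (by omega)
    omega
  by_cases hodd : ∃ x ∈ S, ∃ p₀ p₁ p₂ p₃ q₀ q₁ q₂ q₃ : ℤ, IsHurwitz (conjHom p hp x.1) p₀ p₁ p₂ p₃ ∧
      IsHurwitz (conjHom q hq x.2) q₀ q₁ q₂ q₃ ∧ 2 ∣ p₀ - q₀ ∧ p₀ % 2 = 1 ∧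
      ¬4 ∣ p₀ + p₁ + p₂ + p₃ - (q₀ + q₁ + q₂ + q₃)
  · obtain ⟨y, hy, a₀, a₁, a₂, a₃, b₀, b₁, b₂, b₃, hA, hB, hab, hao, hn4⟩ := hodd
    obtain ⟨u, nu, hconj⟩ := exists_conjHom_quarter_turn
    have huq : normSq (u * q) = 1 := by rw [map_mul, nu, hq, one_mul]
    refine IsE8Embeddable.of_conj PairData.split.isOrthogonalModel hp huq fun x hx => ?_
    obtain ⟨p₀, p₁, p₂, p₃, q₀, q₁, q₂, q₃, hP, hQ, hpq, he⟩ := hco x hx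
    have tL := hP.two_mul_re_mul_star hA
    have tR := hQ.two_mul_re_mul_star hB
    rw [← conjHom_star, ← map_mul, conjHom_re] at tL tR
    have hxy := h.mul_mem x hx _ (h.star_mem y hy)
    obtain ⟨m, hm⟩ := h₁.int _ ⟨_, hxy, rfl⟩
    obtain ⟨n, hn⟩ := h₂.int _ ⟨_, hxy, rfl⟩
    have hmn := hpar _ hxy m n hm hn
    have tL' : p₀ * a₀ + p₁ * a₁ + p₂ * a₂ + p₃ * a₃ = 2 * m := by
      have : ((p₀ * a₀ + p₁ * a₁ + p₂ * a₂ + p₃ * a₃ : ℤ) : ℝ) = ((2 * m : ℤ) : ℝ) := by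
        rw [← tL]; push_cast; rw [← hm]; simp only [Prod.fst_mul, Prod.fst_star]; ring
      exact_mod_cast this
    have tR' : q₀ * b₀ + q₁ * b₁ + q₂ * b₂ + q₃ * b₃ = 2 * n := by
      have : ((q₀ * b₀ + q₁ * b₁ + q₂ * b₂ + q₃ * b₃ : ℤ) : ℝ) = ((2 * n : ℤ) : ℝ) := by
        rw [← tR]; push_cast; rw [← hn]; simp only [Prod.snd_mul, Prod.snd_star]; ring
      exact_mod_cast this
    obtain ⟨P0, P1, P2, P3, dP1, dP2, dP3⟩ := hP
    obtain ⟨Q0, Q1, Q2, Q3, dQ1, dQ2, dQ3⟩ := hQ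
    obtain ⟨-, -, -, -, dA1, dA2, dA3⟩ := hA
    obtain ⟨-, -, -, -, dB1, dB2, dB3⟩ := hB
    rw [conjHom_mul u q nu hq, hconj]
    refine split_mem (q₂ := -q₃) (q₃ := q₂) P0 P1 P2 P3 Q0 Q1 (by push_cast; simp only [imJ_mkQ]; linarith)
      (by simpa using Q2) dP1 dP2 dP3 (by omega) (by omega) (by omega) (by omega) ?_
    exact four_dvd_sum_of_quarter_turn hpq hab hao hmn tL' tR' hn4 ⟨dP1, dP2, dP3⟩ ⟨dQ1, dQ2, dQ3⟩
      ⟨dA1, dA2, dA3⟩ ⟨dB1, dB2, dB3⟩ he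
  · refine IsE8Embeddable.of_conj PairData.split.isOrthogonalModel hp hq fun x hx => ?_
    obtain ⟨p₀, p₁, p₂, p₃, q₀, q₁, q₂, q₃, hP, hQ, hpq, he⟩ := hco x hx
    have h4 : 4 ∣ p₀ + p₁ + p₂ + p₃ - (q₀ + q₁ + q₂ + q₃) := by
      by_cases ho : 2 ∣ p₀
      · exact he ho
      · by_contra h4
        exact hodd ⟨x, hx, p₀, p₁, p₂, p₃, q₀, q₁, q₂, q₃, hP, hQ, hpq, by omega, h4⟩
    obtain ⟨P0, P1, P2, P3, dP1, dP2, dP3⟩ := hP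
    obtain ⟨Q0, Q1, Q2, Q3, dQ1, dQ2, dQ3⟩ := hQ
    exact split_mem P0 P1 P2 P3 Q0 Q1 Q2 Q3 dP1 dP2 dP3 (by omega) (by omega) (by omega) (by omega) h4

/-- In the planes of 1, ω and of their multiples by J, the norm is given by the form u² + uv + v² in
traces. The total is 3 and the form does not take the value 2, so every element lies in one plane
and is ± a power of ω, possibly times J. -/
theorem isE8Embeddable_of_dicyclic (h : IsAdmissible S)
    (hT : ∀ x ∈ S, ∃ n : ℤ, 2 * x.1.re = n ∧ 2 * x.2.re = n) {ω J : ℍ[ℝ] × ℍ[ℝ]} (hω : ω ∈ S)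
    (hJ : J ∈ S) (hω1 : 2 * ω.1.re = -1) (hJ1 : J.1.re = 0) (hωJ : (ω.1 * J.1).re = 0) :
    IsE8Embeddable S := by
  have tr : ∀ x ∈ S, x.1.re = x.2.re := fun x hx => by
    obtain ⟨n, h1, h2⟩ := hT x hx; linarith
  have hω2 : 2 * ω.2.re = -1 := by rw [← tr ω hω, hω1]
  have hJ2 : J.2.re = 0 := by rw [← tr J hJ, hJ1]
  have hωJ2 : (ω.2 * J.2).re = 0 := (tr _ (h.mul_mem _ hω _ hJ)).symm.trans hωJ
  have n1 := h.normSq₁ ω hω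
  have n2 := h.normSq₂ ω hω
  obtain ⟨Z₁, nZ1, rZ1, eZ1⟩ := exists_axis n1 hω1
  obtain ⟨Z₂, nZ2, rZ2, eZ2⟩ := exists_axis n2 hω2
  have h30 : √3 ≠ 0 := by positivity
  have orth : ∀ Z ω J : ℍ[ℝ], (2 : ℝ) • ω = √3 • Z - 1 → J.re = 0 → (ω * J).re = 0 → (Z * J).re = 0 :=
    fun Z ω J e h1 h2 => by
      have := sqrt_three_mul_re e J
      rw [re_mul_comm J ω, h2, h1] at this
      rw [re_mul_comm]
      simpa [h30] using this
  have hF₁ : IsFrame Z₁ J.1 := ⟨nZ1, h.normSq₁ J hJ, rZ1, hJ1, orth _ _ _ eZ1 hJ1 hωJ⟩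
  have hF₂ : IsFrame Z₂ J.2 := ⟨nZ2, h.normSq₂ J hJ, rZ2, hJ2, orth _ _ _ eZ2 hJ2 hωJ2⟩
  have hone : ∀ x ∈ S, 2 * x.1.re = 2 → x = 1 := fun x hx e =>
    Prod.ext (h.eq_one₁ hx e) (h.eq_one₂ hx (by rw [← tr x hx, e]))
  have hωω : ω * star ω = 1 := Prod.ext (mul_star_of_normSq n1) (mul_star_of_normSq n2)
  have hωω' : star ω * ω = 1 := Prod.ext (star_mul_of_normSq n1) (star_mul_of_normSq n2)
  have hstar : star ω = ω ^ 2 := by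
    have e : ∀ w : ℍ[ℝ], normSq w = 1 → 2 * w.re = -1 → star w = w ^ 2 := fun w hw hw' => by
      rw [sq, mul_self_eq hw, hw', star_eq_two_re_sub, hw']
      ext <;> simp
      ring
    exact Prod.ext (e _ n1 hω1) (e _ n2 hω2)
  have key : ∀ x ∈ S, ∀ u v : ℤ, 2 * x.1.re = u → 2 * (x.1 * ω.1).re = v →
      u ^ 2 + u * v + v ^ 2 = 3 → ∃ k : ℕ, x = ω ^ k ∨ x = -ω ^ k := by
    intro x hx u v hu hv hN
    have hxω := h.mul_mem x hx ω hω
    have hxω' := h.mul_mem x hx _ (h.star_mem ω hω)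
    have hw : 2 * (x.1 * star ω.1).re = (-u - v : ℤ) := by
      have e := re_mul_add_re_mul_star x.1 ω.1
      push_cast
      rw [← hu, ← hv]
      linear_combination 2 * e + 2 * x.1.re * hω1
    -- The vectors of norm 3 in the hexagonal form: one of u, v, -u - v is ±2, so one of x, xω, xω*
    -- is ±1.
    have : u = 2 ∨ u = -2 ∨ v = 2 ∨ v = -2 ∨ -u - v = 2 ∨ -u - v = -2 := by
      have h1 : u ≤ 2 := by nlinarith [sq_nonneg (u + 2 * v)]
      have h2 : -2 ≤ u := by nlinarith [sq_nonneg (u + 2 * v)]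
      have h3 : v ≤ 2 := by nlinarith [sq_nonneg (2 * u + v)]
      have h4 : -2 ≤ v := by nlinarith [sq_nonneg (2 * u + v)]
      interval_cases u <;> interval_cases v <;> omega
    have neg : ∀ y ∈ S, 2 * y.1.re = -2 → y = -1 := fun y hy e => by
      rw [← hone (-y) (h.neg_mem y hy) (by simp; linarith), neg_neg]
    have a1 : ∀ z, x * ω = z → x = z * ω ^ 2 := fun z hz => by
      rw [← hz, mul_assoc, ← hstar, hωω, mul_one]
    have a2 : ∀ z, x * star ω = z → x = z * ω := fun z hz => by
      rw [← hz, mul_assoc, hωω', mul_one]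
    rcases this with rfl | rfl | rfl | rfl | e | e
    · exact ⟨0, Or.inl (by rw [pow_zero]; exact hone x hx (by simpa using hu))⟩
    · exact ⟨0, Or.inr (by rw [pow_zero]; exact neg x hx (by simpa using hu))⟩
    · exact ⟨2, Or.inl (by rw [a1 _ (hone _ hxω (by simpa using hv)), one_mul])⟩
    · exact ⟨2, Or.inr (by rw [a1 _ (neg _ hxω (by simpa using hv)), neg_one_mul])⟩
    · rw [e] at hw
      exact ⟨1, Or.inl (by rw [a2 _ (hone _ hxω' (by simpa using hw)), one_mul, pow_one])⟩
    · rw [e] at hw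
      exact ⟨1, Or.inr (by rw [a2 _ (neg _ hxω' (by simpa using hw)), neg_one_mul, pow_one])⟩
  refine isE8Embeddable_of_bihexagonal hF₁ hF₂ eZ1 eZ2 fun x hx => ?_
  have hxJ := h.mul_mem x hx _ (h.star_mem J hJ)
  obtain ⟨u, hu, -⟩ := hT x hx
  obtain ⟨v, hv, -⟩ := hT _ (h.mul_mem x hx ω hω)
  obtain ⟨u', hu', -⟩ := hT _ hxJ
  obtain ⟨v', hv', -⟩ := hT _ (h.mul_mem _ hxJ ω hω)
  have hN := hF₁.cubeRoot_norm eZ1 (h.normSq₁ x hx) hu hv hu' hv'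
  have hN' : (u ^ 2 + u * v + v ^ 2) + (u' ^ 2 + u' * v' + v' ^ 2) = 3 := by exact_mod_cast hN
  have hcases : u ^ 2 + u * v + v ^ 2 = 3 ∨ u' ^ 2 + u' * v' + v' ^ 2 = 3 := by
    have h1 : u ≤ 2 := by nlinarith [sq_nonneg (u + 2 * v), sq_nonneg (2 * u' + v'), sq_nonneg v']
    have h2 : -2 ≤ u := by nlinarith [sq_nonneg (u + 2 * v), sq_nonneg (2 * u' + v'), sq_nonneg v']
    have h3 : v ≤ 2 := by nlinarith [sq_nonneg (2 * u + v), sq_nonneg (2 * u' + v'), sq_nonneg v']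
    have h4 : -2 ≤ v := by nlinarith [sq_nonneg (2 * u + v), sq_nonneg (2 * u' + v'), sq_nonneg v']
    have h1' : u' ≤ 2 := by nlinarith [sq_nonneg (u' + 2 * v'), sq_nonneg (2 * u + v), sq_nonneg v]
    have h2' : -2 ≤ u' := by nlinarith [sq_nonneg (u' + 2 * v'), sq_nonneg (2 * u + v), sq_nonneg v]
    have h3' : v' ≤ 2 := by nlinarith [sq_nonneg (2 * u' + v'), sq_nonneg (2 * u + v), sq_nonneg v]
    have h4' : -2 ≤ v' := by nlinarith [sq_nonneg (2 * u' + v'), sq_nonneg (2 * u + v), sq_nonneg v]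
    clear hu hv hu' hv' hN hxJ
    have : ∀ u ∈ Finset.Icc (-2 : ℤ) 2, ∀ v ∈ Finset.Icc (-2 : ℤ) 2, u ^ 2 + u * v + v ^ 2 ≠ 2 := by
      decide +kernel
    have i1 := this u (Finset.mem_Icc.2 ⟨h2, h1⟩) v (Finset.mem_Icc.2 ⟨h4, h3⟩)
    have i2 := this u' (Finset.mem_Icc.2 ⟨h2', h1'⟩) v' (Finset.mem_Icc.2 ⟨h4', h3'⟩)
    have j1 : 0 ≤ u ^ 2 + u * v + v ^ 2 := by nlinarith [sq_nonneg (2 * u + v), sq_nonneg v]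
    have j2 : 0 ≤ u' ^ 2 + u' * v' + v' ^ 2 := by nlinarith [sq_nonneg (2 * u' + v'), sq_nonneg v']
    omega
  rcases hcases with e | e
  · obtain ⟨k, rfl | rfl⟩ := key x hx u v hu hv e
    · exact ⟨k, k, Or.inl rfl⟩
    · exact ⟨k, k, Or.inr (Or.inl rfl)⟩
  · have hJJ : star J * J = 1 := Prod.ext (star_mul_of_normSq (h.normSq₁ J hJ))
      (star_mul_of_normSq (h.normSq₂ J hJ))
    have hx' : x = x * star J * J := by rw [mul_assoc, hJJ, mul_one]
    obtain ⟨k, e' | e'⟩ := key _ hxJ u' v' hu' hv' e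
    · exact ⟨k, k, Or.inr (Or.inr (Or.inl (by rw [hx', e']; rfl)))⟩
    · exact ⟨k, k, Or.inr (Or.inr (Or.inr (by rw [hx', e', neg_mul]; rfl)))⟩

end IsAdmissible

/-! ### A cube root of unity on one side, and the case division. -/

namespace IsAdmissible

open Quaternion

variable {S : Set (ℍ[ℝ] × ℍ[ℝ])}

/-- Multiplying c by g and g* leaves the right trace unchanged, while the three left traces sum to
zero. Hence three times the right trace is an integer, which rules out surds, and `eq_or` applied to
c, cg, cg* leaves the listed cases. -/
theorem cubeRoot_cases (h : IsAdmissible S) (hC : ((-1, 1) : ℍ[ℝ] × ℍ[ℝ]) ∉ S) {g : ℍ[ℝ] × ℍ[ℝ]}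
    (hg : g ∈ S) (hg1 : 2 * g.1.re = -1) (hg2 : g.2 = 1) {c : ℍ[ℝ] × ℍ[ℝ]} (hc : c ∈ S) :
    (c.1.re = 0 ∧ (c.1 * g.1).re = 0 ∧ c.2.re = 0) ∨
      (∃ k : ℕ, c.1 = g.1 ^ k ∧ (2 * c.2.re = 2 ∨ 2 * c.2.re = -1)) ∨
      ∃ k : ℕ, c.1 = -g.1 ^ k ∧ (2 * c.2.re = -2 ∨ 2 * c.2.re = 1) := by
  have ng := h.normSq₁ g hg
  have hcg := h.mul_mem c hc g hg
  have hcs := h.mul_mem c hc _ (h.star_mem g hg)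
  have r1 : (c * g).2.re = c.2.re := by rw [Prod.snd_mul, hg2, mul_one]
  have r2 : (c * star g).2.re = c.2.re := by rw [Prod.snd_mul, Prod.snd_star, hg2, star_one, mul_one]
  have hsum : 2 * c.1.re + 2 * (c * g).1.re + 2 * (c * star g).1.re = 0 := by
    have e := re_mul_add_re_mul_star c.1 g.1
    simp only [Prod.fst_mul, Prod.fst_star]
    linear_combination 2 * e + 2 * c.1.re * hg1
  obtain ⟨k0, hk0⟩ := h.add_int c hc
  obtain ⟨k1, hk1⟩ := h.add_int _ hcg
  obtain ⟨k2, hk2⟩ := h.add_int _ hcs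
  rw [r1] at hk1
  rw [r2] at hk2
  have hirr : ∀ r : ℝ, Irrational r → ∀ ε : ℤ, (ε = 1 ∨ ε = -1) → 2 * c.2.re = ε * r → False := by
    intro r hr ε hε hs
    have := hr.int_add_mul_inj (a := k0 + k1 + k2) (b := 0) (c := 0) (d := 3 * ε) (by
      push_cast; rw [← hk0, ← hk1, ← hk2]; linear_combination hsum + 3 * hs)
    omega
  obtain ⟨b, hb⟩ : ∃ b : ℤ, 2 * c.2.re = b := by
    rcases h.trace_cases hc with ⟨a, b, -, hb⟩ | ⟨ε, hε, ⟨-, hs⟩ | ⟨-, hs⟩ | ⟨-, hs⟩ | ⟨-, hs⟩⟩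
    · exact ⟨b, hb⟩
    · exact (hirr _ irrational_sqrt_two.neg ε hε hs).elim
    · exact (hirr _ irrational_sqrt_three.neg ε hε hs).elim
    · exact (hirr _ Real.goldenConj_irrational ε hε hs).elim
    · exact (hirr _ Real.goldenRatio_irrational ε hε hs).elim
  have a0 : 2 * c.1.re = (k0 - b : ℤ) := by push_cast; linarith
  have a1 : 2 * (c * g).1.re = (k1 - b : ℤ) := by push_cast; linarith
  have a2 : 2 * (c * star g).1.re = (k2 - b : ℤ) := by push_cast; linarith
  have c0 := h.eq_or hC hc a0 hb
  have c1 := h.eq_or hC hcg a1 (by rw [r1, hb])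
  have c2 := h.eq_or hC hcs a2 (by rw [r2, hb])
  have hsum' : (k0 - b) + (k1 - b) + (k2 - b) = 0 := by
    rw [a0, a1, a2] at hsum; exact_mod_cast hsum
  have hstar : star g.1 = g.1 ^ 2 := by
    rw [sq, mul_self_eq ng, hg1, star_eq_two_re_sub, hg1]
    ext <;> simp
    ring
  have e1 : ∀ z, c.1 * g.1 = z → c.1 = z * g.1 ^ 2 := fun z hz => by
    rw [← hz, mul_assoc, ← hstar, mul_star_of_normSq ng, mul_one]
  have e2 : ∀ z, c.1 * star g.1 = z → c.1 = z * g.1 := fun z hz => by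
    rw [← hz, mul_assoc, star_mul_of_normSq ng, mul_one]
  by_cases hb0 : b = 0
  · left
    have h0 : k0 - b = 0 := by omega
    have h1 : k1 - b = 0 := by omega
    rw [h0] at a0
    rw [h1] at a1
    rw [hb0] at hb
    exact ⟨by simpa using a0, by simpa using a1, by simpa using hb⟩
  have hcases : ((k0 - b = 2 ∨ k1 - b = 2 ∨ k2 - b = 2) ∧ (b = 2 ∨ b = -1)) ∨
      ((k0 - b = -2 ∨ k1 - b = -2 ∨ k2 - b = -2) ∧ (b = -2 ∨ b = 1)) := by omega
  right
  rcases hcases with ⟨hk, hb'⟩ | ⟨hk, hb'⟩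
  · left
    have hb'' : 2 * c.2.re = 2 ∨ 2 * c.2.re = -1 := by
      rw [hb]; exact_mod_cast hb'
    rcases hk with e | e | e
    · rw [e] at a0
      exact ⟨0, by rw [pow_zero]; exact h.eq_one₁ hc (by simpa using a0), hb''⟩
    · rw [e] at a1
      exact ⟨2, by rw [e1 _ (h.eq_one₁ hcg (by exact_mod_cast a1)), one_mul], hb''⟩
    · rw [e] at a2
      exact ⟨1, by rw [e2 _ (h.eq_one₁ hcs (by exact_mod_cast a2)), one_mul, pow_one], hb''⟩
  · right
    have hb'' : 2 * c.2.re = -2 ∨ 2 * c.2.re = 1 := by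
      rw [hb]; exact_mod_cast hb'
    rcases hk with e | e | e
    · rw [e] at a0
      exact ⟨0, by rw [pow_zero]; exact h.eq_neg_one₁ hc (by simpa using a0), hb''⟩
    · rw [e] at a1
      exact ⟨2, by rw [e1 _ (h.eq_neg_one₁ hcg (by exact_mod_cast a1)), neg_one_mul], hb''⟩
    · rw [e] at a2
      exact ⟨1, by rw [e2 _ (h.eq_neg_one₁ hcs (by exact_mod_cast a2)), neg_one_mul, pow_one], hb''⟩

/-- Up to sign, elements with nonzero right trace are pairs of powers of cube roots of unity. The
others are obtained from these by a single J orthogonal to both axes, so the bihexagonal model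
applies. -/
theorem isE8Embeddable_of_cubeRoot (h : IsAdmissible S) (hC : ((-1, 1) : ℍ[ℝ] × ℍ[ℝ]) ∉ S)
    {g : ℍ[ℝ] × ℍ[ℝ]} (hg : g ∈ S) (hg1 : 2 * g.1.re = -1) (hg2 : g.2 = 1) : IsE8Embeddable S := by
  have ng := h.normSq₁ g hg
  obtain ⟨Z₁, nZ, rZ, eZ⟩ := exists_axis ng hg1
  have h30 : √3 ≠ 0 := by positivity
  have key := fun {c} => h.cubeRoot_cases hC hg hg1 hg2 (c := c)
  have hgsq : g.1 ^ 2 = star g.1 := by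
    rw [sq, mul_self_eq ng, hg1, star_eq_two_re_sub, hg1]
    ext <;> simp
    ring
  have hg3 : g.1 ^ 3 = 1 := by rw [pow_succ, hgsq, star_mul_of_normSq ng]
  have hpow : ∀ k : ℕ, 2 * (g.1 ^ k).re = 2 ∨ 2 * (g.1 ^ k).re = -1 := by
    intro k
    rw [← Nat.div_add_mod k 3, pow_add, pow_mul, hg3, one_pow, one_mul]
    have : k % 3 < 3 := Nat.mod_lt _ (by norm_num)
    interval_cases k % 3
    · left; simp
    · right; rw [pow_one, hg1]
    · right; rw [hgsq, re_star, hg1]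
  have orthZ : ∀ c : ℍ[ℝ], c.re = 0 → (c * g.1).re = 0 → (c * Z₁).re = 0 := fun c h1 h2 => by
    have := sqrt_three_mul_re eZ c
    rw [h1, h2] at this
    simpa [h30] using this
  -- the powers of the cube root on the second side
  have hD : ∀ x ∈ S, ∀ y ∈ S, ∀ k l : ℕ, x.1 = g.1 ^ k → y.1 = g.1 ^ l → 2 * x.2.re = -1 →
      2 * y.2.re = 2 ∨ 2 * y.2.re = -1 → ∃ m : ℕ, y.2 = x.2 ^ m := by
    intro x hx y hy k l hxk hyl hx2 hy2
    have nx := h.normSq₂ x hx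
    rcases hy2 with hy2 | hy2
    · exact ⟨0, by rw [pow_zero, h.eq_one₂ hy hy2]⟩
    have hxy := h.mul_mem x hx y hy
    have hxy' := h.mul_mem x hx _ (h.star_mem y hy)
    have aux : ∀ z ∈ S, ∀ m : ℕ, z.1 = g.1 ^ m → 2 * z.2.re = 2 ∨ 2 * z.2.re = -1 := by
      intro z hz m hm
      have hm' := hpow m
      rw [← hm] at hm'
      rcases key hz with ⟨e, -, -⟩ | ⟨-, -, e⟩ | ⟨j, e, -⟩
      · rw [e] at hm'; norm_num at hm'
      · exact e
      · have := hpow j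
        rw [e, re_neg] at hm'
        rcases hm' with hm' | hm' <;> rcases this with this | this <;> linarith
    have b1 := aux _ hxy (k + l) (by rw [Prod.fst_mul, hxk, hyl, pow_add])
    have b2 := aux _ hxy' (k + 2 * l) (by
      rw [Prod.fst_mul, Prod.fst_star, hxk, hyl, star_pow, ← hgsq, ← pow_mul, ← pow_add])
    have e := re_mul_add_re_mul_star x.2 y.2
    simp only [Prod.snd_mul, Prod.snd_star] at b1 b2
    have e' : 2 * (x.2 * y.2).re + 2 * (x.2 * star y.2).re = 1 := by
      linear_combination 2 * e + 2 * y.2.re * hx2 - hy2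
    have hxsq : x.2 ^ 2 = star x.2 := by
      rw [sq, mul_self_eq nx, hx2, star_eq_two_re_sub, hx2]
      ext <;> simp
      ring
    rcases b1 with b1 | b1
    · refine ⟨2, ?_⟩
      have e1 : x.2 * y.2 = 1 := h.eq_one₂ hxy b1
      rw [hxsq, ← mul_one (star x.2), ← e1, ← mul_assoc, star_mul_of_normSq nx, one_mul]
    · refine ⟨1, ?_⟩
      have e1 : x.2 * star y.2 = 1 := h.eq_one₂ hxy' (by
        simp only [Prod.snd_mul, Prod.snd_star]; linarith)
      rw [pow_one, ← mul_one x.2, ← star_mul_of_normSq (h.normSq₂ y hy), ← mul_assoc, e1, one_mul]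
  -- The root ω₂ comes from an element whose left part is a power of `g.1` and whose right trace is
  -- -1, and J from an element with pure right part. Whatever S does not supply is chosen freely.
  obtain ⟨ω₂, Z₂, J₁, J₂, hF₁, hF₂, eZ₂, hω₂, hJ⟩ : ∃ ω₂ Z₂ J₁ J₂ : ℍ[ℝ], IsFrame Z₁ J₁ ∧
      IsFrame Z₂ J₂ ∧ (2 : ℝ) • ω₂ = √3 • Z₂ - 1 ∧
      (∀ y ∈ S, ∀ l : ℕ, y.1 = g.1 ^ l → 2 * y.2.re = 2 ∨ 2 * y.2.re = -1 → ∃ m : ℕ, y.2 = ω₂ ^ m) ∧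
      (((J₁, J₂) : ℍ[ℝ] × ℍ[ℝ]) ∈ S ∨ ∀ c ∈ S, c.2.re ≠ 0) := by
    by_cases hω : ∃ x ∈ S, (∃ k : ℕ, x.1 = g.1 ^ k) ∧ 2 * x.2.re = -1
    · obtain ⟨x, hx, ⟨k, hk⟩, hx2⟩ := hω
      obtain ⟨Z₂, nZ₂, rZ₂, eZ₂⟩ := exists_axis (h.normSq₂ x hx) hx2
      by_cases hJ : ∃ J ∈ S, J.2.re = 0
      · obtain ⟨J, hJS, hJ2⟩ := hJ
        have hJ0 : J.1.re = 0 ∧ (J.1 * g.1).re = 0 := by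
          rcases key hJS with ⟨e1, e2, -⟩ | ⟨-, -, e⟩ | ⟨-, -, e⟩
          · exact ⟨e1, e2⟩
          all_goals rw [hJ2] at e; norm_num at e
        -- Otherwise the left part of Jx, and with it that of J, is ± a power of `g.1`, whose trace
        -- is not zero.
        have hJx : (J.2 * x.2).re = 0 := by
          have hz := h.mul_mem J hJS x hx
          have e0 : J.1 = J.1 * x.1 * g.1 ^ (2 * k) := by
            rw [hk, mul_assoc, ← pow_add, show k + 2 * k = 3 * k by ring, pow_mul, hg3, one_pow, mul_one]
          rcases key hz with ⟨-, -, e⟩ | ⟨j, e, -⟩ | ⟨j, e, -⟩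
          · exact e
          · rw [Prod.fst_mul] at e
            rw [e, ← pow_add] at e0
            have := hpow (j + 2 * k)
            rw [← e0, hJ0.1] at this
            norm_num at this
          · rw [Prod.fst_mul] at e
            rw [e, neg_mul, ← pow_add] at e0
            have := hpow (j + 2 * k)
            rw [← neg_neg (g.1 ^ (j + 2 * k)), ← e0, re_neg, hJ0.1] at this
            norm_num at this
        refine ⟨x.2, Z₂, J.1, J.2, ⟨nZ, h.normSq₁ J hJS, rZ, hJ0.1, ?_⟩,
          ⟨nZ₂, h.normSq₂ J hJS, rZ₂, hJ2, ?_⟩, eZ₂, fun y hy l hl hy2 => hD x hx y hy k l hk hl hx2 hy2,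
          Or.inl hJS⟩
        · rw [re_mul_comm]; exact orthZ _ hJ0.1 hJ0.2
        · have := sqrt_three_mul_re eZ₂ J.2
          rw [hJx, hJ2] at this
          rw [re_mul_comm]
          simpa [h30] using this
      · obtain ⟨J₁, hF₁⟩ := exists_isFrame nZ rZ
        obtain ⟨J₂, hF₂⟩ := exists_isFrame nZ₂ rZ₂
        exact ⟨x.2, Z₂, J₁, J₂, hF₁, hF₂, eZ₂, fun y hy l hl hy2 => hD x hx y hy k l hk hl hx2 hy2,
          Or.inr fun c hc e => hJ ⟨c, hc, e⟩⟩
    · have hω' : ∀ y ∈ S, ∀ l : ℕ, y.1 = g.1 ^ l → 2 * y.2.re = 2 ∨ 2 * y.2.re = -1 → ∀ ω : ℍ[ℝ],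
          ∃ m : ℕ, y.2 = ω ^ m := by
        rintro y hy l hl (e | e) ω
        · exact ⟨0, by rw [pow_zero, h.eq_one₂ hy e]⟩
        · exact (hω ⟨y, hy, ⟨l, hl⟩, e⟩).elim
      have half : ∀ Z : ℍ[ℝ], (2 : ℝ) • ((1 / 2 : ℝ) • (√3 • Z - 1)) = √3 • Z - 1 := fun Z => by
        rw [smul_smul]; norm_num
      by_cases hJ : ∃ J ∈ S, J.2.re = 0
      · obtain ⟨J, hJS, hJ2⟩ := hJ
        have hJ0 : J.1.re = 0 ∧ (J.1 * g.1).re = 0 := by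
          rcases key hJS with ⟨e1, e2, -⟩ | ⟨-, -, e⟩ | ⟨-, -, e⟩
          · exact ⟨e1, e2⟩
          all_goals rw [hJ2] at e; norm_num at e
        obtain ⟨Z₂, f1, f2, f3, f4, f5⟩ := exists_isFrame (h.normSq₂ J hJS) hJ2
        refine ⟨_, Z₂, J.1, J.2, ⟨nZ, h.normSq₁ J hJS, rZ, hJ0.1, ?_⟩,
          ⟨f2, f1, f4, f3, by rw [re_mul_comm, f5]⟩, half Z₂, fun y hy l hl hy2 => hω' y hy l hl hy2 _,
          Or.inl hJS⟩
        rw [re_mul_comm]; exact orthZ _ hJ0.1 hJ0.2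
      · obtain ⟨J₁, hF₁⟩ := exists_isFrame nZ rZ
        obtain ⟨J₂, hF₂⟩ := exists_isFrame nZ rZ
        exact ⟨_, Z₁, J₁, J₂, hF₁, hF₂, half Z₁, fun y hy l hl hy2 => hω' y hy l hl hy2 _,
          Or.inr fun c hc e => hJ ⟨c, hc, e⟩⟩
  have main : ∀ x ∈ S, x.2.re ≠ 0 → ∃ k l : ℕ, x = (g.1 ^ k, ω₂ ^ l) ∨ x = -(g.1 ^ k, ω₂ ^ l) := by
    intro x hx hx0
    rcases key hx with ⟨-, -, e⟩ | ⟨k, e, e'⟩ | ⟨k, e, e'⟩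
    · exact (hx0 e).elim
    · obtain ⟨l, hl⟩ := hω₂ x hx k e e'
      exact ⟨k, l, Or.inl (Prod.ext e hl)⟩
    · obtain ⟨l, hl⟩ := hω₂ (-x) (h.neg_mem x hx) k (by rw [Prod.fst_neg, e, neg_neg])
        (by rw [Prod.snd_neg, re_neg]; rcases e' with e' | e' <;> [left; right] <;> linarith)
      exact ⟨k, l, Or.inr (Prod.ext e (by rw [Prod.snd_neg, ← hl, Prod.snd_neg, neg_neg]))⟩
  refine isE8Embeddable_of_bihexagonal hF₁ hF₂ eZ eZ₂ fun x hx => ?_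
  by_cases hx0 : x.2.re = 0
  swap
  · obtain ⟨k, l, e | e⟩ := main x hx hx0
    · exact ⟨k, l, Or.inl e⟩
    · exact ⟨k, l, Or.inr (Or.inl e)⟩
  · have hJS := hJ.resolve_right fun H => H x hx hx0
    have hxJ := h.mul_mem x hx _ (h.star_mem _ hJS)
    have hJJ : star ((J₁, J₂) : ℍ[ℝ] × ℍ[ℝ]) * (J₁, J₂) = 1 :=
      Prod.ext (star_mul_of_normSq hF₁.normSq₂) (star_mul_of_normSq hF₂.normSq₂)
    have hx' : x = x * star (J₁, J₂) * (J₁, J₂) := by rw [mul_assoc, hJJ, mul_one]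
    -- If the right traces of x and xJ* both vanished, the left part of x would be orthogonal to the
    -- whole frame (Z₁, J₁), against its norm.
    have hne : (x * star (J₁, J₂)).2.re ≠ 0 := fun e0 => by
      have hx1 : x.1.re = 0 ∧ (x.1 * g.1).re = 0 := by
        rcases key hx with ⟨e1, e2, -⟩ | ⟨-, -, e⟩ | ⟨-, -, e⟩
        · exact ⟨e1, e2⟩
        all_goals rw [hx0] at e; norm_num at e
      have hx2 : (x.1 * star J₁).re = 0 ∧ (x.1 * star J₁ * g.1).re = 0 := by
        rcases key hxJ with ⟨e1, e2, -⟩ | ⟨-, -, e⟩ | ⟨-, -, e⟩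
        · exact ⟨e1, e2⟩
        all_goals rw [e0] at e; norm_num at e
      have hP := hF₁.parseval x.1
      rw [star_mul, star_eq_neg.2 rZ, ← mul_assoc, mul_neg, mul_neg, re_neg, re_neg,
        orthZ _ hx1.1 hx1.2, orthZ _ hx2.1 hx2.2, hx1.1, hx2.1, h.normSq₁ x hx] at hP
      norm_num at hP
    obtain ⟨k, l, e | e⟩ := main _ hxJ hne
    · exact ⟨k, l, Or.inr (Or.inr (Or.inl (by rw [hx', e])))⟩
    · exact ⟨k, l, Or.inr (Or.inr (Or.inr (by rw [hx', e, neg_mul])))⟩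

/-- Excludes two different surds in one group: tr x tr y summed over both sides is an integer, but
would be ±2√6, ±√10 or ±√15. -/
theorem irrational_case (h : IsAdmissible S) {x y : ℍ[ℝ] × ℍ[ℝ]} (hx : x ∈ S) (hy : y ∈ S) {n : ℤ}
    (hn : n = 24 ∨ n = 10 ∨ n = 15) (he : (2 * x.1.re * (2 * y.1.re) + 2 * x.2.re * (2 * y.2.re)) ^ 2 = n) :
    False := by
  obtain ⟨m, hm⟩ := h.mul_add_mul_int hx hy
  rw [hm] at he
  have he' : m ^ 2 = n := by exact_mod_cast he
  have h1 : m ≤ 4 := by rcases hn with rfl | rfl | rfl <;> nlinarith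
  have h2 : -4 ≤ m := by rcases hn with rfl | rfl | rfl <;> nlinarith
  rcases hn with rfl | rfl | rfl <;> interval_cases m <;> omega

theorem bound {x : ℍ[ℝ] × ℍ[ℝ]} (h : IsAdmissible S) (hx : x ∈ S) {n : ℤ} (hn : 2 * x.1.re = n) :
    -2 ≤ n ∧ n ≤ 2 := by
  have h1 := abs_le.1 (h.abs_le₁ hx)
  rw [hn] at h1
  exact ⟨by exact_mod_cast h1.1, by exact_mod_cast h1.2⟩

theorem isE8Embeddable_of_golden' (h : IsAdmissible S)
    (hG : ∀ y ∈ S, (∃ n : ℤ, 2 * y.1.re = n ∧ 2 * y.2.re = n) ∨ ∃ ε : ℤ, (ε = 1 ∨ ε = -1) ∧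
      ((2 * y.1.re = ε * Real.goldenRatio ∧ 2 * y.2.re = ε * Real.goldenConj) ∨
        (2 * y.1.re = ε * Real.goldenConj ∧ 2 * y.2.re = ε * Real.goldenRatio)))
    {a : ℍ[ℝ] × ℍ[ℝ]} (ha : a ∈ S) (h1 : 2 * a.1.re = Real.goldenRatio)
    (h2 : 2 * a.2.re = Real.goldenConj) : IsE8Embeddable S := by
  refine h.isE8Embeddable_of_golden (fun y hy => ?_) ha ⟨by simp [h1], by simp [h2]⟩
  have hs := Real.goldenRatio_add_goldenConj
  rcases hG y hy with ⟨n, e1, e2⟩ | ⟨ε, hε, ⟨e1, e2⟩ | ⟨e1, e2⟩⟩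
  · have hb := h.bound hy e1
    refine ⟨n, 0, ⟨by simp [e1], by simp [e2]⟩, ?_⟩
    obtain ⟨b1, b2⟩ := hb
    clear e1 e2
    interval_cases n <;> decide
  · refine ⟨0, ε, ⟨by simp [e1], by simp [e2]⟩, ?_⟩
    rcases hε with rfl | rfl <;> decide
  · refine ⟨ε, -ε, ⟨?_, ?_⟩, ?_⟩
    · rw [e1]; push_cast; linear_combination ε * hs
    · rw [e2]; push_cast; linear_combination ε * hs
    · rcases hε with rfl | rfl <;> decide

theorem isE8Embeddable_of_int (h : IsAdmissible S)
    (hT : ∀ x ∈ S, ∃ n : ℤ, 2 * x.1.re = n ∧ 2 * x.2.re = n) : IsE8Embeddable S := by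
  have tr : ∀ x ∈ S, x.1.re = x.2.re := fun x hx => by
    obtain ⟨n, h1, h2⟩ := hT x hx; linarith
  by_cases hd : ∃ ω ∈ S, ∃ J ∈ S, 2 * ω.1.re = -1 ∧ J.1.re = 0 ∧ (ω.1 * J.1).re = 0
  · obtain ⟨ω, hω, J, hJ, h1, h2, h3⟩ := hd
    exact h.isE8Embeddable_of_dicyclic hT hω hJ h1 h2 h3
  refine h.isE8Embeddable_of_even ⟨?_, ?_, ?_, ?_, ?_, ?_⟩ ⟨?_, ?_, ?_, ?_, ?_, ?_⟩ ?_
  · rintro _ ⟨x, hx, rfl⟩ _ ⟨y, hy, rfl⟩; exact ⟨_, h.mul_mem x hx y hy, rfl⟩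
  · rintro _ ⟨x, hx, rfl⟩; exact ⟨_, h.star_mem x hx, rfl⟩
  · rintro _ ⟨x, hx, rfl⟩; exact ⟨_, h.neg_mem x hx, rfl⟩
  · rintro _ ⟨x, hx, rfl⟩; exact h.normSq₁ x hx
  · rintro _ ⟨x, hx, rfl⟩
    obtain ⟨n, hn, -⟩ := hT x hx
    exact ⟨n, hn⟩
  · rintro _ ⟨x, hx, rfl⟩ _ ⟨y, hy, rfl⟩ h1 h2 h3
    exact hd ⟨x, hx, y, hy, h1, h2, h3⟩
  · rintro _ ⟨x, hx, rfl⟩ _ ⟨y, hy, rfl⟩; exact ⟨_, h.mul_mem x hx y hy, rfl⟩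
  · rintro _ ⟨x, hx, rfl⟩; exact ⟨_, h.star_mem x hx, rfl⟩
  · rintro _ ⟨x, hx, rfl⟩; exact ⟨_, h.neg_mem x hx, rfl⟩
  · rintro _ ⟨x, hx, rfl⟩; exact h.normSq₂ x hx
  · rintro _ ⟨x, hx, rfl⟩
    obtain ⟨n, -, hn⟩ := hT x hx
    exact ⟨n, hn⟩
  · rintro _ ⟨x, hx, rfl⟩ _ ⟨y, hy, rfl⟩ h1 h2 h3
    exact hd ⟨x, hx, y, hy, by rw [tr x hx, h1], by rw [tr y hy, h2],
      (tr _ (h.mul_mem x hx y hy)).trans h3⟩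
  · intro x hx a b ha hb
    have : (a : ℝ) = b := by rw [← ha, ← hb, tr x hx]
    have : a = b := by exact_mod_cast this
    simp [this]

/-- Multiplication by (-1, 1) changes the sign of the left trace alone, so twice each left trace is
an integer and no surd occurs. Comparing x with (-1, 1) x also removes the exceptional pairs of
`even_sub_or`. -/
theorem isE8Embeddable_of_neg_one_mem (h : IsAdmissible S) (hC : ((-1, 1) : ℍ[ℝ] × ℍ[ℝ]) ∈ S) :
    IsE8Embeddable S := by
  have hint : ∀ x ∈ S, ∃ a b : ℤ, 2 * x.1.re = a ∧ 2 * x.2.re = b := by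
    intro x hx
    have hx' := h.mul_mem _ hC x hx
    obtain ⟨m, hm⟩ := h.add_int x hx
    obtain ⟨n, hn⟩ := h.add_int _ hx'
    simp only [Prod.fst_mul, Prod.snd_mul, neg_mul, one_mul, re_neg] at hn
    have key : ∀ r : ℝ, Irrational r → ∀ ε : ℤ, (ε = 1 ∨ ε = -1) → 2 * x.1.re = ε * r → False := by
      intro r hr ε hε hs
      have := hr.int_add_mul_inj (a := m - n) (b := 0) (c := 0) (d := 2 * ε) (by
        push_cast; rw [← hm, ← hn]; linear_combination 2 * hs)
      omega
    rcases h.trace_cases hx with H | ⟨ε, hε, ⟨hs, -⟩ | ⟨hs, -⟩ | ⟨hs, -⟩ | ⟨hs, -⟩⟩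
    · exact H
    · exact (key _ irrational_sqrt_two ε hε hs).elim
    · exact (key _ irrational_sqrt_three ε hε hs).elim
    · exact (key _ Real.goldenRatio_irrational ε hε hs).elim
    · exact (key _ Real.goldenConj_irrational ε hε hs).elim
  refine h.isE8Embeddable_of_even ⟨?_, ?_, ?_, ?_, ?_, ?_⟩ ⟨?_, ?_, ?_, ?_, ?_, ?_⟩ ?_
  · rintro _ ⟨x, hx, rfl⟩ _ ⟨y, hy, rfl⟩; exact ⟨_, h.mul_mem x hx y hy, rfl⟩
  · rintro _ ⟨x, hx, rfl⟩; exact ⟨_, h.star_mem x hx, rfl⟩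
  · rintro _ ⟨x, hx, rfl⟩; exact ⟨_, h.neg_mem x hx, rfl⟩
  · rintro _ ⟨x, hx, rfl⟩; exact h.normSq₁ x hx
  · rintro _ ⟨x, hx, rfl⟩
    obtain ⟨a, b, ha, -⟩ := hint x hx
    exact ⟨a, ha⟩
  · rintro _ ⟨x, hx, rfl⟩ _ ⟨y, hy, rfl⟩ h1 h2 h3
    exact h.not_dicyclic₁ hC x hx y hy h1 h2 h3
  · rintro _ ⟨x, hx, rfl⟩ _ ⟨y, hy, rfl⟩; exact ⟨_, h.mul_mem x hx y hy, rfl⟩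
  · rintro _ ⟨x, hx, rfl⟩; exact ⟨_, h.star_mem x hx, rfl⟩
  · rintro _ ⟨x, hx, rfl⟩; exact ⟨_, h.neg_mem x hx, rfl⟩
  · rintro _ ⟨x, hx, rfl⟩; exact h.normSq₂ x hx
  · rintro _ ⟨x, hx, rfl⟩
    obtain ⟨a, b, -, hb⟩ := hint x hx
    exact ⟨b, hb⟩
  · rintro _ ⟨x, hx, rfl⟩ _ ⟨y, hy, rfl⟩ h1 h2 h3
    exact h.not_dicyclic₂ hC x hx y hy h1 h2 h3
  · intro x hx a b ha hb
    have c1 := h.even_sub_or hx ha hb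
    have c2 := h.even_sub_or (h.mul_mem _ hC x hx) (a := -a) (b := b) (by simp [ha]) (by simpa using hb)
    omega

/-- An admissible group of pairs of unit quaternions acts faithfully on the `E₈` lattice. -/
theorem isE8Embeddable (h : IsAdmissible S) : IsE8Embeddable S := by
  by_cases hC : ((-1, 1) : ℍ[ℝ] × ℍ[ℝ]) ∈ S
  · exact h.isE8Embeddable_of_neg_one_mem hC
  by_cases hB : ∃ g ∈ S, 2 * g.1.re = -1 ∧ g.2 = 1
  · obtain ⟨g, hg, h1, h2⟩ := hB
    exact h.isE8Embeddable_of_cubeRoot hC hg h1 h2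
  by_cases hB' : ∃ g ∈ S, g.1 = 1 ∧ 2 * g.2.re = -1
  · obtain ⟨g, hg, h1, h2⟩ := hB'
    exact IsE8Embeddable.of_swap (h.swap.isE8Embeddable_of_cubeRoot
      (fun H => hC (by simpa using h.neg_mem _ H)) (g := g.swap) (by simpa using hg) h2 h1)
  -- The exceptional integral pairs are, up to sign, cube roots of unity acting on one side, which
  -- are now excluded.
  have hA : ∀ y ∈ S, (∃ n : ℤ, 2 * y.1.re = n ∧ 2 * y.2.re = n) ∨ ∃ ε : ℤ, (ε = 1 ∨ ε = -1) ∧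
      ((2 * y.1.re = ε * √2 ∧ 2 * y.2.re = ε * -√2) ∨ (2 * y.1.re = ε * √3 ∧ 2 * y.2.re = ε * -√3) ∨
       (2 * y.1.re = ε * Real.goldenRatio ∧ 2 * y.2.re = ε * Real.goldenConj) ∨
       (2 * y.1.re = ε * Real.goldenConj ∧ 2 * y.2.re = ε * Real.goldenRatio)) := by
    intro y hy
    rcases h.trace_cases hy with ⟨a, b, ha, hb⟩ | H
    swap
    · exact Or.inr H
    have hy' := h.neg_mem y hy
    rcases h.eq_or hC hy ha hb with rfl | ⟨rfl, rfl⟩ | ⟨rfl, rfl⟩ | ⟨rfl, rfl⟩ | ⟨rfl, rfl⟩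
    · exact Or.inl ⟨a, ha, hb⟩
    · exact (hB' ⟨y, hy, h.eq_one₁ hy (by simpa using ha), by simpa using hb⟩).elim
    · exact (hB' ⟨-y, hy', h.eq_one₁ hy' (by simp at ha ⊢; linarith), by simp at hb ⊢; linarith⟩).elim
    · exact (hB ⟨y, hy, by simpa using ha, h.eq_one₂ hy (by simpa using hb)⟩).elim
    · exact (hB ⟨-y, hy', by simp at ha ⊢; linarith, h.eq_one₂ hy' (by simp at hb ⊢; linarith)⟩).elim
  have q2 : √2 ^ 2 = 2 := Real.sq_sqrt (by norm_num)
  have q3 : √3 ^ 2 = 3 := Real.sq_sqrt (by norm_num)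
  have q5 : (Real.goldenRatio - Real.goldenConj) ^ 2 = 5 := by
    rw [Real.goldenRatio_sub_goldenConj]; exact Real.sq_sqrt (by norm_num)
  have hε2 : ∀ ε : ℤ, (ε = 1 ∨ ε = -1) → (ε : ℝ) ^ 2 = 1 := by
    rintro ε (rfl | rfl) <;> norm_num
  have surd : ∀ (r : ℝ) (n : ℤ), -2 ≤ n ∧ n ≤ 2 → ∀ y : ℍ[ℝ] × ℍ[ℝ], 2 * y.1.re = n → 2 * y.2.re = n →
      ∃ p q : ℤ, HasTrace r (-r) p q y ∧ IsSurdCoeff p q := fun r n hn y e1 e2 =>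
    ⟨n, 0, ⟨by simp [e1], by simp [e2]⟩, Or.inl ⟨rfl, hn⟩⟩
  have surd' : ∀ (r : ℝ) (ε : ℤ), (ε = 1 ∨ ε = -1) → ∀ y : ℍ[ℝ] × ℍ[ℝ], 2 * y.1.re = ε * r →
      2 * y.2.re = ε * -r → ∃ p q : ℤ, HasTrace r (-r) p q y ∧ IsSurdCoeff p q :=
    fun r ε hε y e1 e2 => ⟨0, ε, ⟨by simp [e1], by simp [e2]⟩, Or.inr ⟨rfl, hε⟩⟩
  have sign : ∀ r r' : ℝ, (∃ a ∈ S, ∃ ε : ℤ, (ε = 1 ∨ ε = -1) ∧ 2 * a.1.re = ε * r ∧ 2 * a.2.re = ε * r') →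
      ∃ a ∈ S, 2 * a.1.re = r ∧ 2 * a.2.re = r' := by
    rintro r r' ⟨a, ha, ε, rfl | rfl, e1, e2⟩
    · exact ⟨a, ha, by simpa using e1, by simpa using e2⟩
    · exact ⟨-a, h.neg_mem a ha, by simp at e1 ⊢; linarith, by simp at e2 ⊢; linarith⟩
  by_cases h2 : ∃ a ∈ S, ∃ ε : ℤ, (ε = 1 ∨ ε = -1) ∧ 2 * a.1.re = ε * √2 ∧ 2 * a.2.re = ε * -√2
  · obtain ⟨a, ha, a1, a2⟩ := sign _ _ h2
    refine h.isE8Embeddable_of_sqrt_two (fun y hy => ?_) ha ⟨by simp [a1], by simp [a2]⟩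
    rcases hA y hy with ⟨n, e1, e2⟩ | ⟨ε, hε, ⟨e1, e2⟩ | ⟨e1, e2⟩ | ⟨e1, e2⟩ | ⟨e1, e2⟩⟩
    · exact surd _ n (h.bound hy e1) y e1 e2
    · exact surd' _ ε hε y e1 e2
    · refine (h.irrational_case ha hy (n := 24) (by simp) ?_).elim
      rw [a1, a2, e1, e2]; push_cast
      linear_combination 4 * √2 ^ 2 * √3 ^ 2 * hε2 ε hε + 4 * √2 ^ 2 * q3 + 12 * q2
    · refine (h.irrational_case ha hy (n := 10) (by simp) ?_).elim
      rw [a1, a2, e1, e2]; push_cast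
      linear_combination √2 ^ 2 * (Real.goldenRatio - Real.goldenConj) ^ 2 * hε2 ε hε + √2 ^ 2 * q5 + 5 * q2
    · refine (h.irrational_case ha hy (n := 10) (by simp) ?_).elim
      rw [a1, a2, e1, e2]; push_cast
      linear_combination √2 ^ 2 * (Real.goldenRatio - Real.goldenConj) ^ 2 * hε2 ε hε + √2 ^ 2 * q5 + 5 * q2
  by_cases h3 : ∃ a ∈ S, ∃ ε : ℤ, (ε = 1 ∨ ε = -1) ∧ 2 * a.1.re = ε * √3 ∧ 2 * a.2.re = ε * -√3
  · obtain ⟨a, ha, a1, a2⟩ := sign _ _ h3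
    refine h.isE8Embeddable_of_sqrt_three (fun y hy => ?_) ha ⟨by simp [a1], by simp [a2]⟩
    rcases hA y hy with ⟨n, e1, e2⟩ | ⟨ε, hε, ⟨e1, e2⟩ | ⟨e1, e2⟩ | ⟨e1, e2⟩ | ⟨e1, e2⟩⟩
    · exact surd _ n (h.bound hy e1) y e1 e2
    · exact (h2 ⟨y, hy, ε, hε, e1, e2⟩).elim
    · exact surd' _ ε hε y e1 e2
    · refine (h.irrational_case ha hy (n := 15) (by simp) ?_).elim
      rw [a1, a2, e1, e2]; push_cast
      linear_combination √3 ^ 2 * (Real.goldenRatio - Real.goldenConj) ^ 2 * hε2 ε hε + √3 ^ 2 * q5 + 5 * q3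
    · refine (h.irrational_case ha hy (n := 15) (by simp) ?_).elim
      rw [a1, a2, e1, e2]; push_cast
      linear_combination √3 ^ 2 * (Real.goldenRatio - Real.goldenConj) ^ 2 * hε2 ε hε + √3 ^ 2 * q5 + 5 * q3
  have hG : ∀ y ∈ S, (∃ n : ℤ, 2 * y.1.re = n ∧ 2 * y.2.re = n) ∨ ∃ ε : ℤ, (ε = 1 ∨ ε = -1) ∧
      ((2 * y.1.re = ε * Real.goldenRatio ∧ 2 * y.2.re = ε * Real.goldenConj) ∨
        (2 * y.1.re = ε * Real.goldenConj ∧ 2 * y.2.re = ε * Real.goldenRatio)) := by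
    intro y hy
    rcases hA y hy with H | ⟨ε, hε, e | e | e⟩
    · exact Or.inl H
    · exact (h2 ⟨y, hy, ε, hε, e⟩).elim
    · exact (h3 ⟨y, hy, ε, hε, e⟩).elim
    · exact Or.inr ⟨ε, hε, e⟩
  by_cases h5 : ∃ a ∈ S, ∃ ε : ℤ, (ε = 1 ∨ ε = -1) ∧ 2 * a.1.re = ε * Real.goldenRatio ∧
      2 * a.2.re = ε * Real.goldenConj
  · obtain ⟨a, ha, a1, a2⟩ := sign _ _ h5
    exact h.isE8Embeddable_of_golden' hG ha a1 a2
  by_cases h5' : ∃ a ∈ S, ∃ ε : ℤ, (ε = 1 ∨ ε = -1) ∧ 2 * a.1.re = ε * Real.goldenConj ∧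
      2 * a.2.re = ε * Real.goldenRatio
  · obtain ⟨a, ha, a1, a2⟩ := sign _ _ h5'
    refine IsE8Embeddable.of_swap (h.swap.isE8Embeddable_of_golden' (fun y hy => ?_) (a := a.swap)
      (by simpa using ha) a2 a1)
    rcases hG _ hy with ⟨n, e1, e2⟩ | ⟨ε, hε, ⟨e1, e2⟩ | ⟨e1, e2⟩⟩
    · exact Or.inl ⟨n, e2, e1⟩
    · exact Or.inr ⟨ε, hε, Or.inr ⟨e2, e1⟩⟩
    · exact Or.inr ⟨ε, hε, Or.inl ⟨e2, e1⟩⟩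
  refine h.isE8Embeddable_of_int fun y hy => ?_
  rcases hG y hy with H | ⟨ε, hε, e | e⟩
  · exact H
  · exact (h5 ⟨y, hy, ε, hε, e⟩).elim
  · exact (h5' ⟨y, hy, ε, hε, e⟩).elim

end IsAdmissible

/-! ### No even unimodular lattice in Euclidean four-space. -/

section Lattice

open Quaternion

/-- A unimodular lattice that is mapped isometrically to a real vector space with a bilinear form
has linearly independent image. -/
theorem IsEvenUnimodular.linearIndependent {Γ V ι : Type*} [AddCommGroup Γ] [AddCommGroup V]
    [Module ℝ V] [Finite ι] {B : LinearMap.BilinForm ℤ Γ} (hB : IsEvenUnimodular B)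
    (b : Module.Basis ι ℤ Γ) (φ : Γ →ₗ[ℤ] V) (Q : LinearMap.BilinForm ℝ V)
    (h : ∀ x y, Q (φ x) (φ y) = B x y) : LinearIndependent ℝ (φ ∘ b) := by
  have := Fintype.ofFinite ι
  classical
  rw [Fintype.linearIndependent_iff]
  intro c hc j
  obtain ⟨z, hz⟩ := hB.unimodular.2 (b.coord j)
  have h1 := congrArg (Q (φ z)) hc
  simp only [map_sum, map_smul, Function.comp_apply, h, map_zero, hz] at h1
  simpa [Finsupp.single_apply] using h1

/-- The covolume is one, while the ball of radius √2 has volume 2π² > 16 = 2⁴. Minkowski's theorem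
gives a nonzero vector of square length less than 2, impossible in an even lattice. -/
theorem not_isEvenUnimodular_of_euclidean {Γ : Type*} [AddCommGroup Γ] [Module.Free ℤ Γ]
    [Module.Finite ℤ Γ] {B : LinearMap.BilinForm ℤ Γ} (hB : IsEvenUnimodular B)
    (φ : Γ →ₗ[ℤ] EuclideanSpace ℝ (Fin 4)) (h : ∀ x y, inner ℝ (φ x) (φ y) = (B x y : ℝ))
    (hs : Submodule.span ℝ (Set.range φ) = ⊤) : False := by
  classical
  let b := Module.finBasis ℤ Γ
  have hli := hB.linearIndependent b φ (innerₗ _) h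
  have hsp : ⊤ ≤ Submodule.span ℝ (Set.range (φ ∘ b)) := by
    rw [← hs, Submodule.span_le]
    rintro _ ⟨x, rfl⟩
    rw [← b.sum_repr x, map_sum]
    refine Submodule.sum_mem _ fun i _ => ?_
    rw [map_zsmul]
    exact zsmul_mem (Submodule.subset_span (Set.mem_range_self i)) _
  let e : Module.Basis _ ℝ (EuclideanSpace ℝ (Fin 4)) := Module.Basis.mk hli hsp
  have he : ∀ i, e i = φ (b i) := fun i => by simp [e]
  have hcard : Fintype.card (Fin (Module.finrank ℤ Γ)) = Fintype.card (Fin 4) := by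
    rw [← Module.finrank_eq_card_basis e, finrank_euclideanSpace]
  obtain ⟨σ⟩ := Fintype.card_eq.1 hcard
  let b' := b.reindex σ
  let e' := e.reindex σ
  have he' : ∀ i, e' i = φ (b' i) := fun i => by simp [e', b', he]
  let o := EuclideanSpace.basisFun (Fin 4) ℝ
  let M := o.toBasis.toMatrix e'
  have hdet : |M.det| = 1 := by
    choose z hz using fun j => hB.unimodular.2 (b'.coord j)
    let G : Matrix (Fin 4) (Fin 4) ℤ := Matrix.of fun i j => B (b' i) (b' j)
    let C : Matrix (Fin 4) (Fin 4) ℤ := Matrix.of fun i j => b'.repr (z i) j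
    have hCG : C * G = 1 := by
      ext i j
      have h1 : B (z i) (b' j) = b'.coord i (b' j) := by rw [hz]
      rw [← b'.sum_repr (z i)] at h1
      simp only [map_sum, map_zsmul, LinearMap.sum_apply, LinearMap.smul_apply] at h1
      simp only [Matrix.mul_apply, C, G, Matrix.of_apply, Matrix.one_apply]
      simpa [Finsupp.single_apply, eq_comm] using h1
    have hG : Mᵀ * M = G.map (Int.castRingHom ℝ) := by
      ext i j
      simp only [Matrix.mul_apply, Matrix.transpose_apply, Matrix.map_apply, G, Matrix.of_apply]
      rw [eq_intCast, ← h, ← he', ← he']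
      simp [M, Module.Basis.toMatrix_apply, o, PiLp.inner_apply, mul_comm]
    have h2 : M.det ^ 2 = (G.det : ℝ) := by
      have := congrArg Matrix.det hG
      rw [Matrix.det_mul, Matrix.det_transpose] at this
      rw [pow_two, this, ← RingHom.mapMatrix_apply, ← RingHom.map_det]
      rfl
    have h3 : IsUnit G.det := by
      have := congrArg Matrix.det hCG
      rw [Matrix.det_mul, Matrix.det_one] at this
      exact IsUnit.of_mul_eq_one_right _ this
    rcases Int.isUnit_iff.1 h3 with h4 | h4
    · rw [h4] at h2
      rw [Int.cast_one] at h2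
      exact sq_eq_sq₀ (abs_nonneg _) zero_le_one |>.1 (by rw [sq_abs, h2, one_pow])
    · rw [h4] at h2
      push_cast at h2
      nlinarith [sq_nonneg M.det]
  have hvol : MeasureTheory.volume (ZSpan.fundamentalDomain e') = 1 := by
    rw [ZSpan.measure_fundamentalDomain e' MeasureTheory.volume o.toBasis,
      MeasureTheory.measure_congr (ZSpan.fundamentalDomain_ae_parallelepiped _ _),
      o.coe_toBasis, o.volume_parallelepiped, Module.Basis.det_apply, hdet]
    simp
  have hlt : MeasureTheory.volume (ZSpan.fundamentalDomain e') *
      2 ^ Module.finrank ℝ (EuclideanSpace ℝ (Fin 4)) <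
      MeasureTheory.volume (Metric.ball (0 : EuclideanSpace ℝ (Fin 4)) (√2)) := by
    have hpi : (8 : ℝ) < Real.pi ^ 2 := by nlinarith [Real.pi_gt_three]
    rw [hvol, finrank_euclideanSpace,
      InnerProductSpace.volume_ball_of_dim_even (k := 2) (by simp), finrank_euclideanSpace,
      ← ENNReal.ofReal_pow (Real.sqrt_nonneg _), ← ENNReal.ofReal_mul (by positivity)]
    rw [one_mul, ← ENNReal.ofReal_ofNat, ← ENNReal.ofReal_pow (by norm_num)]
    have h4 : √2 ^ 4 = (4 : ℝ) := by
      rw [show (4 : ℕ) = 2 * 2 from rfl, pow_mul, Real.sq_sqrt (by norm_num)]; norm_num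
    refine (ENNReal.ofReal_lt_ofReal_iff (by positivity)).2 ?_
    simp only [Fintype.card_fin, h4, Nat.factorial]
    push_cast
    nlinarith
  have : Countable (Submodule.span ℤ (Set.range e')).toAddSubgroup :=
    inferInstanceAs (Countable (Submodule.span ℤ (Set.range e')))
  obtain ⟨x, hx0, hx⟩ := MeasureTheory.exists_ne_zero_mem_lattice_of_measure_mul_two_pow_lt_measure
    (ZSpan.isAddFundamentalDomain' e' MeasureTheory.volume) (by simp) (convex_ball _ _) hlt
  obtain ⟨k, hk⟩ : ∃ k, φ k = x := by
    obtain ⟨x, hx'⟩ := x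
    have hle : Submodule.span ℤ (Set.range e') ≤ LinearMap.range φ := by
      rw [Submodule.span_le]
      rintro _ ⟨i, rfl⟩
      exact ⟨b' i, (he' i).symm⟩
    exact hle hx'
  have hn : (B k k : ℝ) < 2 := by
    rw [← h, hk, real_inner_self_eq_norm_sq]
    rw [mem_ball_zero_iff] at hx
    have := (Real.lt_sqrt (norm_nonneg _)).1 hx
    exact this
  have hp : (0 : ℝ) < B k k := by
    rw [← h, hk]
    exact real_inner_self_pos.2 (by simpa using hx0)
  obtain ⟨m, hm⟩ := hB.even k
  rw [hm] at hn hp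
  norm_cast at hn hp
  omega

end Lattice

/-! ### Integrality from the two projections of the lattice. -/

section NarainPair

open Quaternion

/-- The two projections of an even unimodular lattice of signature `(4, 4)` to a positive and a
negative definite space, both identified with the quaternions. -/
structure IsNarainPair {Γ : Type*} [AddCommGroup Γ] (B : LinearMap.BilinForm ℤ Γ)
    (l r : Γ →ₗ[ℤ] ℍ[ℝ]) : Prop where
  isEvenUnimodular : IsEvenUnimodular B
  form : ∀ x y, (B x y : ℝ) = inner ℝ (l x) (l y) - inner ℝ (r x) (r y)
  span : Submodule.span ℝ (Set.range (l.prod r)) = ⊤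

theorem IsEvenUnimodular.neg {Γ : Type*} [AddCommGroup Γ] {B : LinearMap.BilinForm ℤ Γ}
    (hB : IsEvenUnimodular B) : IsEvenUnimodular (-B) where
  symm x y := by simp [hB.symm x y]
  even x := by simpa using hB.even x
  unimodular := by
    have : ((-B : LinearMap.BilinForm ℤ Γ) : Γ → Module.Dual ℤ Γ) =
        (Equiv.neg (Module.Dual ℤ Γ)) ∘ (B : Γ →ₗ[ℤ] Module.Dual ℤ Γ) := by
      ext x y; simp
    rw [this]
    exact (Equiv.neg _).bijective.comp hB.unimodular

namespace IsNarainPair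

variable {Γ : Type*} [AddCommGroup Γ] {B : LinearMap.BilinForm ℤ Γ} {l r : Γ →ₗ[ℤ] ℍ[ℝ]}

theorem swap (h : IsNarainPair B l r) : IsNarainPair (-B) r l where
  isEvenUnimodular := h.isEvenUnimodular.neg
  form x y := by simp [h.form x y]
  span := by
    have h1 : Set.range (r.prod l) =
        (LinearEquiv.prodComm ℝ ℍ[ℝ] ℍ[ℝ] : ℍ[ℝ] × ℍ[ℝ] →ₗ[ℝ] _) '' Set.range (l.prod r) := by
      rw [← Set.range_comp]; rfl
    rw [h1, Submodule.span_image, h.span, Submodule.map_top, LinearEquiv.range]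

theorem eq_of_left_eq (h : IsNarainPair B l r) {x y : Γ} (h1 : l x = l y) (h2 : r x = r y) :
    x = y := by
  apply h.isEvenUnimodular.unimodular.1
  ext z
  have := h.form x z
  rw [h1, h2, ← h.form] at this
  exact_mod_cast this

theorem span_left (h : IsNarainPair B l r) : Submodule.span ℝ (Set.range l) = ⊤ := by
  have h1 : Set.range l = (LinearMap.fst ℝ ℍ[ℝ] ℍ[ℝ]) '' Set.range (l.prod r) := by
    rw [← Set.range_comp]; rfl
  rw [h1, Submodule.span_image, h.span, Submodule.map_top,
    LinearMap.range_eq_top.2 LinearMap.fst_surjective]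

theorem exists_left_ne_zero (h : IsNarainPair B l r) : ∃ x, l x ≠ 0 := by
  by_contra! h1
  have h2 := h.span_left
  rw [Submodule.span_eq_bot.2 (by rintro _ ⟨x, rfl⟩; exact h1 x)] at h2
  exact bot_ne_top h2

/-- A vector all of whose products are divisible by `n` is divisible by `n`. -/
theorem exists_smul_eq (h : IsNarainPair B l r) {n : ℤ} (hn : n ≠ 0) {x : Γ}
    (hx : ∀ y, n ∣ B x y) : ∃ z, x = n • z := by
  choose q hq using hx
  let ψ : Module.Dual ℤ Γ :=
    { toFun := q
      map_add' := fun y z => by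
        apply mul_left_cancel₀ hn
        rw [mul_add, ← hq, ← hq, ← hq, map_add]
      map_smul' := fun c y => by
        apply mul_left_cancel₀ hn
        rw [← hq, map_smul, hq, smul_eq_mul, smul_eq_mul, RingHom.id_apply]; ring }
  obtain ⟨z, hz⟩ := h.isEvenUnimodular.unimodular.2 ψ
  refine ⟨z, h.isEvenUnimodular.unimodular.1 ?_⟩
  ext y
  rw [map_smul, hz, hq]
  simp [ψ]

/-- The trace of an endomorphism that is scalar on both summands. -/
theorem trace_eq [Module.Free ℤ Γ] [Module.Finite ℤ Γ] (h : IsNarainPair B l r)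
    {f : Module.End ℤ Γ} {t s : ℝ} (h1 : ∀ x, l (f x) = t • l x) (h2 : ∀ x, r (f x) = s • r x) :
    ((LinearMap.trace ℤ Γ f : ℤ) : ℝ) = 4 * (t + s) := by
  classical
  let b := Module.finBasis ℤ Γ
  let φ := l.prod r
  have hli : LinearIndependent ℝ (φ ∘ b) :=
    h.isEvenUnimodular.linearIndependent b φ
      ((innerₗ ℍ[ℝ]).compl₁₂ (LinearMap.fst ℝ ℍ[ℝ] ℍ[ℝ]) (LinearMap.fst ℝ ℍ[ℝ] ℍ[ℝ]) -
        (innerₗ ℍ[ℝ]).compl₁₂ (LinearMap.snd ℝ ℍ[ℝ] ℍ[ℝ]) (LinearMap.snd ℝ ℍ[ℝ] ℍ[ℝ]))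
      (fun x y => by simp [φ, h.form])
  have hsp : ⊤ ≤ Submodule.span ℝ (Set.range (φ ∘ b)) := by
    rw [← h.span, Submodule.span_le]
    rintro _ ⟨x, rfl⟩
    rw [← b.sum_repr x, map_sum]
    refine Submodule.sum_mem _ fun i _ => ?_
    rw [map_zsmul]
    exact zsmul_mem (Submodule.subset_span (Set.mem_range_self i)) _
  let e := Module.Basis.mk hli hsp
  have he : ∀ i, e i = φ (b i) := fun i => by simp [e]
  let g : Module.End ℝ (ℍ[ℝ] × ℍ[ℝ]) := (t • LinearMap.id).prodMap (s • LinearMap.id)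
  have hg : LinearMap.trace ℝ _ g = 4 * (t + s) := by
    rw [LinearMap.trace_prodMap', map_smul, map_smul, LinearMap.trace_id,
      Quaternion.finrank_eq_four]
    simp; ring
  have hgφ : ∀ x, g (φ x) = φ (f x) := fun x => by
    ext1 <;> simp [g, φ, h1, h2]
  have hm : LinearMap.toMatrix e e g = (LinearMap.toMatrix b b f).map (Int.castRingHom ℝ) := by
    ext i j
    rw [LinearMap.toMatrix_apply, he, hgφ, Matrix.map_apply, LinearMap.toMatrix_apply]
    have h3 : φ (f (b j)) = ∑ k, (b.repr (f (b j)) k : ℝ) • e k := by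
      conv_lhs => rw [← b.sum_repr (f (b j)), map_sum]
      refine Finset.sum_congr rfl fun k _ => ?_
      rw [map_zsmul, he, Int.cast_smul_eq_zsmul]
    rw [h3, e.repr_sum_self]
    rfl
  rw [← hg, LinearMap.trace_eq_matrix_trace ℝ e, hm, LinearMap.trace_eq_matrix_trace ℤ b]
  simp [Matrix.trace]

/-- By Cayley–Hamilton the characteristic polynomial of f kills a vector with nonzero left
projection, so t is one of its roots. -/
theorem isIntegral_left [Module.Free ℤ Γ] [Module.Finite ℤ Γ] (h : IsNarainPair B l r)
    {f : Module.End ℤ Γ} {t : ℝ} (h1 : ∀ x, l (f x) = t • l x) : IsIntegral ℤ t := by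
  obtain ⟨x, hx⟩ := h.exists_left_ne_zero
  refine ⟨f.charpoly, f.charpoly_monic, ?_⟩
  have hpow : ∀ (n : ℕ) x, l ((f ^ n) x) = t ^ n • l x := by
    intro n x
    induction n with
    | zero => simp
    | succ n ih => rw [pow_succ', Module.End.mul_apply, h1, ih, smul_smul, pow_succ']
  have h2 : ∀ (p : Polynomial ℤ) x, l (Polynomial.aeval f p x) = Polynomial.aeval t p • l x := by
    intro p x
    induction p using Polynomial.induction_on' with
    | add p q hp hq => simp [hp, hq, add_smul]
    | monomial n a =>
      rw [Polynomial.aeval_monomial, Polynomial.aeval_monomial, ← Algebra.smul_def,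
        ← Algebra.smul_def, LinearMap.smul_apply, map_zsmul, hpow, smul_assoc]
  have h3 := h2 f.charpoly x
  rw [LinearMap.aeval_self_charpoly, LinearMap.zero_apply, map_zero] at h3
  exact (smul_eq_zero.1 h3.symm).resolve_right hx

end IsNarainPair

/-- A rational algebraic integer is an integer. -/
theorem exists_int_of_isIntegral {t : ℝ} (ht : IsIntegral ℤ t) {q : ℚ} (hq : t = q) :
    ∃ n : ℤ, t = n := by
  rw [hq] at ht
  have h1 : IsIntegral ℤ q :=
    (isIntegral_algebraMap_iff (R := ℤ) (A := ℚ) (B := ℝ) (algebraMap ℚ ℝ).injective).1 ht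
  obtain ⟨n, hn⟩ := IsIntegrallyClosed.isIntegral_iff.1 h1
  exact ⟨n, by rw [hq, ← hn]; simp⟩

namespace IsNarainPair

variable {Γ : Type*} [AddCommGroup Γ] [Module.Free ℤ Γ] [Module.Finite ℤ Γ]
  {B : LinearMap.BilinForm ℤ Γ} {l r : Γ →ₗ[ℤ] ℍ[ℝ]}

/-- The scalars are algebraic integers. Their sum is a quarter of the trace of f, and their product
follows from the traces of f and f², so both are rational. -/
theorem int_of_scalars (h : IsNarainPair B l r)
    {f : Module.End ℤ Γ} {t s : ℝ} (h1 : ∀ x, l (f x) = t • l x) (h2 : ∀ x, r (f x) = s • r x) :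
    (∃ n : ℤ, t + s = n) ∧ (∃ n : ℤ, t * s = n) ∧ (t = s → ∃ n : ℤ, t = n) := by
  have ht := h.isIntegral_left h1
  have hs := h.swap.isIntegral_left h2
  have h3 := h.trace_eq h1 h2
  have h4 := h.trace_eq (f := f * f) (t := t * t) (s := s * s)
    (fun x => by rw [Module.End.mul_apply, h1, h1, smul_smul])
    (fun x => by rw [Module.End.mul_apply, h2, h2, smul_smul])
  refine ⟨?_, ?_, ?_⟩
  · refine exists_int_of_isIntegral (ht.add hs) (q := (LinearMap.trace ℤ Γ f : ℤ) / 4) ?_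
    push_cast; rw [h3]; ring
  · refine exists_int_of_isIntegral (ht.mul hs)
      (q := (((LinearMap.trace ℤ Γ f : ℤ) / 4) ^ 2 - (LinearMap.trace ℤ Γ (f * f) : ℤ) / 4) / 2) ?_
    push_cast; rw [h3, h4]; ring
  · rintro rfl
    refine exists_int_of_isIntegral ht (q := (LinearMap.trace ℤ Γ f : ℤ) / 8) ?_
    push_cast; rw [h3]; ring

end IsNarainPair

end NarainPair

/-! ### Symmetries excluded by unimodularity. -/

section NarainSymmetries

open Quaternion

theorem Quaternion.inner_mul_left (a v q : ℍ[ℝ]) :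
    inner ℝ v (a * q) = (v * star q * star a).re := by
  rw [inner_def, star_mul, mul_assoc]

namespace IsNarainPair

variable {Γ : Type*} [AddCommGroup Γ] {B : LinearMap.BilinForm ℤ Γ} {l r : Γ →ₗ[ℤ] ℍ[ℝ]}

/-- A lattice of this kind has no symmetry that is a primitive sixth root of unity on one side and
trivial on the other. -/
theorem not_sixth [Module.Free ℤ Γ] [Module.Finite ℤ Γ] (h : IsNarainPair B l r) {a : ℍ[ℝ]}
    (ha : normSq a = 1) (ha' : 2 * a.re = 1) (f : Γ →ₗ[ℤ] Γ) (hl : ∀ k, l (f k) = a * l k)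
    (hr : ∀ k, r (f k) = r k) : False := by
  let L : Submodule ℤ Γ := LinearMap.ker r
  have haa : a * a = a - 1 := by rw [mul_self_eq ha, ha', one_smul]
  -- Since a - a² = 1 for a primitive sixth root of unity, this is the projection to Π_L, and it
  -- preserves the lattice. The lattice thus splits, and its left part is even, unimodular, definite
  -- and of rank four.
  let π : Γ →ₗ[ℤ] Γ := f - f ∘ₗ f
  have hπl : ∀ k, l (π k) = l k := by
    intro k
    simp only [π, LinearMap.sub_apply, LinearMap.comp_apply, map_sub, hl]
    rw [← mul_assoc, haa, sub_mul, one_mul, sub_sub_cancel]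
  have hπr : ∀ k, r (π k) = 0 := fun k => by simp [π, hr]
  have hform : ∀ x : Γ, ∀ y : L, (B x y : ℝ) = inner ℝ (l x) (l y) := fun x y => by
    rw [h.form, LinearMap.mem_ker.1 y.2, inner_zero_right, sub_zero]
  let BL : LinearMap.BilinForm ℤ L := B.restrict L
  have hBL : IsEvenUnimodular BL := by
    refine ⟨fun x y => h.isEvenUnimodular.symm x y, fun x => h.isEvenUnimodular.even x, ?_, ?_⟩
    · rw [injective_iff_map_eq_zero]
      intro x hx
      have h1 := hform x x
      rw [show B x x = BL x x from rfl, hx, LinearMap.zero_apply, Int.cast_zero, eq_comm,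
        inner_self_eq_zero] at h1
      ext1
      exact h.eq_of_left_eq (by rw [h1]; simp) (by rw [LinearMap.mem_ker.1 x.2]; simp)
    -- The functional ψ ∘ π on the whole lattice is represented by some z, and then π z represents ψ
    -- on the left part.
    · intro ψ
      obtain ⟨z, hz⟩ := h.isEvenUnimodular.unimodular.2
        (ψ ∘ₗ π.codRestrict L fun k => LinearMap.mem_ker.2 (hπr k))
      refine ⟨⟨π z, LinearMap.mem_ker.2 (hπr z)⟩, LinearMap.ext fun y => ?_⟩
      have h1 : B (π z) y = B z y := by
        have := hform (π z) y
        rw [hπl, ← hform] at this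
        exact_mod_cast this
      change B (π z) y = ψ y
      rw [h1, hz, LinearMap.comp_apply]
      congr 1
      ext1
      exact h.eq_of_left_eq (hπl _) ((hπr _).trans (LinearMap.mem_ker.1 y.2).symm)
  let τ := linearIsometryEquivTuple
  refine not_isEvenUnimodular_of_euclidean hBL
    ((τ : ℍ[ℝ] →+ EuclideanSpace ℝ (Fin 4)).toIntLinearMap ∘ₗ l ∘ₗ L.subtype)
    (fun x y => ?_) ?_
  · exact (τ.inner_map_map _ _).trans (hform x y).symm
  · have h1 : Set.range ((τ : ℍ[ℝ] →+ EuclideanSpace ℝ (Fin 4)).toIntLinearMap ∘ₗ l ∘ₗ L.subtype) =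
        (τ.toLinearEquiv : ℍ[ℝ] →ₗ[ℝ] EuclideanSpace ℝ (Fin 4)) '' Set.range l := by
      ext v
      constructor
      · rintro ⟨x, rfl⟩
        exact ⟨_, ⟨x, rfl⟩, rfl⟩
      · rintro ⟨_, ⟨x, rfl⟩, rfl⟩
        exact ⟨⟨π x, LinearMap.mem_ker.2 (hπr x)⟩, congrArg τ (hπl x)⟩
    rw [h1, Submodule.span_image, h.span_left, Submodule.map_top, LinearEquiv.range]

/-- If `(-1, 1)` is a symmetry, then a binary dihedral group of order twelve cannot act on the left
side. -/
theorem not_dicyclic (h : IsNarainPair B l r) {e f f' g : Γ →ₗ[ℤ] Γ}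
    (hel : ∀ k, l (e k) = -l k) (her : ∀ k, r (e k) = r k) {a b c d : ℍ[ℝ]} (ha : normSq a = 1)
    (hc : normSq c = 1) (ha' : 2 * a.re = -1) (hc' : c.re = 0) (hac : (a * c).re = 0)
    (hfl : ∀ k, l (f k) = a * l k) (hfr : ∀ k, r (f k) = b * r k)
    (hfl' : ∀ k, l (f' k) = star a * l k) (hfr' : ∀ k, r (f' k) = star b * r k)
    (hgl : ∀ k, l (g k) = c * l k) (hgr : ∀ k, r (g k) = d * r k) : False := by
  have hform : ∀ x y, r y = 0 → (B x y : ℝ) = inner ℝ (l x) (l y) := fun x y hy => by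
    rw [h.form, hy, inner_zero_right, sub_zero]
  -- The left sublattice is unimodular at 3: y - e y is twice the left part of y, so divisibility by
  -- 3 on the sublattice extends to all of Γ, where x is then divisible by 3.
  have hdiv : ∀ x, r x = 0 → (∀ y, r y = 0 → (3 : ℤ) ∣ B x y) → ∃ z, r z = 0 ∧ x = (3 : ℤ) • z := by
    intro x hx hxy
    obtain ⟨z, hz⟩ := h.exists_smul_eq (n := 3) (by norm_num) (x := x) (fun y => by
      have h1 := hxy (y - e y) (by rw [map_sub, her, sub_self])
      have h2 : B x (y - e y) = 2 * B x y := by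
        rw [h.isEvenUnimodular.symm, h.isEvenUnimodular.symm x y]
        have := hform (y - e y) x hx
        rw [map_sub l, hel, sub_neg_eq_add, inner_add_left, ← hform _ _ hx, ← two_mul] at this
        exact_mod_cast this
      rw [h2] at h1
      exact (Int.Prime.dvd_mul' (p := 3) (by norm_num) h1).resolve_left (by norm_num))
    refine ⟨z, ?_, hz⟩
    rw [hz, map_zsmul, ← Int.cast_smul_eq_zsmul ℝ] at hx
    exact (smul_eq_zero.1 hx).resolve_left (by norm_num)
  have hnn : ∀ x, r x = 0 → 0 ≤ B x x := fun x hx => by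
    have := hform x x hx
    have h0 : (0 : ℝ) ≤ B x x := by rw [this]; exact real_inner_self_nonneg
    exact_mod_cast h0
  -- Otherwise polarization makes every product on the sublattice divisible by 3, so every vector of
  -- it is divisible by 3, and descent on the norm kills it.
  obtain ⟨x, hx, hx3⟩ : ∃ x, r x = 0 ∧ ¬ (3 : ℤ) ∣ B x x := by
    by_contra! hcon
    have hall : ∀ x, r x = 0 → ∃ z, r z = 0 ∧ x = (3 : ℤ) • z := by
      intro x hx
      refine hdiv x hx fun y hy => ?_
      have h1 := hcon (x + y) (by rw [map_add, hx, hy, add_zero])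
      simp only [map_add, LinearMap.add_apply, h.isEvenUnimodular.symm y x] at h1
      have h2 := hcon x hx
      have h3 := hcon y hy
      omega
    have hzero : ∀ n : ℕ, ∀ x, r x = 0 → (B x x).toNat = n → l x = 0 := by
      intro n
      induction n using Nat.strong_induction_on with
      | _ n ih =>
        intro x hx hn
        by_contra hlx
        obtain ⟨z, hz, rfl⟩ := hall x hx
        have hpos : 0 < B z z := by
          have : (0 : ℝ) < B z z := by
            rw [hform z z hz]
            refine real_inner_self_pos.2 fun h0 => hlx ?_
            rw [map_zsmul, h0, smul_zero]
          exact_mod_cast this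
        simp only [map_smul, LinearMap.smul_apply, smul_eq_mul] at hn
        refine hlx ?_
        rw [map_zsmul, ih _ (by omega) z hz rfl, smul_zero]
    obtain ⟨x, hx⟩ := h.exists_left_ne_zero
    have h1 := hzero _ (x - e x) (by rw [map_sub, her, sub_self]) rfl
    rw [map_sub, hel, sub_neg_eq_add, ← two_smul ℝ] at h1
    exact hx ((smul_eq_zero.1 h1).resolve_left two_ne_zero)
  set θ := a - star a with hθ
  have hθa : θ = (2 : ℝ) • a + 1 := by
    ext <;> simp [hθ] <;> linarith
  have hθ0 : θ.re = 0 := by simp [hθ]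
  have hθn : normSq θ = 3 := by
    have h1 : normSq a = a.re ^ 2 + a.imI ^ 2 + a.imJ ^ 2 + a.imK ^ 2 := normSq_def' a
    rw [normSq_def', hθa]
    simp
    nlinarith
  obtain ⟨κ, hκ⟩ : ∃ κ : ℝ, κ ^ 2 = 1 / 3 := ⟨√(1 / 3), Real.sq_sqrt (by norm_num)⟩
  have hframe : IsFrame c (κ • θ) := by
    refine ⟨hc, ?_, hc', ?_, ?_⟩
    · rw [Quaternion.normSq_smul, hθn, hκ]; norm_num
    · rw [re_smul, hθ0, smul_zero]
    · rw [mul_smul_comm, re_smul, hθa, mul_add, mul_smul_comm, mul_one, re_add, re_smul,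
        re_mul_comm, hac, hc']; simp
  let T : Γ →ₗ[ℤ] Γ := f - f'
  have hTl : ∀ k, l (T k) = θ * l k := fun k => by simp [T, hfl, hfl', hθ, sub_mul]
  have hTr : ∀ k, r k = 0 → r (T k) = 0 := fun k hk => by simp [T, hfr, hfr', hk]
  have hgr' : ∀ k, r k = 0 → r (g k) = 0 := fun k hk => by rw [hgr, hk, mul_zero]
  -- T acts on the left as θ with θ² = -3. Parseval in the frame c, θ/√3 shows that 3 divides B(y,
  -- θx)² + B(y, cθx)²; as -1 is not a square modulo 3, it divides both terms. Then θx = 3z, and 3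
  -- B(x, x) = 9 B(z, z).
  have hTdiv : ∀ y, r y = 0 → (3 : ℤ) ∣ B (T x) y := by
    intro y hy
    have h1 := hframe.parseval (l y * star (l x))
    rw [map_mul, normSq_star, mul_smul_comm, Quaternion.star_smul, Quaternion.star_smul,
      mul_smul_comm, mul_smul_comm,
      re_smul, re_smul, ← inner_mul_left, ← inner_mul_left, ← inner_mul_left, ← inner_def,
      ← inner_self, ← inner_self, mul_assoc c, ← hTl, ← hgl, ← hgl, ← hform _ _ hx,
      ← hform _ _ (hgr' _ hx), ← hform _ _ (hTr _ hx), ← hform _ _ (hgr' _ (hTr _ hx)),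
      ← hform _ _ hx, ← hform _ _ hy, smul_eq_mul, smul_eq_mul, mul_pow, mul_pow, hκ] at h1
    have h2 : 3 * B y x ^ 2 + 3 * B y (g x) ^ 2 + B y (T x) ^ 2 + B y (g (T x)) ^ 2 =
        3 * (B y y * B x x) := by
      have : (3 * B y x ^ 2 + 3 * B y (g x) ^ 2 + B y (T x) ^ 2 + B y (g (T x)) ^ 2 : ℝ) =
        3 * (B y y * B x x) := by linarith
      exact_mod_cast this
    rw [h.isEvenUnimodular.symm]
    generalize B y (T x) = p at h2 ⊢
    generalize B y (g (T x)) = q at h2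
    have h3 : (3 : ℤ) ∣ p ^ 2 + q ^ 2 :=
      ⟨B y y * B x x - B y x ^ 2 - B y (g x) ^ 2, by linarith⟩
    rw [Int.dvd_iff_emod_eq_zero] at h3 ⊢
    rcases (by omega : p % 3 = 0 ∨ p % 3 = 1 ∨ p % 3 = 2) with h4 | h4 | h4 <;>
    rcases (by omega : q % 3 = 0 ∨ q % 3 = 1 ∨ q % 3 = 2) with h5 | h5 | h5 <;>
    simp [pow_two, Int.add_emod, Int.mul_emod, h4, h5] at h3 ⊢
  obtain ⟨z, hz, hTz⟩ := hdiv (T x) (hTr x hx) hTdiv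
  refine hx3 ⟨B z z, ?_⟩
  have h1 : (B (T x) (T x) : ℝ) = 3 * B x x := by
    rw [hform _ _ (hTr x hx), hTl, inner_self, map_mul, hθn, hform _ _ hx, inner_self]
  have h2 : B (T x) (T x) = 9 * B z z := by
    rw [hTz]; simp only [map_smul, LinearMap.smul_apply, smul_eq_mul]; ring
  have h3 : B (T x) (T x) = 3 * B x x := by exact_mod_cast h1
  omega

end IsNarainPair

end NarainSymmetries

/-! ### From SU(2) × SU(2) to unit quaternions, and the theorem. -/

section WindingMomentum

open Quaternion

/-- The pairs of unit quaternions that preserve a lattice of signature `(4, 4)`. -/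
def narainSymmetries {Γ : Type*} [AddCommGroup Γ] (l r : Γ →ₗ[ℤ] ℍ[ℝ]) : Set (ℍ[ℝ] × ℍ[ℝ]) :=
  {x | normSq x.1 = 1 ∧ normSq x.2 = 1 ∧
    ∃ f : Γ ≃ₗ[ℤ] Γ, ∀ k, l (f k) = x.1 * l k ∧ r (f k) = x.2 * r k}

section

variable {Γ : Type*} [AddCommGroup Γ] {B : LinearMap.BilinForm ℤ Γ} {l r : Γ →ₗ[ℤ] ℍ[ℝ]}

theorem swap_mem_narainSymmetries {x : ℍ[ℝ] × ℍ[ℝ]} (hx : x ∈ narainSymmetries l r) :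
    x.swap ∈ narainSymmetries r l := by
  obtain ⟨h1, h2, f, hf⟩ := hx
  exact ⟨h2, h1, f, fun k => (hf k).symm⟩

theorem symm_apply_of_forall {l : Γ →ₗ[ℤ] ℍ[ℝ]} {a : ℍ[ℝ]} (ha : normSq a = 1) {f : Γ ≃ₗ[ℤ] Γ}
    (hf : ∀ k, l (f k) = a * l k) (k : Γ) : l (f.symm k) = star a * l k := by
  conv_rhs => rw [← f.apply_symm_apply k, hf, ← mul_assoc, star_mul_of_normSq ha, one_mul]

theorem star_mem_narainSymmetries {x : ℍ[ℝ] × ℍ[ℝ]} (hx : x ∈ narainSymmetries l r) :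
    star x ∈ narainSymmetries l r := by
  obtain ⟨h1, h2, f, hf⟩ := hx
  exact ⟨by simpa using h1, by simpa using h2, f.symm, fun k =>
    ⟨symm_apply_of_forall h1 (fun k => (hf k).1) k, symm_apply_of_forall h2 (fun k => (hf k).2) k⟩⟩

theorem neg_mem_narainSymmetries {x : ℍ[ℝ] × ℍ[ℝ]} (hx : x ∈ narainSymmetries l r) :
    -x ∈ narainSymmetries l r := by
  obtain ⟨h1, h2, f, hf⟩ := hx
  exact ⟨by simpa using h1, by simpa using h2, f.trans (LinearEquiv.neg ℤ), fun k => by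
    simp [(hf k).1, (hf k).2]⟩

/-- The endomorphism f + f⁻¹ acts by a + a* = 2 Re a on the left and by 2 Re b on the right. -/
theorem IsNarainPair.int_of_mem [Module.Free ℤ Γ] [Module.Finite ℤ Γ] (h : IsNarainPair B l r)
    {x : ℍ[ℝ] × ℍ[ℝ]} (hx : x ∈ narainSymmetries l r) :
    (∃ n : ℤ, 2 * x.1.re + 2 * x.2.re = n) ∧ (∃ n : ℤ, 2 * x.1.re * (2 * x.2.re) = n) ∧
      (2 * x.1.re = 2 * x.2.re → ∃ n : ℤ, 2 * x.1.re = n) := by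
  obtain ⟨h1, h2, f, hf⟩ := hx
  have key : ∀ a v : ℍ[ℝ], a * v + star a * v = (2 * a.re) • v := fun a v => by
    rw [← add_mul, self_add_star', ← Quaternion.coe_mul_eq_smul]
  refine h.int_of_scalars (f := (f : Γ →ₗ[ℤ] Γ) + (f.symm : Γ →ₗ[ℤ] Γ)) (fun k => ?_) (fun k => ?_)
  · rw [← key, LinearMap.add_apply, map_add]
    exact congrArg₂ _ (hf k).1 (symm_apply_of_forall h1 (fun k => (hf k).1) k)
  · rw [← key, LinearMap.add_apply, map_add]
    exact congrArg₂ _ (hf k).2 (symm_apply_of_forall h2 (fun k => (hf k).2) k)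

theorem IsNarainPair.not_sixth_of_mem [Module.Free ℤ Γ] [Module.Finite ℤ Γ]
    (h : IsNarainPair B l r) {x : ℍ[ℝ] × ℍ[ℝ]} (hx : x ∈ narainSymmetries l r)
    (h1 : 2 * x.1.re = 1) (h2 : x.2 = 1) : False := by
  obtain ⟨hx1, _, f, hf⟩ := hx
  exact h.not_sixth hx1 h1 f (fun k => (hf k).1) fun k => (hf k).2.trans (by rw [h2, one_mul])

theorem IsNarainPair.not_dicyclic_of_mem (h : IsNarainPair B l r)
    (he : ((-1, 1) : ℍ[ℝ] × ℍ[ℝ]) ∈ narainSymmetries l r) {x y : ℍ[ℝ] × ℍ[ℝ]}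
    (hx : x ∈ narainSymmetries l r) (hy : y ∈ narainSymmetries l r) (h1 : 2 * x.1.re = -1)
    (h2 : y.1.re = 0) (h3 : (x.1 * y.1).re = 0) : False := by
  obtain ⟨_, _, e, he⟩ := he
  obtain ⟨hx1, hx2, f, hf⟩ := hx
  obtain ⟨hy1, _, g, hg⟩ := hy
  exact h.not_dicyclic (e := e) (f := f) (f' := f.symm) (g := g)
    (fun k => (he k).1.trans (neg_one_mul _)) (fun k => (he k).2.trans (one_mul _)) hx1 hy1 h1 h2 h3
    (fun k => (hf k).1) (fun k => (hf k).2) (symm_apply_of_forall hx1 fun k => (hf k).1)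
    (symm_apply_of_forall hx2 fun k => (hf k).2) (fun k => (hg k).1) fun k => (hg k).2

theorem IsNarainPair.isAdmissible [Module.Free ℤ Γ] [Module.Finite ℤ Γ] (h : IsNarainPair B l r) :
    IsAdmissible (narainSymmetries l r) where
  one_mem := ⟨by simp, by simp, LinearEquiv.refl ℤ Γ, fun k => by simp⟩
  mul_mem := by
    rintro x ⟨h1, h2, f, hf⟩ y ⟨h1', h2', g, hg⟩
    exact ⟨by simp [h1, h1'], by simp [h2, h2'], g.trans f, fun k => by
      simp [(hf _).1, (hf _).2, (hg _).1, (hg _).2, mul_assoc]⟩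
  star_mem x hx := star_mem_narainSymmetries hx
  neg_mem x hx := neg_mem_narainSymmetries hx
  normSq₁ x hx := hx.1
  normSq₂ x hx := hx.2.1
  add_int x hx := (h.int_of_mem hx).1
  mul_int x hx := (h.int_of_mem hx).2.1
  int_of_eq x hx he := (h.int_of_mem hx).2.2 (by rw [he])
  not_sixth₁ x hx := h.not_sixth_of_mem hx
  not_sixth₂ x hx h1 h2 := h.swap.not_sixth_of_mem (swap_mem_narainSymmetries hx) h2 h1
  not_dicyclic₁ he x hx y hy := h.not_dicyclic_of_mem he hx hy
  not_dicyclic₂ he x hx y hy := h.swap.not_dicyclic_of_mem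
    (by simpa using swap_mem_narainSymmetries (neg_mem_narainSymmetries he))
    (swap_mem_narainSymmetries hx) (swap_mem_narainSymmetries hy)

end

/-- The identification of `ℂ²` with the quaternions for which `SU(2)` acts by left
multiplication. -/
def quaternionOfDoublet : (Fin 2 → ℂ) ≃ₗ[ℝ] ℍ[ℝ] where
  toFun z := mkQ (z 0).re (z 0).im (-(z 1).re) (z 1).im
  map_add' z w := by ext <;> simp; ring
  map_smul' c z := by ext <;> simp
  invFun q := ![⟨q.re, q.imI⟩, ⟨-q.imJ, q.imK⟩]
  left_inv z := by
    ext i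
    fin_cases i <;> simp
  right_inv q := by ext <;> simp

theorem normSq_quaternionOfDoublet (z : Fin 2 → ℂ) :
    normSq (quaternionOfDoublet z) = ∑ i, Complex.normSq (z i) := by
  rw [normSq_def', Fin.sum_univ_two, Complex.normSq_apply, Complex.normSq_apply]
  simp [quaternionOfDoublet]
  ring

/-- The adjoint of an element of SU(2) is its adjugate, so the first row determines the matrix and
supplies the four coordinates of the quaternion. -/
theorem exists_quaternion_of_mem_specialUnitaryGroup {u : Matrix (Fin 2) (Fin 2) ℂ}
    (hu : u ∈ Matrix.specialUnitaryGroup (Fin 2) ℂ) :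
    ∃ a : ℍ[ℝ], normSq a = 1 ∧
      ∀ z, quaternionOfDoublet (u *ᵥ z) = a * quaternionOfDoublet z := by
  obtain ⟨h1, h2⟩ := Matrix.mem_specialUnitaryGroup_iff.1 hu
  have h3 : star u = u.adjugate := by
    have h4 := Matrix.adjugate_mul u
    rw [h2, one_smul] at h4
    calc star u = u.adjugate * u * star u := by rw [h4, one_mul]
      _ = u.adjugate := by rw [mul_assoc, Matrix.mem_unitaryGroup_iff.1 h1, mul_one]
  rw [Matrix.adjugate_fin_two] at h3
  have h00 : star (u 0 0) = u 1 1 := by simpa using congrFun (congrFun h3 0) 0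
  have h01 : star (u 0 1) = -u 1 0 := by simpa using congrFun (congrFun h3 1) 0
  have h10 : u 1 0 = -star (u 0 1) := by rw [h01, neg_neg]
  refine ⟨mkQ (u 0 0).re (u 0 0).im (u 0 1).re (u 0 1).im, ?_, fun z => ?_⟩
  · rw [Matrix.det_fin_two, h10, ← h00] at h2
    have := congrArg Complex.re h2
    simp at this
    rw [normSq_def']
    simp
    linarith
  · ext <;> simp [quaternionOfDoublet, h10, ← h00] <;>
      ring

namespace NarainDecomposition.ComplexFrame

variable {Γ : Type*} [AddCommGroup Γ] {B : LinearMap.BilinForm ℤ Γ} {D : NarainDecomposition B}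

/-- The identification of `Π` with pairs of quaternions. -/
noncomputable def toPair (F : D.ComplexFrame) : (ℝ ⊗[ℤ] Γ) ≃ₗ[ℝ] ℍ[ℝ] × ℍ[ℝ] :=
  (Submodule.prodEquivOfIsCompl D.left D.right D.isCompl).symm.trans
    ((F.toL.trans quaternionOfDoublet).prodCongr (F.toR.trans quaternionOfDoublet))

theorem toPair_add (F : D.ComplexFrame) (x : D.left) (y : D.right) :
    F.toPair ((x : ℝ ⊗[ℤ] Γ) + y) =
      (quaternionOfDoublet (F.toL x), quaternionOfDoublet (F.toR y)) := by
  have : (Submodule.prodEquivOfIsCompl D.left D.right D.isCompl).symm ((x : ℝ ⊗[ℤ] Γ) + y) =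
      (x, y) := by
    rw [LinearEquiv.symm_apply_eq]; simp
  simp [toPair, this]

theorem exists_add_eq (D : NarainDecomposition B) (v : ℝ ⊗[ℤ] Γ) :
    ∃ (x : D.left) (y : D.right), v = (x : ℝ ⊗[ℤ] Γ) + y := by
  refine ⟨((Submodule.prodEquivOfIsCompl D.left D.right D.isCompl).symm v).1,
    ((Submodule.prodEquivOfIsCompl D.left D.right D.isCompl).symm v).2, ?_⟩
  rw [← Submodule.coe_prodEquivOfIsCompl' D.left D.right D.isCompl, LinearEquiv.apply_symm_apply]

theorem exists_toPair_eq (F : D.ComplexFrame) {g : (ℝ ⊗[ℤ] Γ) ≃ₗ[ℝ] (ℝ ⊗[ℤ] Γ)}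
    (hg : g ∈ SU2A F) : ∃ p : ℍ[ℝ] × ℍ[ℝ], normSq p.1 = 1 ∧ normSq p.2 = 1 ∧
      ∀ v, F.toPair (g v) = p * F.toPair v := by
  obtain ⟨u, hu, w, hw, h1, h2⟩ := hg
  obtain ⟨a, ha, hua⟩ := exists_quaternion_of_mem_specialUnitaryGroup hu
  obtain ⟨b, hb, hwb⟩ := exists_quaternion_of_mem_specialUnitaryGroup hw
  refine ⟨(a, b), ha, hb, fun v => ?_⟩
  obtain ⟨x, y, rfl⟩ := exists_add_eq D v
  rw [map_add, h1, h2, toPair_add, toPair_add, LinearEquiv.apply_symm_apply,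
    LinearEquiv.apply_symm_apply, hua, hwb]
  rfl

theorem baseChange_self (hB : IsEvenUnimodular B) (F : D.ComplexFrame) (v : ℝ ⊗[ℤ] Γ) :
    B.baseChange ℝ v v = normSq (F.toPair v).1 - normSq (F.toPair v).2 := by
  have hs : LinearMap.IsSymm (B.baseChange ℝ) := LinearMap.BilinForm.IsSymm.baseChange ℝ ⟨hB.symm⟩
  obtain ⟨x, y, rfl⟩ := exists_add_eq D v
  have h1 := D.orthogonal x x.2 y y.2
  have h2 : B.baseChange ℝ y x = 0 := (hs.eq y x).trans h1
  rw [toPair_add, normSq_quaternionOfDoublet, normSq_quaternionOfDoublet, F.normSq_toL,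
    F.normSq_toR]
  simp only [map_add, LinearMap.add_apply, h1, h2]
  ring

/-- The projection of the lattice to `Π_L`. -/
noncomputable def projL (F : D.ComplexFrame) : Γ →ₗ[ℤ] ℍ[ℝ] :=
  (LinearMap.fst ℝ ℍ[ℝ] ℍ[ℝ] ∘ₗ F.toPair.toLinearMap).restrictScalars ℤ ∘ₗ TensorProduct.mk ℤ ℝ Γ 1

/-- The projection of the lattice to `Π_R`. -/
noncomputable def projR (F : D.ComplexFrame) : Γ →ₗ[ℤ] ℍ[ℝ] :=
  (LinearMap.snd ℝ ℍ[ℝ] ℍ[ℝ] ∘ₗ F.toPair.toLinearMap).restrictScalars ℤ ∘ₗ TensorProduct.mk ℤ ℝ Γ 1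

theorem isNarainPair (hB : IsEvenUnimodular B) (F : D.ComplexFrame) :
    IsNarainPair B F.projL F.projR where
  isEvenUnimodular := hB
  form x y := by
    -- The frame only records square lengths, so the bilinear identity is recovered by polarization.
    have key : ∀ z, (B z z : ℝ) = inner ℝ (F.projL z) (F.projL z) -
        inner ℝ (F.projR z) (F.projR z) := fun z => by
      have := F.baseChange_self hB (1 ⊗ₜ z)
      rw [LinearMap.BilinForm.baseChange_tmul] at this
      rw [inner_self, inner_self]
      rw [mul_one, zsmul_one] at this
      exact this
    have h1 := key (x + y)
    simp only [map_add, LinearMap.add_apply, inner_add_left, inner_add_right, hB.symm y x] at h1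
    rw [real_inner_comm (F.projL x) (F.projL y), real_inner_comm (F.projR x) (F.projR y)] at h1
    push_cast at h1
    linarith [key x, key y]
  span := by
    have h1 : Set.range (F.projL.prod F.projR) =
        (F.toPair : (ℝ ⊗[ℤ] Γ) →ₗ[ℝ] ℍ[ℝ] × ℍ[ℝ]) '' Set.range (TensorProduct.mk ℤ ℝ Γ 1) := by
      rw [← Set.range_comp]; rfl
    have h2 : Submodule.span ℝ (Set.range (TensorProduct.mk ℤ ℝ Γ 1)) = ⊤ := by
      rw [eq_top_iff]
      rintro v -
      induction v using TensorProduct.induction_on with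
      | zero => exact zero_mem _
      | tmul c k =>
        rw [show c ⊗ₜ[ℤ] k = c • (TensorProduct.mk ℤ ℝ Γ 1 k) by
          rw [TensorProduct.mk_apply, TensorProduct.smul_tmul', smul_eq_mul, mul_one]]
        exact Submodule.smul_mem _ _ (Submodule.subset_span ⟨k, rfl⟩)
      | add v w hv hw => exact add_mem hv hw
    rw [h1, Submodule.span_image, h2, Submodule.map_top, LinearEquiv.range]

/-- The homomorphism from `G₀` to pairs of unit quaternions. -/
noncomputable def pairHom (F : D.ComplexFrame) : G0 F →* ℍ[ℝ] × ℍ[ℝ] where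
  toFun g := F.toPair (g.1 (F.toPair.symm 1))
  map_one' := F.toPair.apply_symm_apply 1
  map_mul' g h := by
    obtain ⟨p, -, -, hp⟩ := F.exists_toPair_eq g.2.1
    change F.toPair (g.1 (h.1 _)) = _
    rw [hp, hp, LinearEquiv.apply_symm_apply, mul_one]

theorem toPair_apply (F : D.ComplexFrame) (g : G0 F) :
    normSq (F.pairHom g).1 = 1 ∧ normSq (F.pairHom g).2 = 1 ∧
      ∀ v, F.toPair (g.1 v) = F.pairHom g * F.toPair v := by
  obtain ⟨p, h1, h2, hp⟩ := F.exists_toPair_eq g.2.1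
  have : F.pairHom g = p :=
    (hp _).trans (by rw [LinearEquiv.apply_symm_apply, mul_one])
  rw [this]
  exact ⟨h1, h2, hp⟩

theorem pairHom_injective (F : D.ComplexFrame) : Function.Injective F.pairHom := by
  intro g h hgh
  ext v
  apply F.toPair.injective
  rw [(F.toPair_apply g).2.2, (F.toPair_apply h).2.2, hgh]

theorem pairHom_mem (F : D.ComplexFrame) (g : G0 F) :
    F.pairHom g ∈ narainSymmetries F.projL F.projR := by
  obtain ⟨h1, h2, h3⟩ := F.toPair_apply g
  obtain ⟨-, f, hf⟩ := g.2.2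
  have h4 : ∀ k, F.toPair (1 ⊗ₜ f k) = F.pairHom g * F.toPair (1 ⊗ₜ k) := fun k => by
    rw [← hf, h3]
  exact ⟨h1, h2, f, fun k => ⟨congrArg Prod.fst (h4 k), congrArg Prod.snd (h4 k)⟩⟩

end NarainDecomposition.ComplexFrame

end WindingMomentum

theorem proposition3p1 {Γ : Type*} [AddCommGroup Γ] [Module.Free ℤ Γ] [Module.Finite ℤ Γ]
    (B : LinearMap.BilinForm ℤ Γ) (hB : IsEvenUnimodular B)
    (D : NarainDecomposition B) (F : D.ComplexFrame) :
    ∃ H : Subgroup WPlusE8, Nonempty (NarainDecomposition.G0 F ≃* H) := by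
  obtain ⟨R, hR, hlat⟩ := (F.isNarainPair hB).isAdmissible.isE8Embeddable
  exact hR.exists_mulEquiv F.pairHom F.pairHom_injective (fun g => (F.toPair_apply g).1)
    (fun g => (F.toPair_apply g).2.1) fun g => hlat _ (F.pairHom_mem g)
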